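/- Let $K$ be a field of characteristic $0$ that is complete with respect to a nontrivial non-Archimedean absolute value, and put $\Gamma=\sqrt{|K^\times|}=\{\rho>0 : \rho^k\in|K^\times| \text{ for some } k\ge 1\}$. For $\rho=(\rho_1,\dots,\rho_n)$ with $\rho_i>0$ let $T(\rho)=K\langle \frac{x_1}{\rho_1},\dots,\frac{x_n}{\rho_n}\rangle$ be the Tate algebra of power series $\sum_\nu a_\nu x^\nu$ with $|a_\nu|\rho^\nu\to 0$. An affinoid algebra is a quotient of some $T(\rho)$ with all $\rho_i\in\Gamma$. For $r=(r_1,\dots,r_n)$ with $r_i\ge 0$ let $K\langle \frac{x_1}{r_1},\dots,\frac{x_n}{r_n}\rangle^\dagger=\bigcup_{\rho>r}T(\rho)$, where $\rho>r$ means $\rho_i>r_i$ for all $i$. A quasi-dagger algebra is a quotient of some $K\langle \frac{x_1}{r_1},\dots,\frac{x_n}{r_n}\rangle^\dagger$ with all $r_i\in\{0\}\cup\Gamma$. Morphisms of affinoid and of quasi-dagger algebras are all $K$-algebra homomorphisms. An EFC $K$-algebra is a product-preserving set-valued functor on the category of rigid analytic affine spaces $\mathbb{A}^n_K$, $n\ge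 0$ (a morphism $\mathbb{A}^n_K\to\mathbb{A}^m_K$ is an $m$-tuple of entire power series in $n$ variables). (1) There is a fully faithful functor $G$ from quasi-dagger algebras to the ind-category of affinoid algebras, together with isomorphisms $\operatorname{Hom}_{\mathrm{ind}}(C,G(A))\cong\operatorname{Hom}_{K\text{-alg}}(C,A)$, natural in the affinoid algebra $C$ and in the quasi-dagger algebra $A$. Every quasi-dagger algebra $A$ has a presentation $A\cong K\langle \frac{x_1}{r_1},\dots,\frac{x_n}{r_n}\rangle^\dagger/(f_1,\dots,f_m)$ with $r_i\in\{0\}\cup\Gamma$ and $f_1,\dots,f_m\in T(\rho)$ for some $\rho>r$. For every such presentation, $G(A)$ is the ind-object given by the direct system $$\{A(\rho')\}_{\rho\ge\rho'>r,\ \rho'_i\in\Gamma},\qquad A(\rho')=T(\rho')/(f_1,\dots,f_m),$$ its structure maps $A(\rho')\to G(A)$ corresponding to the canonical homomorphisms $A(\rho')\to A$. (2) There is a functor $E$ from affinoid algebras to EFC algebras which equips each affinoid algebra, viewed as a Banach algebra with its residue norms, with its entire functional calculus (evaluation of entire series by convergent sums). Extend $E$ to the ind-category by filtered colimits. The composite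 of $G$ with this extension is a fully faithful functor from quasi-dagger algebras to EFC algebras. It sends $A$ to an EFC algebra with underlying set $A$ (naturally in $A$), in which an entire function is evaluated at elements coming from some $A(\rho')$ by summing its series in the Banach algebra $A(\rho')$. -/

import Mathlib

open CategoryTheory Limits

universe u

namespace QuasiDagger

section Entire

open Filter Topology MvPowerSeries

variable {K : Type u} [NontriviallyNormedField K]

/-- The power series `p` converges everywhere (it is restricted for every polyradius) and its sum
at each point `x ∈ K ^ n` is `F x`. -/
def HasEntireExpansion {n : ℕ} (p : MvPowerSeries (Fin n) K) (F : (Fin n → K) → K) : Prop :=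
  (∀ c : Fin n → ℝ, p.IsRestricted c) ∧
    ∀ x : Fin n → K, HasSum (fun ν : Fin n →₀ ℕ => coeff ν p * ν.prod (fun i k => x i ^ k)) (F x)

/-- Entire functions of `n` variables. As `K` is complete and nontrivially valued, the power
series is determined by the function `F`. -/
def IsEntire {n : ℕ} (F : (Fin n → K) → K) : Prop :=
  ∃ p : MvPowerSeries (Fin n) K, HasEntireExpansion p F

theorem isEntire_coord {n : ℕ} (i : Fin n) : IsEntire (fun x : Fin n → K => x i) := by
  classical
  refine ⟨X i, fun c => ?_, fun x => ?_⟩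
  · exact isRestricted_monomial c _ _
  · have h := hasSum_single (f := fun ν : Fin n →₀ ℕ =>
      coeff ν (X i : MvPowerSeries (Fin n) K) * ν.prod (fun i k => x i ^ k))
      (Finsupp.single i 1) (fun ν hν => by simp [coeff_X, hν])
    simpa [coeff_X] using h

theorem coeff_mul_bound [IsUltrametricDist K] {n : ℕ} {c : Fin n → ℝ} (hc : ∀ i, 0 ≤ c i)
    {p q : MvPowerSeries (Fin n) K} {A B : ℝ} (hA : 0 ≤ A)
    (hp : ∀ μ, ‖coeff μ p‖ * μ.prod (c · ^ ·) ≤ A)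
    (hq : ∀ μ, ‖coeff μ q‖ * μ.prod (c · ^ ·) ≤ B) (μ : Fin n →₀ ℕ) :
    ‖coeff μ (p * q)‖ * μ.prod (c · ^ ·) ≤ A * B := by
  classical
  have hpos : ∀ μ : Fin n →₀ ℕ, 0 ≤ μ.prod (c · ^ ·) := fun μ =>
    Finset.prod_nonneg fun i _ => pow_nonneg (hc i) _
  rw [coeff_mul]
  obtain ⟨a, ha, hle⟩ := IsUltrametricDist.exists_norm_finsetSum_le_of_nonempty
    (t := Finset.HasAntidiagonal.antidiagonal μ) ⟨(0, μ), by simp⟩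
    (fun z => coeff z.1 p * coeff z.2 q)
  have hadd : μ.prod (c · ^ ·) = a.1.prod (c · ^ ·) * a.2.prod (c · ^ ·) := by
    rw [← Finset.HasAntidiagonal.mem_antidiagonal.mp ha]
    exact Finsupp.prod_add_index' (by simp) (by simp [pow_add])
  calc _ ≤ ‖coeff a.1 p * coeff a.2 q‖ * μ.prod (c · ^ ·) :=
        mul_le_mul_of_nonneg_right hle (hpos μ)
    _ = (‖coeff a.1 p‖ * a.1.prod (c · ^ ·)) * (‖coeff a.2 q‖ * a.2.prod (c · ^ ·)) := by
        rw [hadd, norm_mul]; ring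
    _ ≤ A * B := mul_le_mul (hp _) (hq _) (mul_nonneg (norm_nonneg _) (hpos _)) hA

theorem coeff_one_bound {n : ℕ} {c : Fin n → ℝ} (μ : Fin n →₀ ℕ) :
    ‖coeff μ (1 : MvPowerSeries (Fin n) K)‖ * μ.prod (c · ^ ·) ≤ 1 := by
  classical
  by_cases h : μ = 0
  · subst h; simp
  · simp [coeff_one, h]

/-- Bound for a monomial in power series. -/
theorem coeff_monomial_bound [IsUltrametricDist K] {n m : ℕ} {c : Fin m → ℝ} (hc : ∀ i, 0 ≤ c i)
    {q : Fin n → MvPowerSeries (Fin m) K} {R : Fin n → ℝ} (hR : ∀ i, 0 ≤ R i)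
    (hq : ∀ i μ, ‖coeff μ (q i)‖ * μ.prod (c · ^ ·) ≤ R i) (ν : Fin n →₀ ℕ) (μ : Fin m →₀ ℕ) :
    ‖coeff μ (ν.prod fun i k => q i ^ k)‖ * μ.prod (c · ^ ·) ≤ ν.prod (R · ^ ·) := by
  have hpow : ∀ (i : Fin n) (k : ℕ) (μ : Fin m →₀ ℕ),
      ‖coeff μ (q i ^ k)‖ * μ.prod (c · ^ ·) ≤ R i ^ k := by
    intro i k
    induction k with
    | zero => intro μ; simpa using coeff_one_bound μ
    | succ k ih =>
      intro μ
      rw [pow_succ, pow_succ]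
      exact coeff_mul_bound hc (pow_nonneg (hR i) k) ih (hq i) μ
  have key : ∀ (s : Finset (Fin n)) (μ : Fin m →₀ ℕ),
      ‖coeff μ (∏ i ∈ s, q i ^ ν i)‖ * μ.prod (c · ^ ·) ≤ ∏ i ∈ s, R i ^ ν i := by
    classical
    intro s
    induction s using Finset.induction_on with
    | empty => intro μ; simpa using coeff_one_bound μ
    | insert a s ha ih =>
      intro μ
      rw [Finset.prod_insert ha, Finset.prod_insert ha]
      exact coeff_mul_bound hc (pow_nonneg (hR a) _) (hpow a _) ih μ
  exact key ν.support μ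

theorem HasEntireExpansion.one {n : ℕ} :
    HasEntireExpansion (1 : MvPowerSeries (Fin n) K) (fun _ => 1) := by
  classical
  refine ⟨fun c => isRestricted_one c, fun x => ?_⟩
  have h := hasSum_single (f := fun ν : Fin n →₀ ℕ =>
      coeff ν (1 : MvPowerSeries (Fin n) K) * ν.prod (fun i k => x i ^ k)) 0
      (fun ν hν => by simp [coeff_one, hν])
  simpa using h

/-- The Cauchy product over an ultrametric field. -/
theorem hasSum_antidiagonal [IsUltrametricDist K] {A : Type*} [AddCommMonoid A]
    [Finset.HasAntidiagonal A] {f g : A → K} {a b : K} (hf : HasSum f a) (hg : HasSum g b) :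
    HasSum (fun n => ∑ z ∈ Finset.HasAntidiagonal.antidiagonal n, f z.1 * g z.2) (a * b) := by
  have : NonarchimedeanRing K :=
    { is_nonarchimedean := NonarchimedeanAddGroup.is_nonarchimedean }
  have h3 := hf.mul_of_nonarchimedean hg
  have hs := (summable_sum_mul_antidiagonal_of_summable_mul h3.summable).hasSum
  rwa [← hf.summable.tsum_mul_tsum_eq_tsum_sum_antidiagonal hg.summable h3.summable,
    hf.tsum_eq, hg.tsum_eq] at hs

theorem HasEntireExpansion.mul [IsUltrametricDist K] {n : ℕ} {p q : MvPowerSeries (Fin n) K}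
    {F G : (Fin n → K) → K} (hp : HasEntireExpansion p F) (hq : HasEntireExpansion q G) :
    HasEntireExpansion (p * q) (fun x => F x * G x) := by
  classical
  refine ⟨fun c => isRestricted.mul c (hp.1 c) (hq.1 c), fun x => ?_⟩
  refine (hasSum_antidiagonal (hp.2 x) (hq.2 x)).congr_fun fun μ => ?_
  rw [coeff_mul, Finset.sum_mul]
  refine Finset.sum_congr rfl fun z hz => ?_
  rw [← Finset.HasAntidiagonal.mem_antidiagonal.mp hz,
    Finsupp.prod_add_index' (h := fun i k => x i ^ k) (by simp) (by simp [pow_add])]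
  ring

theorem HasEntireExpansion.monomial [IsUltrametricDist K] {n m : ℕ} {q : Fin n → MvPowerSeries (Fin m) K}
    {G : Fin n → (Fin m → K) → K} (hq : ∀ i, HasEntireExpansion (q i) (G i)) (ν : Fin n →₀ ℕ) :
    HasEntireExpansion (ν.prod fun i k => q i ^ k) (fun x => ν.prod fun i k => G i x ^ k) := by
  classical
  have hpow : ∀ (i : Fin n) (k : ℕ), HasEntireExpansion (q i ^ k) (fun x => G i x ^ k) := by
    intro i k
    induction k with
    | zero => simpa using HasEntireExpansion.one
    | succ k ih => simpa [pow_succ] using ih.mul (hq i)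
  have key : ∀ s : Finset (Fin n),
      HasEntireExpansion (∏ i ∈ s, q i ^ ν i) (fun x => ∏ i ∈ s, G i x ^ ν i) := by
    intro s
    induction s using Finset.induction_on with
    | empty => simpa using HasEntireExpansion.one
    | insert a s ha ih =>
      simp only [Finset.prod_insert ha]
      exact (hpow a _).mul ih
  exact key ν.support

/-- A double family dominated by `b ν → 0`, each row of which tends to zero, tends to zero. -/
theorem tendsto_prod_cofinite_zero {α β : Type*} {a : α × β → ℝ} {b : α → ℝ}
    (h0 : ∀ z, 0 ≤ a z) (hb : ∀ z, a z ≤ b z.1) (hb0 : Tendsto b cofinite (𝓝 0))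
    (hrow : ∀ ν, Tendsto (fun μ => a (ν, μ)) cofinite (𝓝 0)) : Tendsto a cofinite (𝓝 0) := by
  rw [Metric.tendsto_nhds]
  intro ε hε
  have hfin : {ν | ¬ b ν < ε}.Finite := by
    have := hb0.eventually (gt_mem_nhds hε)
    simpa [Filter.eventually_cofinite] using this
  have hrowf : ∀ ν, {μ | ¬ a (ν, μ) < ε}.Finite := fun ν => by
    have := (hrow ν).eventually (gt_mem_nhds hε)
    simpa [Filter.eventually_cofinite] using this
  rw [Filter.eventually_cofinite]
  refine (hfin.biUnion fun ν _ => (hrowf ν).image (Prod.mk ν)).subset ?_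
  rintro ⟨ν, μ⟩ h
  simp only [Set.mem_ofPred_eq, dist_zero_right, Real.norm_eq_abs, abs_of_nonneg (h0 _)] at h
  simp only [Set.mem_iUnion]
  exact ⟨ν, fun h' => h ((hb _).trans_lt h'), μ, h, rfl⟩

theorem IsEntire.comp [IsUltrametricDist K] [CompleteSpace K] {n m : ℕ} {F : (Fin n → K) → K}
    {G : Fin n → (Fin m → K) → K} (hF : IsEntire F) (hG : ∀ i, IsEntire (G i)) :
    IsEntire (fun x => F (fun i => G i x)) := by
  classical
  obtain ⟨p, hp⟩ := hF
  choose q hq using hG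
  set Q : (Fin n →₀ ℕ) → MvPowerSeries (Fin m) K := fun ν => ν.prod fun i k => q i ^ k with hQ
  have hQe : ∀ ν, HasEntireExpansion (Q ν) (fun x => ν.prod fun i k => G i x ^ k) :=
    fun ν => HasEntireExpansion.monomial hq ν
  have hpos : ∀ {c : Fin m → ℝ}, (∀ i, 0 ≤ c i) → ∀ μ : Fin m →₀ ℕ, 0 ≤ μ.prod (c · ^ ·) :=
    fun hc μ => Finset.prod_nonneg fun i _ => pow_nonneg (hc i) _
  have key : ∀ c : Fin m → ℝ, (∀ i, 0 ≤ c i) →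
      Tendsto (fun z : (Fin n →₀ ℕ) × (Fin m →₀ ℕ) =>
        ‖coeff z.1 p * coeff z.2 (Q z.1)‖ * z.2.prod (c · ^ ·)) cofinite (𝓝 0) := by
    intro c hc
    have hbd : ∀ i, ∃ R : ℝ, 0 ≤ R ∧ ∀ μ, ‖coeff μ (q i)‖ * μ.prod (c · ^ ·) ≤ R := by
      intro i
      obtain ⟨R, hR⟩ := ((hq i).1 c).bddAbove_range_of_cofinite
      exact ⟨max R 0, le_max_right _ _, fun μ => (hR ⟨μ, rfl⟩).trans (le_max_left _ _)⟩
    choose R hR0 hR using hbd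
    refine tendsto_prod_cofinite_zero (b := fun ν => ‖coeff ν p‖ * ν.prod (R · ^ ·))
      (fun z => mul_nonneg (norm_nonneg _) (hpos hc _)) (fun z => ?_) (hp.1 R) (fun ν => ?_)
    · rw [norm_mul, mul_assoc]
      exact mul_le_mul_of_nonneg_left (coeff_monomial_bound hc hR0 hR _ _) (norm_nonneg _)
    · have := ((hQe ν).1 c).const_mul ‖coeff ν p‖
      simpa [norm_mul, mul_assoc] using this
  have hsum1 : ∀ μ, Summable fun ν => coeff ν p * coeff μ (Q ν) := by
    intro μ
    refine NonarchimedeanAddGroup.summable_of_tendsto_cofinite_zero ?_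
    rw [tendsto_zero_iff_norm_tendsto_zero]
    have h1 := (key (fun _ => 1) (fun _ => zero_le_one)).comp
      (Function.Injective.tendsto_cofinite (f := fun ν : Fin n →₀ ℕ => (ν, μ))
        (fun a b h => (Prod.mk.inj h).1))
    refine h1.congr fun ν => ?_
    simp [Finsupp.prod]
  let h : MvPowerSeries (Fin m) K := fun μ => ∑' ν, coeff ν p * coeff μ (Q ν)
  have hcoeff : ∀ μ, coeff μ h = ∑' ν, coeff ν p * coeff μ (Q ν) := fun μ => rfl
  refine ⟨h, fun c => ?_, fun x => ?_⟩
  · rw [← isRestricted_abs_iff]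
    have hc : ∀ i, 0 ≤ |c| i := fun i => abs_nonneg (c i)
    have hk := key |c| hc
    rw [IsRestricted, Metric.tendsto_nhds]
    intro ε hε
    have hfin : {z : (Fin n →₀ ℕ) × (Fin m →₀ ℕ) |
        ¬ ‖coeff z.1 p * coeff z.2 (Q z.1)‖ * z.2.prod (|c| · ^ ·) < ε / 2}.Finite := by
      have := hk.eventually (gt_mem_nhds (half_pos hε))
      simpa [Filter.eventually_cofinite] using this
    rw [Filter.eventually_cofinite]
    refine (hfin.image Prod.snd).subset fun μ hμ => ?_
    by_contra hcon
    apply hμ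
    have hall : ∀ ν, ‖coeff ν p * coeff μ (Q ν)‖ * μ.prod (|c| · ^ ·) < ε / 2 := by
      intro ν
      by_contra h'
      exact hcon ⟨(ν, μ), h', rfl⟩
    rw [dist_zero_right, Real.norm_eq_abs, abs_of_nonneg (mul_nonneg (norm_nonneg _) (hpos hc _))]
    refine lt_of_le_of_lt ?_ (half_lt_self hε)
    rcases (hpos hc μ).eq_or_lt with h0 | h0
    · rw [← h0, mul_zero]; exact (half_pos hε).le
    · rw [← le_div_iff₀ h0, hcoeff]
      exact IsUltrametricDist.norm_tsum_le_of_forall_le_of_nonneg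
        (div_nonneg (half_pos hε).le h0.le) fun ν => ((lt_div_iff₀ h0).2 (hall ν)).le
  · have hk := key (fun i => ‖x i‖) (fun i => norm_nonneg _)
    have hS : Summable fun z : (Fin n →₀ ℕ) × (Fin m →₀ ℕ) =>
        coeff z.1 p * coeff z.2 (Q z.1) * z.2.prod (fun i k => x i ^ k) := by
      refine NonarchimedeanAddGroup.summable_of_tendsto_cofinite_zero ?_
      rw [tendsto_zero_iff_norm_tendsto_zero]
      refine hk.congr fun z => ?_
      simp [Finsupp.prod]
    have hrow := hS.hasSum.prod_fiberwise
      (g := fun ν => coeff ν p * ν.prod fun i k => G i x ^ k) fun ν => by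
        simpa [mul_assoc] using ((hQe ν).2 x).mul_left (coeff ν p)
    have hval := hrow.unique (hp.2 fun i => G i x)
    have hcol := ((Equiv.prodComm _ _).hasSum_iff.2 hS.hasSum).prod_fiberwise
      (g := fun μ => coeff μ h * μ.prod fun i k => x i ^ k) fun μ => by
        simpa [hcoeff] using (hsum1 μ).hasSum.mul_right (μ.prod fun i k => x i ^ k)
    rwa [hval] at hcol

end Entire
/-! ### Affine spaces and algebras with entire functional calculus -/

section EFC

/-- The affine spaces `𝔸ⁿ` over `K`, `n ≥ 0`. -/
structure AffineSpaces (K : Type u) where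
  /-- the dimension -/
  dim : ℕ

variable (K : Type u) [NontriviallyNormedField K]

/-- A morphism `𝔸ⁿ ⟶ 𝔸ᵐ` of rigid analytic varieties: an `m`-tuple of entire functions of `n`
variables, recorded through the map `Kⁿ → Kᵐ` that it defines (and which determines it). -/
@[ext]
structure AffineSpaces.Map (X Y : AffineSpaces K) where
  /-- the map on `K`-points -/
  toFun : (Fin X.dim → K) → (Fin Y.dim → K)
  isEntire : ∀ j, IsEntire fun x => toFun x j

variable [IsUltrametricDist K] [CompleteSpace K]

/-- The full subcategory of rigid analytic varieties on the affine spaces. -/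
instance : Category.{u} (AffineSpaces K) where
  Hom X Y := AffineSpaces.Map K X Y
  id X := ⟨fun x => x, fun j => isEntire_coord j⟩
  comp f g := ⟨fun x => g.toFun (f.toFun x), fun j => (g.isEntire j).comp f.isEntire⟩

variable {K} in
/-- The coordinate functions `𝔸ⁿ ⟶ 𝔸¹`. -/
def AffineSpaces.coord (n : ℕ) (i : Fin n) : (⟨n⟩ : AffineSpaces K) ⟶ ⟨1⟩ :=
  AffineSpaces.Map.mk (fun x _ => x i) fun _ => isEntire_coord i

/-- An algebra with entire functional calculus: a product-preserving functor from the category of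
affine spaces to sets. -/
def IsEFC : ObjectProperty (AffineSpaces K ⥤ Type u) := fun F => PreservesFiniteProducts F

/-- The category of EFC `K`-algebras. -/
abbrev EFCAlg := (IsEFC K).FullSubcategory

/-- The underlying set `F(𝔸¹)` of an EFC `K`-algebra. -/
def EFCAlg.underlying : EFCAlg K ⥤ Type u :=
  (IsEFC K).ι ⋙ (evaluation (AffineSpaces K) (Type u)).obj ⟨1⟩

end EFC

/-! ### Affinoid algebras and quasi-dagger algebras -/

section Algebras

open MvPowerSeries

variable (K : Type u) [NontriviallyNormedField K]

/-- `ρ` is a positive real number in `√|K^×|`, the value group of an algebraic closure of `K`. -/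
def IsRadius (ρ : ℝ) : Prop := 0 < ρ ∧ ∃ k : ℕ, 0 < k ∧ ∃ c : K, ρ ^ k = ‖c‖

variable {K} in
/-- The ideal of `S` generated by a family `f` of power series (each lying in `S`). -/
noncomputable def spanIn {n m : ℕ} (S : Subalgebra K (MvPowerSeries (Fin n) K))
    (f : Fin m → MvPowerSeries (Fin n) K) : Ideal S :=
  Ideal.span {t | ∃ j, (t : MvPowerSeries (Fin n) K) = f j}

variable {K} in
theorem spanIn_le_comap {n m : ℕ} {S T : Subalgebra K (MvPowerSeries (Fin n) K)} (h : S ≤ T)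
    (f : Fin m → MvPowerSeries (Fin n) K) :
    spanIn S f ≤ (spanIn T f).comap (Subalgebra.inclusion h) :=
  Ideal.span_le.2 fun _ ⟨j, hj⟩ => Ideal.subset_span ⟨j, hj⟩

variable [IsUltrametricDist K]

/-- The Tate algebra `K⟨x₁/ρ₁, …, xₙ/ρₙ⟩`: power series with `|a_ν| ρ ^ ν → 0`. -/
def Tate {n : ℕ} (ρ : Fin n → ℝ) : Subalgebra K (MvPowerSeries (Fin n) K) where
  __ := MvPowerSeries.IsRestricted.subring (R := K) ρ
  algebraMap_mem' a := isRestricted_C ρ a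

variable {K} in
theorem mem_Tate {n : ℕ} {ρ : Fin n → ℝ} {p : MvPowerSeries (Fin n) K} :
    p ∈ Tate K ρ ↔ p.IsRestricted ρ := Iff.rfl

theorem Tate_anti {n : ℕ} {ρ σ : Fin n → ℝ} (h0 : ∀ i, 0 ≤ ρ i) (h : ∀ i, ρ i ≤ σ i) :
    Tate K σ ≤ Tate K ρ := by
  intro p hp
  refine squeeze_zero (fun ν => ?_) (fun ν => ?_) (mem_Tate.1 hp)
  · exact mul_nonneg (norm_nonneg _) (Finset.prod_nonneg fun i _ => pow_nonneg (h0 i) _)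
  · exact mul_le_mul_of_nonneg_left
      (Finset.prod_le_prod (fun i _ => pow_nonneg (h0 i) _)
        fun i _ => pow_le_pow_left₀ (h0 i) (h i) _) (norm_nonneg _)

/-- The quasi-Washnitzer algebra `K⟨x₁/r₁, …, xₙ/rₙ⟩†` for `rᵢ ≥ 0`: the union of the Tate
algebras over all polyradii `ρ` with `ρᵢ > rᵢ`. -/
def QuasiWashnitzer {n : ℕ} (r : Fin n → NNReal) : Subalgebra K (MvPowerSeries (Fin n) K) where
  carrier := {p | ∃ ρ : Fin n → ℝ, (∀ i, r i < ρ i) ∧ p ∈ Tate K ρ}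
  mul_mem' := by
    rintro p q ⟨ρ, hρ, hp⟩ ⟨σ, hσ, hq⟩
    have h0 : ∀ i, 0 ≤ min (ρ i) (σ i) := fun i =>
      le_min ((r i).2.trans (hρ i).le) ((r i).2.trans (hσ i).le)
    exact ⟨fun i => min (ρ i) (σ i), fun i => lt_min (hρ i) (hσ i),
      mul_mem (Tate_anti K h0 (fun i => min_le_left _ _) hp)
        (Tate_anti K h0 (fun i => min_le_right _ _) hq)⟩
  add_mem' := by
    rintro p q ⟨ρ, hρ, hp⟩ ⟨σ, hσ, hq⟩
    have h0 : ∀ i, 0 ≤ min (ρ i) (σ i) := fun i =>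
      le_min ((r i).2.trans (hρ i).le) ((r i).2.trans (hσ i).le)
    exact ⟨fun i => min (ρ i) (σ i), fun i => lt_min (hρ i) (hσ i),
      add_mem (Tate_anti K h0 (fun i => min_le_left _ _) hp)
        (Tate_anti K h0 (fun i => min_le_right _ _) hq)⟩
  algebraMap_mem' a := ⟨fun i => r i + 1, fun i => lt_add_one _, Subalgebra.algebraMap_mem _ a⟩

theorem Tate_le_quasiWashnitzer {n : ℕ} {r : Fin n → NNReal} {ρ : Fin n → ℝ}
    (h : ∀ i, r i < ρ i) : Tate K ρ ≤ QuasiWashnitzer K r := fun _ hp => ⟨ρ, h, hp⟩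

/-- Affinoid algebras: quotients of Tate algebras. -/
def IsAffinoid : ObjectProperty (CommAlgCat.{u} K) := fun C =>
  ∃ (n : ℕ) (ρ : Fin n → ℝ), (∀ i, IsRadius K (ρ i)) ∧
    ∃ π : Tate K ρ →ₐ[K] C, Function.Surjective π

/-- The category of affinoid algebras and `K`-algebra homomorphisms. -/
abbrev Affinoid := (IsAffinoid K).FullSubcategory

/-- Quasi-dagger algebras: quotients of quasi-Washnitzer algebras, where each radius is `0` or lies
in `√|K^×|`. -/
def IsQuasiDagger : ObjectProperty (CommAlgCat.{u} K) := fun A =>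
  ∃ (n : ℕ) (r : Fin n → NNReal), (∀ i, r i = 0 ∨ IsRadius K (r i)) ∧
    ∃ π : QuasiWashnitzer K r →ₐ[K] A, Function.Surjective π

/-- The category of quasi-dagger algebras and `K`-algebra homomorphisms. -/
abbrev QDagger := (IsQuasiDagger K).FullSubcategory

variable {K}

/-- The residue seminorm on an algebra `C` presented as a quotient `π` of a Tate algebra `T(ρ)`:
the infimum of the norms `sup_ν |a_ν| ρ ^ ν` of all preimages. -/
noncomputable def residueNorm {n : ℕ} {ρ : Fin n → ℝ} {C : Type u} [CommRing C] [Algebra K C]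
    (π : Tate K ρ →ₐ[K] C) (c : C) : ℝ :=
  sInf {x : ℝ | ∃ t : Tate K ρ, π t = c ∧ x = gaussNorm (fun a : K => ‖a‖) ρ t.1}

/-- `c` is the sum of the series `∑ p_ν b ^ ν`, for the residue seminorm of the presentation `π`. -/
def IsValue {n : ℕ} {ρ : Fin n → ℝ} {C : Type u} [CommRing C] [Algebra K C]
    (π : Tate K ρ →ₐ[K] C) {k : ℕ} (p : MvPowerSeries (Fin k) K) (b : Fin k → C) (c : C) : Prop :=
  Filter.Tendsto (fun s : Finset (Fin k →₀ ℕ) =>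
    residueNorm π (c - ∑ ν ∈ s, coeff ν p • ν.prod fun i l => b i ^ l)) Filter.atTop (nhds 0)

/-- A finite presentation `A ≅ K⟨x₁/r₁, …, xₙ/rₙ⟩† / (f₁, …, fₘ)` with `f₁, …, fₘ` in
`K⟨x₁/ρ₁, …, xₙ/ρₙ⟩` for some `ρ > r`. -/
structure FinPresentation (A : CommAlgCat.{u} K) where
  /-- number of variables -/
  n : ℕ
  /-- the radii -/
  r : Fin n → NNReal
  isRadius : ∀ i, r i = 0 ∨ IsRadius K (r i)
  /-- the quotient map -/
  π : QuasiWashnitzer K r →ₐ[K] A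
  surjective : Function.Surjective π
  /-- number of relations -/
  m : ℕ
  /-- the relations -/
  f : Fin m → MvPowerSeries (Fin n) K
  /-- a polyradius on which the relations converge -/
  ρ : Fin n → ℝ
  lt : ∀ i, r i < ρ i
  mem : ∀ j, f j ∈ Tate K ρ
  ker_eq : RingHom.ker π = spanIn (QuasiWashnitzer K r) f

namespace FinPresentation

variable {A : CommAlgCat.{u} K} (P : FinPresentation A)

/-- The polyradii `ρ'` with `r < ρ' ≤ ρ`. -/
def IsIndex (ρ' : Fin P.n → ℝ) : Prop := ∀ i, IsRadius K (ρ' i) ∧ P.r i < ρ' i ∧ ρ' i ≤ P.ρ i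

/-- The directed set of polyradii `ρ'` with `r < ρ' ≤ ρ`, where a smaller polyradius is a later
index. -/
abbrev Index := {ρ' : Fin P.n → ℝ // P.IsIndex ρ'}ᵒᵈ

/-- The polyradius of an index. -/
def rad (i : P.Index) : Fin P.n → ℝ := (OrderDual.ofDual i).1

theorem rad_spec (i : P.Index) : P.IsIndex (P.rad i) := (OrderDual.ofDual i).2

theorem Tate_mono {i j : P.Index} (h : i ≤ j) : Tate K (P.rad i) ≤ Tate K (P.rad j) :=
  Tate_anti K (fun k => (P.rad_spec j k).1.1.le) (OrderDual.ofDual_le_ofDual.2 h)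

/-- The affinoid algebra `A(ρ') = K⟨x₁/ρ'₁, …, xₙ/ρ'ₙ⟩ / (f₁, …, fₘ)`. -/
abbrev Level (i : P.Index) : Type u := Tate K (P.rad i) ⧸ spanIn (Tate K (P.rad i)) P.f

/-- The transition map `A(ρ') → A(ρ'')` for `ρ' ≥ ρ''`. -/
noncomputable def transition {i j : P.Index} (h : i ≤ j) : P.Level i →ₐ[K] P.Level j :=
  Ideal.quotientMapₐ _ (Subalgebra.inclusion (P.Tate_mono h))
    (spanIn_le_comap (P.Tate_mono h) P.f)

/-- The canonical map `A(ρ') → A`. -/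
noncomputable def toAlg (i : P.Index) : P.Level i →ₐ[K] A :=
  Ideal.Quotient.liftₐ _
    (P.π.comp (Subalgebra.inclusion (Tate_le_quasiWashnitzer K fun k => (P.rad_spec i k).2.1)))
    fun t ht => by
      have h := spanIn_le_comap
        (Tate_le_quasiWashnitzer K fun k => (P.rad_spec i k).2.1) P.f ht
      rw [← P.ker_eq] at h
      exact h

/-- The direct system of affinoid algebras `{A(ρ')}` over the polyradii `r < ρ' ≤ ρ`. -/
noncomputable def system : P.Index ⥤ Affinoid K where
  obj i := ⟨CommAlgCat.of K (P.Level i), P.n, P.rad i, fun k => (P.rad_spec i k).1,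
    Ideal.Quotient.mkₐ K _, Ideal.Quotient.mkₐ_surjective K _⟩
  map h := ObjectProperty.homMk (CommAlgCat.ofHom (P.transition h.le))
  map_id i := by
    ext x
    obtain ⟨x, rfl⟩ := Ideal.Quotient.mk_surjective x
    rfl
  map_comp g h := by
    ext x
    obtain ⟨x, rfl⟩ := Ideal.Quotient.mk_surjective x
    rfl

end FinPresentation

variable (K) in
/-- The functor sending a quasi-dagger algebra `A` to the presheaf `C ↦ Hom_K(C, A)` on affinoid
algebras. -/
def restrictedYoneda : QDagger K ⥤ (Affinoid K)ᵒᵖ ⥤ Type u :=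
  (IsQuasiDagger K).ι ⋙ yoneda ⋙ (Functor.whiskeringLeft _ _ _).obj (IsAffinoid K).ι.op

variable [CompleteSpace K]

/-- The functor `E` from affinoid algebras to EFC algebras equips each affinoid algebra `C` with its
entire functional calculus as a Banach algebra: the underlying set of `E(C)` is `C`, by means of
`u`, and an entire function with power series `p` acts by summing the series in `C`. -/
def IsFunctionalCalculus (E : Affinoid K ⥤ EFCAlg K)
    (u : E ⋙ EFCAlg.underlying K ≅ (IsAffinoid K).ι ⋙ forget (CommAlgCat.{u} K)) : Prop :=
  ∀ (C : Affinoid K) (n : ℕ) (ρ : Fin n → ℝ) (π : Tate K ρ →ₐ[K] C.obj),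
    (∀ i, IsRadius K (ρ i)) → Function.Surjective π →
    ∀ (k : ℕ) (g : (⟨k⟩ : AffineSpaces K) ⟶ ⟨1⟩) (p : MvPowerSeries (Fin k) K),
      HasEntireExpansion p (fun x => g.toFun x 0) →
      ∀ z : (E.obj C).obj.obj ⟨k⟩,
        IsValue π p (fun i => u.hom.app C ((E.obj C).obj.map (AffineSpaces.coord k i) z))
          (u.hom.app C ((E.obj C).obj.map g z))

/-- The functor `Φ` from quasi-dagger algebras to EFC algebras equips `A` with the entire functional
calculus coming from the affinoid algebras `A(ρ')`: the underlying set of `Φ(A)` is `A`, by means of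
`v`, and entire functions act on the images of elements of `A(ρ')` by summing their series in
`A(ρ')`. -/
def IsInducedCalculus (Φ : QDagger K ⥤ EFCAlg K)
    (v : Φ ⋙ EFCAlg.underlying K ≅ (IsQuasiDagger K).ι ⋙ forget (CommAlgCat.{u} K)) : Prop :=
  ∀ (A : QDagger K) (P : FinPresentation A.obj) (i : P.Index)
    (k : ℕ) (g : (⟨k⟩ : AffineSpaces K) ⟶ ⟨1⟩) (p : MvPowerSeries (Fin k) K),
      HasEntireExpansion p (fun x => g.toFun x 0) →
      ∀ (z : (Φ.obj A).obj.obj ⟨k⟩) (b : Fin k → P.Level i) (c : P.Level i),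
        (∀ j, v.hom.app A ((Φ.obj A).obj.map (AffineSpaces.coord k j) z) = P.toAlg i (b j)) →
        IsValue (Ideal.Quotient.mkₐ K (spanIn (Tate K (P.rad i)) P.f)) p b c →
        v.hom.app A ((Φ.obj A).obj.map g z) = P.toAlg i c

end Algebras

end QuasiDagger

set_option linter.unusedSectionVars false

/-! A finite presentation exhibits the quasi-dagger algebra `A` as the filtered colimit of the
affinoid algebras `A(ρ')`. Part (1) amounts to this: a homomorphism from an affinoid algebra `C` to
`A` factors through some `A(ρ')`, and two factorizations agree at a later index. Then the presheaf
`C ↦ Hom(C, A)`, which depends on `A` alone, is the ind-object of every presentation, and `G` is the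
restricted Yoneda functor.

No homomorphism is assumed continuous, and `A` carries no topology. The substitute is residual
finiteness: the ideals of finite codimension intersect in zero. The preimage of such an ideal in a
Tate algebra is a closed subspace of finite codimension, so functionals on the finite-dimensional
quotients of `A` pull back to continuous ones (`Tate.continuous_of_vanishing`), and they separate
the points of `A`. Hence homomorphisms from Tate algebras are determined by the images of the
variables, and fibre products of two Tate algebras over `A` are closed. Baire's theorem along a
sequence of shrinking polyradii puts the image of a whole Tate algebra into one level
(`FinPresentation.exists_range_le`). The kernel of `A(ρ') → A` is finitely generated, so it dies at
a later index (`FinPresentation.exists_ker_le`), and the lift becomes a homomorphism.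

Residual finiteness follows from Krull's intersection theorem for Noetherian algebras with finite
residue fields. Noetherianity and closedness of ideals come from Gröbner bases: leading exponents,
Dickson's lemma, and division with bounded remainder. For quasi-Washnitzer algebras the leading
exponent is taken along an ultrafilter of radii decreasing to `r`. Residue fields are handled by
lifting Noether normalization from the residue field of `K` to the unit polydisc, passing to radii
in `√|K^×|` by a finite map, and then to quasi-Washnitzer algebras by showing that a maximal ideal
generates a proper ideal in a suitable Tate algebra.

For (2), a presheaf `X` is sent to the functor of its germs along growing polydiscs in `𝔸ⁿ`, with
entire maps acting by pullback. This commutes with colimits, so on ind-objects it is the extension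
by filtered colimits. For `X = Hom(-, A)` the germs on `𝔸ⁿ` are the `n`-tuples in `A`: any tuple is
the image of the variables of a Tate algebra of large radius, by a homomorphism that is unique.
Polynomials are entire, so a morphism of EFC algebras is a `K`-algebra homomorphism, and every such
homomorphism acts on germs. The same comparison gives full faithfulness of `G`, because a map of
these presheaves is determined by its effect on germs (`presheafToEFC_map_injective`). -/

namespace QuasiDagger

open MvPowerSeries Filter Topology

/-! ### Weights of monomials -/

section Weight

variable {n : ℕ}

/-- The weight `ρ ^ ν` of the monomial `x ^ ν`. -/
def wt (ρ : Fin n → ℝ) (ν : Fin n →₀ ℕ) : ℝ := ν.prod (ρ · ^ ·)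

theorem wt_eq_prod (ρ : Fin n → ℝ) (ν : Fin n →₀ ℕ) : wt ρ ν = ∏ i, ρ i ^ ν i :=
  Finsupp.prod_fintype _ _ (by simp)

@[simp] theorem wt_zero (ρ : Fin n → ℝ) : wt ρ 0 = 1 := by simp [wt]

theorem wt_add (ρ : Fin n → ℝ) (μ ν : Fin n →₀ ℕ) : wt ρ (μ + ν) = wt ρ μ * wt ρ ν := by
  simp [wt_eq_prod, pow_add, Finset.prod_mul_distrib]

theorem wt_nonneg {ρ : Fin n → ℝ} (h : ∀ i, 0 ≤ ρ i) (ν : Fin n →₀ ℕ) : 0 ≤ wt ρ ν :=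
  Finset.prod_nonneg fun i _ => pow_nonneg (h i) _

theorem wt_pos {ρ : Fin n → ℝ} (h : ∀ i, 0 < ρ i) (ν : Fin n →₀ ℕ) : 0 < wt ρ ν :=
  Finset.prod_pos fun i _ => pow_pos (h i) _

theorem wt_mono {ρ σ : Fin n → ℝ} (h0 : ∀ i, 0 ≤ ρ i) (h : ∀ i, ρ i ≤ σ i) (ν : Fin n →₀ ℕ) :
    wt ρ ν ≤ wt σ ν :=
  Finset.prod_le_prod (fun i _ => pow_nonneg (h0 i) _) fun i _ => pow_le_pow_left₀ (h0 i) (h i) _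

theorem wt_single (ρ : Fin n → ℝ) (i : Fin n) (k : ℕ) : wt ρ (Finsupp.single i k) = ρ i ^ k := by
  simp [wt]

end Weight

/-- The factor `1` gives the bound the shape `C * wt ρ ν` that `Tate.lift` requires. -/
theorem norm_prod_pow_le {n : ℕ} {ρ : Fin n → ℝ} {B : Type*} [NormedCommRing B] [NormOneClass B]
    {b : Fin n → B} (hb : ∀ i, ‖b i‖ ≤ ρ i) (ν : Fin n →₀ ℕ) :
    ‖ν.prod fun i k => b i ^ k‖ ≤ 1 * wt ρ ν := by
  rw [one_mul]
  refine (Finset.norm_prod_le _ _).trans (Finset.prod_le_prod (fun _ _ => norm_nonneg _)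
    fun i _ => (norm_pow_le _ _).trans (pow_le_pow_left₀ (norm_nonneg _) (hb i) _))

/-! ### Tate algebras as Banach algebras -/

section Norm

variable {K : Type u} [NontriviallyNormedField K] [IsUltrametricDist K] {n : ℕ} {ρ : Fin n → ℝ}

theorem mem_Tate_iff {p : MvPowerSeries (Fin n) K} :
    p ∈ Tate K ρ ↔ Tendsto (fun ν => ‖coeff ν p‖ * wt ρ ν) cofinite (𝓝 0) := Iff.rfl

theorem Tate.finite_lt {p : MvPowerSeries (Fin n) K} (hp : p ∈ Tate K ρ) {ε : ℝ} (hε : 0 < ε) :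
    {ν | ε ≤ ‖coeff ν p‖ * wt ρ ν}.Finite := by
  have := (mem_Tate_iff.1 hp).eventually (gt_mem_nhds hε)
  simpa [Filter.eventually_cofinite] using this

theorem mem_Tate_of_finite (hρ : ∀ i, 0 ≤ ρ i) {p : MvPowerSeries (Fin n) K}
    (h : ∀ ε > 0, {ν | ε ≤ ‖coeff ν p‖ * wt ρ ν}.Finite) : p ∈ Tate K ρ := by
  rw [mem_Tate_iff, Metric.tendsto_nhds]
  intro ε hε
  rw [Filter.eventually_cofinite]
  refine (h ε hε).subset fun ν hν => ?_
  have h0 : 0 ≤ ‖coeff ν p‖ * wt ρ ν := mul_nonneg (norm_nonneg _) (wt_nonneg hρ ν)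
  simpa [Real.dist_eq, abs_of_nonneg (wt_nonneg hρ ν)] using hν

theorem Tate.bddAbove (t : Tate K ρ) :
    BddAbove (Set.range fun ν => ‖coeff ν t.1‖ * wt ρ ν) :=
  (mem_Tate_iff.1 t.2).bddAbove_range_of_cofinite

theorem Tate.coeff_le_gaussNorm (t : Tate K ρ) (ν : Fin n →₀ ℕ) :
    ‖coeff ν t.1‖ * wt ρ ν ≤ gaussNorm (fun a : K => ‖a‖) ρ t.1 :=
  le_ciSup (Tate.bddAbove t) ν

/-- The monomial `x ^ ν` of a Tate algebra. -/
noncomputable def Tate.mono (K : Type u) [NontriviallyNormedField K] [IsUltrametricDist K]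
    (ρ : Fin n → ℝ) (ν : Fin n →₀ ℕ) : Tate K ρ :=
  ⟨monomial ν 1, isRestricted_monomial _ _ _⟩

/-- The variable `x_i` of a Tate algebra. -/
noncomputable def Tate.X (K : Type u) [NontriviallyNormedField K] [IsUltrametricDist K]
    (ρ : Fin n → ℝ) (i : Fin n) : Tate K ρ := Tate.mono K ρ (Finsupp.single i 1)

theorem Tate.coeff_mono [DecidableEq (Fin n →₀ ℕ)] (μ ν : Fin n →₀ ℕ) :
    coeff μ (Tate.mono K ρ ν).1 = if μ = ν then 1 else 0 := by
  classical
  simp [Tate.mono, coeff_monomial]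

@[simp] theorem Tate.mono_zero : Tate.mono K ρ 0 = 1 := rfl

theorem Tate.mono_add (μ ν : Fin n →₀ ℕ) :
    Tate.mono K ρ (μ + ν) = Tate.mono K ρ μ * Tate.mono K ρ ν := by
  apply Subtype.ext
  change monomial (μ + ν) 1 = monomial μ (1 : K) * monomial ν 1
  rw [monomial_mul_monomial, one_mul]

theorem Tate.mono_eq_prod (ν : Fin n →₀ ℕ) :
    Tate.mono K ρ ν = ν.prod fun i k => Tate.X K ρ i ^ k := by
  have h1 : ∀ (i : Fin n) (k : ℕ), Tate.mono K ρ (Finsupp.single i k) = Tate.X K ρ i ^ k := by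
    intro i k
    induction k with
    | zero => simp
    | succ k ih => rw [Finsupp.single_add, Tate.mono_add, ih, pow_succ]; rfl
  induction ν using Finsupp.induction_linear with
  | zero => simp
  | add μ ν hμ hν =>
    rw [Tate.mono_add, hμ, hν, Finsupp.prod_add_index' (by simp) (by simp [pow_add])]
  | single i k => rw [h1]; simp

variable [hρ : Fact (∀ i, 0 < ρ i)]

/-- The Gauss norm on a Tate algebra. -/
noncomputable def Tate.gaussRingNorm : RingNorm (Tate K ρ) where
  toFun t := gaussNorm (fun a : K => ‖a‖) ρ t.1
  map_zero' := gaussNorm_zero _ _ norm_zero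
  add_le' s t := by
    have hs := Tate.coeff_le_gaussNorm s
    have ht := Tate.coeff_le_gaussNorm t
    refine ciSup_le fun ν => ?_
    have hw := wt_nonneg (fun i => (hρ.out i).le) ν
    calc _ ≤ (‖coeff ν s.1‖ + ‖coeff ν t.1‖) * wt ρ ν :=
          mul_le_mul_of_nonneg_right (norm_add_le _ _) hw
      _ ≤ _ := by rw [add_mul]; exact add_le_add (hs ν) (ht ν)
  mul_le' s t := ciSup_le fun ν => coeff_mul_bound (fun i => (hρ.out i).le)
    ((mul_nonneg (norm_nonneg _) (wt_nonneg (fun i => (hρ.out i).le) 0)).trans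
      (Tate.coeff_le_gaussNorm s 0))
    (Tate.coeff_le_gaussNorm s) (Tate.coeff_le_gaussNorm t) ν
  neg' t := gaussNorm_neg _ _ (fun x => norm_neg x) _
  eq_zero_of_map_eq_zero' t ht := by
    apply Subtype.ext
    ext ν
    have h := Tate.coeff_le_gaussNorm t ν
    have hw := wt_pos hρ.out ν
    rw [ht] at h
    have : ‖coeff ν t.1‖ ≤ 0 := by
      by_contra hc
      exact absurd h (not_le.2 (mul_pos (not_le.1 hc) hw))
    simpa using this

noncomputable scoped instance : NormedCommRing (Tate K ρ) :=
  { RingNorm.toNormedRing Tate.gaussRingNorm with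
    mul_comm := mul_comm }

theorem Tate.coeff_le (t : Tate K ρ) (ν : Fin n →₀ ℕ) : ‖coeff ν t.1‖ * wt ρ ν ≤ ‖t‖ :=
  le_ciSup (Tate.bddAbove t) ν

theorem Tate.norm_le {t : Tate K ρ} {c : ℝ} (h : ∀ ν, ‖coeff ν t.1‖ * wt ρ ν ≤ c) : ‖t‖ ≤ c :=
  ciSup_le h

/-- The terms tend to zero, so only finitely many reach `c / 2`. The supremum is at most the larger
of `c / 2` and the greatest of these, so strictness survives. -/
theorem Tate.norm_lt_of_forall {t : Tate K ρ} {c : ℝ} (hc : 0 < c)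
    (h : ∀ ν, ‖coeff ν t.1‖ * wt ρ ν < c) : ‖t‖ < c := by
  have hfin := Tate.finite_lt t.2 (half_pos hc)
  by_cases hne : {ν | c / 2 ≤ ‖coeff ν t.1‖ * wt ρ ν}.Nonempty
  · obtain ⟨μ, -, hmax⟩ := hfin.exists_maximalFor (fun ν => ‖coeff ν t.1‖ * wt ρ ν) _ hne
    refine lt_of_le_of_lt (Tate.norm_le fun ν => ?_) (max_lt (half_lt_self hc) (h μ))
    by_cases hν : c / 2 ≤ ‖coeff ν t.1‖ * wt ρ ν
    · exact le_max_of_le_right (by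
        by_contra hlt
        exact hlt (hmax hν (not_le.1 hlt).le))
    · exact le_max_of_le_left (not_le.1 hν).le
  · refine lt_of_le_of_lt (Tate.norm_le fun ν => ?_) (half_lt_self hc)
    exact (not_le.1 fun hν => hne ⟨ν, hν⟩).le

theorem Tate.exists_norm_eq (t : Tate K ρ) : ∃ ν, ‖t‖ = ‖coeff ν t.1‖ * wt ρ ν := by
  by_contra hcon
  push Not at hcon
  have hlt : ∀ ν, ‖coeff ν t.1‖ * wt ρ ν < ‖t‖ := fun ν =>
    lt_of_le_of_ne (Tate.coeff_le t ν) (hcon ν).symm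
  have h0 : 0 < ‖t‖ := lt_of_le_of_lt
    (mul_nonneg (norm_nonneg _) (wt_nonneg (fun i => (hρ.out i).le) 0)) (hlt 0)
  exact lt_irrefl _ (Tate.norm_lt_of_forall h0 hlt)

noncomputable scoped instance : NormedAlgebra K (Tate K ρ) where
  norm_smul_le a t := Tate.norm_le fun ν => by
    have : coeff ν (a • t).1 = a * coeff ν t.1 := rfl
    rw [this, norm_mul, mul_assoc]
    exact mul_le_mul_of_nonneg_left (Tate.coeff_le t ν) (norm_nonneg _)

scoped instance : IsUltrametricDist (Tate K ρ) :=
  IsUltrametricDist.isUltrametricDist_of_forall_norm_add_le_max_norm fun s t =>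
    Tate.norm_le (t := s + t) fun ν => by
      have hw := wt_nonneg (fun i => (hρ.out i).le) ν
      calc _ ≤ max ‖coeff ν s.1‖ ‖coeff ν t.1‖ * wt ρ ν :=
            mul_le_mul_of_nonneg_right (IsUltrametricDist.norm_add_le_max _ _) hw
        _ ≤ _ := by
          rw [max_mul_of_nonneg _ _ hw]
          exact max_le_max (Tate.coeff_le s ν) (Tate.coeff_le t ν)

theorem Tate.norm_mono (ν : Fin n →₀ ℕ) : ‖Tate.mono K ρ ν‖ = wt ρ ν := by
  classical
  refine le_antisymm (Tate.norm_le fun μ => ?_) ?_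
  · rw [Tate.coeff_mono]
    split_ifs with h
    · simp [h]
    · simpa using wt_nonneg (fun i => (hρ.out i).le) ν
  · simpa [Tate.coeff_mono] using Tate.coeff_le (Tate.mono K ρ ν) ν

theorem Tate.norm_X (i : Fin n) : ‖Tate.X K ρ i‖ = ρ i := by
  rw [Tate.X, Tate.norm_mono, wt_single, pow_one]

scoped instance : NormOneClass (Tate K ρ) := ⟨by
  rw [← Tate.mono_zero, Tate.norm_mono, wt_zero]⟩

scoped instance [CompleteSpace K] : CompleteSpace (Tate K ρ) := by
  refine Metric.complete_of_cauchySeq_tendsto fun s hs => ?_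
  have hw := wt_pos hρ.out
  have hw0 := fun ν => (hw ν).le
  have hcau : ∀ ε > 0, ∃ N, ∀ m ≥ N, ∀ l ≥ N, ∀ ν,
      ‖coeff ν (s m).1 - coeff ν (s l).1‖ * wt ρ ν ≤ ε := by
    intro ε hε
    obtain ⟨N, hN⟩ := Metric.cauchySeq_iff.1 hs ε hε
    refine ⟨N, fun m hm l hl ν => ?_⟩
    have h1 := (hN m hm l hl).le
    rw [dist_eq_norm] at h1
    exact (Tate.coeff_le (s m - s l) ν).trans h1
  have hlim : ∀ ν, ∃ a, Tendsto (fun m => coeff ν (s m).1) atTop (𝓝 a) := by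
    intro ν
    refine cauchySeq_tendsto_of_complete (Metric.cauchySeq_iff.2 fun ε hε => ?_)
    obtain ⟨N, hN⟩ := hcau (ε / 2 * wt ρ ν) (mul_pos (half_pos hε) (hw ν))
    refine ⟨N, fun m hm l hl => ?_⟩
    rw [dist_eq_norm]
    exact (le_of_mul_le_mul_right (hN m hm l hl ν) (hw ν)).trans_lt (half_lt_self hε)
  choose a ha using hlim
  -- Let `l → ∞` in the Cauchy estimate, which is uniform in `ν`.
  have hclose : ∀ ε > 0, ∃ N, ∀ m ≥ N, ∀ ν, ‖coeff ν (s m).1 - a ν‖ * wt ρ ν ≤ ε := by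
    intro ε hε
    obtain ⟨N, hN⟩ := hcau ε hε
    refine ⟨N, fun m hm ν => ?_⟩
    have h1 : Tendsto (fun l => ‖coeff ν (s m).1 - coeff ν (s l).1‖ * wt ρ ν) atTop
        (𝓝 (‖coeff ν (s m).1 - a ν‖ * wt ρ ν)) :=
      ((tendsto_const_nhds.sub (ha ν)).norm).mul_const _
    exact le_of_tendsto h1 (eventually_atTop.2 ⟨N, fun l hl => hN m hm l hl ν⟩)
  let p : MvPowerSeries (Fin n) K := a
  have hpa : ∀ ν, coeff ν p = a ν := fun _ => rfl
  -- Since `s N` is uniformly within `ε / 2` of the limit, a term of size at least `ε` in the limit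
  -- is already one in `s N`.
  have hp : p ∈ Tate K ρ := by
    refine mem_Tate_of_finite (fun i => (hρ.out i).le) fun ε hε => ?_
    obtain ⟨N, hN⟩ := hclose (ε / 2) (half_pos hε)
    refine (Tate.finite_lt (s N).2 hε).subset fun ν hν => ?_
    by_contra hlt
    have h1 : ‖a ν‖ ≤ max ‖coeff ν (s N).1‖ ‖coeff ν (s N).1 - a ν‖ := by
      have := IsUltrametricDist.norm_add_le_max (coeff ν (s N).1) (a ν - coeff ν (s N).1)
      rwa [add_sub_cancel, norm_sub_rev (a ν)] at this
    have h2 := mul_le_mul_of_nonneg_right h1 (hw0 ν)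
    rw [max_mul_of_nonneg _ _ (hw0 ν)] at h2
    have h3 : max (‖coeff ν (s N).1‖ * wt ρ ν) (‖coeff ν (s N).1 - a ν‖ * wt ρ ν) < ε :=
      max_lt (not_le.1 hlt) ((hN N le_rfl ν).trans_lt (half_lt_self hε))
    exact absurd hν (not_le.2 (h2.trans_lt h3))
  refine ⟨⟨p, hp⟩, Metric.tendsto_atTop.2 fun ε hε => ?_⟩
  obtain ⟨N, hN⟩ := hclose (ε / 2) (half_pos hε)
  refine ⟨N, fun m hm => ?_⟩
  rw [dist_eq_norm]
  exact (Tate.norm_le (t := s m - ⟨p, hp⟩) fun ν => hN m hm ν).trans_lt (half_lt_self hε)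

theorem Tate.hasSum_mono (t : Tate K ρ) :
    HasSum (fun ν => coeff ν t.1 • Tate.mono K ρ ν) t := by
  classical
  rw [HasSum, Metric.tendsto_nhds]
  intro ε hε
  filter_upwards [eventually_ge_atTop (Tate.finite_lt t.2 (half_pos hε)).toFinset] with s hs
  rw [dist_eq_norm]
  refine lt_of_le_of_lt (Tate.norm_le (t := ∑ μ ∈ s, coeff μ t.1 • Tate.mono K ρ μ - t)
    fun ν => ?_) (half_lt_self hε)
  have hc : coeff ν (∑ μ ∈ s, coeff μ t.1 • Tate.mono K ρ μ - t).1 =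
      (if ν ∈ s then coeff ν t.1 else 0) - coeff ν t.1 := by
    have h1 : (∑ μ ∈ s, coeff μ t.1 • Tate.mono K ρ μ - t).1 =
        ∑ μ ∈ s, coeff μ t.1 • (Tate.mono K ρ μ).1 - t.1 := by
      simp
    rw [h1, map_sub, map_sum]
    congr 1
    have h2 : ∀ μ ∈ s, coeff ν (coeff μ t.1 • (Tate.mono K ρ μ).1) =
        if ν = μ then coeff ν t.1 else 0 := by
      intro μ _
      have : coeff ν (coeff μ t.1 • (Tate.mono K ρ μ).1) =
        coeff μ t.1 * coeff ν (Tate.mono K ρ μ).1 := rfl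
      rw [this, Tate.coeff_mono]
      split_ifs with h
      · simp [h]
      · simp
    rw [Finset.sum_congr rfl h2]
    simp
  rw [hc]
  split_ifs with h
  · simpa using (half_pos hε).le
  · have : ν ∉ {ν | ε / 2 ≤ ‖coeff ν t.1‖ * wt ρ ν} := fun h' => h (hs (by simpa using h'))
    simpa using (not_le.1 this).le

/-- Polynomials are dense. Identities between continuous linear maps are proved by applying this to
the subspace where they agree. -/
theorem Tate.eq_top_of_isClosed {S : Submodule K (Tate K ρ)} (hS : IsClosed (S : Set (Tate K ρ)))
    (h : ∀ ν, Tate.mono K ρ ν ∈ S) : S = ⊤ := by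
  refine (Submodule.eq_top_iff').2 fun t => ?_
  exact hS.mem_of_tendsto (Tate.hasSum_mono t)
    (Eventually.of_forall fun s => S.sum_mem fun ν _ => S.smul_mem _ (h ν))

section Lift

variable {V : Type*} [NormedAddCommGroup V] [NormedSpace K V] [IsUltrametricDist V]
  [CompleteSpace V] {v : (Fin n →₀ ℕ) → V} {C : ℝ}

theorem Tate.summable_smul (hv : ∀ ν, ‖v ν‖ ≤ C * wt ρ ν) (t : Tate K ρ) :
    Summable fun ν => coeff ν t.1 • v ν := by
  refine NonarchimedeanAddGroup.summable_of_tendsto_cofinite_zero ?_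
  rw [tendsto_zero_iff_norm_tendsto_zero]
  have h1 := (mem_Tate_iff.1 t.2).const_mul C
  rw [mul_zero] at h1
  refine squeeze_zero (fun ν => norm_nonneg _) (fun ν => ?_) h1
  rw [norm_smul, mul_left_comm]
  exact mul_le_mul_of_nonneg_left (hv ν) (norm_nonneg _)

/-- A bounded family indexed by the monomials extends to a continuous linear map. -/
noncomputable def Tate.lift (hv : ∀ ν, ‖v ν‖ ≤ C * wt ρ ν) : Tate K ρ →L[K] V :=
  LinearMap.mkContinuous
    { toFun := fun t => ∑' ν, coeff ν t.1 • v ν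
      map_add' := fun s t => by
        rw [← (Tate.summable_smul hv s).tsum_add (Tate.summable_smul hv t)]
        exact tsum_congr fun ν => by rw [← add_smul]; rfl
      map_smul' := fun a t => by
        rw [RingHom.id_apply, ← (Tate.summable_smul hv t).tsum_const_smul]
        exact tsum_congr fun ν => by rw [smul_smul]; rfl } C fun t => by
    have hC : 0 ≤ C := by simpa using (norm_nonneg _).trans (hv 0)
    refine IsUltrametricDist.norm_tsum_le_of_forall_le_of_nonneg
      (mul_nonneg hC (norm_nonneg _)) fun ν => ?_
    rw [norm_smul]
    calc _ ≤ ‖coeff ν t.1‖ * (C * wt ρ ν) := mul_le_mul_of_nonneg_left (hv ν) (norm_nonneg _)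
      _ = C * (‖coeff ν t.1‖ * wt ρ ν) := by ring
      _ ≤ _ := mul_le_mul_of_nonneg_left (Tate.coeff_le t ν) hC

theorem Tate.hasSum_lift (hv : ∀ ν, ‖v ν‖ ≤ C * wt ρ ν) (t : Tate K ρ) :
    HasSum (fun ν => coeff ν t.1 • v ν) (Tate.lift hv t) :=
  (Tate.summable_smul hv t).hasSum

theorem Tate.norm_lift_le (hv : ∀ ν, ‖v ν‖ ≤ C * wt ρ ν) (t : Tate K ρ) :
    ‖Tate.lift hv t‖ ≤ C * ‖t‖ :=
  have hC : 0 ≤ C := by simpa using (norm_nonneg _).trans (hv 0)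
  ContinuousLinearMap.le_of_opNorm_le _ (LinearMap.mkContinuous_norm_le _ hC _) t

theorem Tate.lift_mono (hv : ∀ ν, ‖v ν‖ ≤ C * wt ρ ν) (ν : Fin n →₀ ℕ) :
    Tate.lift hv (Tate.mono K ρ ν) = v ν := by
  classical
  refine (Tate.hasSum_lift hv _).unique ?_
  convert hasSum_ite_eq ν (v ν) using 2 with μ
  rw [Tate.coeff_mono]
  split_ifs with h
  · simp [h]
  · simp

end Lift

section Eval

variable {B : Type*} [NormedCommRing B] [NormedAlgebra K B] [IsUltrametricDist B]
  [CompleteSpace B] [NormOneClass B] {b : Fin n → B}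

/-- Evaluation of the power series of a Tate algebra at a point of the polydisc. -/
noncomputable def Tate.eval (hb : ∀ i, ‖b i‖ ≤ ρ i) : Tate K ρ →ₐ[K] B :=
  AlgHom.ofLinearMap (Tate.lift (K := K) (norm_prod_pow_le hb)).toLinearMap
    (by
      rw [← Tate.mono_zero]
      exact (Tate.lift_mono _ _).trans (by simp))
    (by
      set L := Tate.lift (K := K) (norm_prod_pow_le hb)
      -- Multiplicativity holds on pairs of monomials; density extends it first in the second factor
      -- and then in the first.
      have h1 : ∀ μ t, L (Tate.mono K ρ μ * t) = L (Tate.mono K ρ μ) * L t := by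
        intro μ t
        let S : Submodule K (Tate K ρ) :=
          LinearMap.eqLocus (L.toLinearMap ∘ₗ LinearMap.mulLeft K (Tate.mono K ρ μ))
            (LinearMap.mulLeft K (L (Tate.mono K ρ μ)) ∘ₗ L.toLinearMap)
        have hS : IsClosed (S : Set (Tate K ρ)) :=
          isClosed_eq (L.continuous.comp (continuous_const.mul continuous_id))
            (continuous_const.mul L.continuous)
        have := Tate.eq_top_of_isClosed hS fun ν => by
          change L (Tate.mono K ρ μ * Tate.mono K ρ ν) = L (Tate.mono K ρ μ) * L (Tate.mono K ρ ν)
          rw [← Tate.mono_add, Tate.lift_mono, Tate.lift_mono, Tate.lift_mono,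
            Finsupp.prod_add_index' (by simp) (by simp [pow_add])]
        exact (Submodule.eq_top_iff'.1 this t : t ∈ S)
      intro s t
      let S : Submodule K (Tate K ρ) :=
        LinearMap.eqLocus (L.toLinearMap ∘ₗ LinearMap.mulRight K t)
          (LinearMap.mulRight K (L t) ∘ₗ L.toLinearMap)
      have hS : IsClosed (S : Set (Tate K ρ)) :=
        isClosed_eq (L.continuous.comp (continuous_id.mul continuous_const))
          (L.continuous.mul continuous_const)
      have := Tate.eq_top_of_isClosed hS fun ν => h1 ν t
      exact (Submodule.eq_top_iff'.1 this s : s ∈ S))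

theorem Tate.hasSum_eval (hb : ∀ i, ‖b i‖ ≤ ρ i) (t : Tate K ρ) :
    HasSum (fun ν => coeff ν t.1 • ν.prod fun i k => b i ^ k) (Tate.eval hb t) :=
  Tate.hasSum_lift (norm_prod_pow_le hb) t

theorem Tate.norm_eval_le (hb : ∀ i, ‖b i‖ ≤ ρ i) (t : Tate K ρ) : ‖Tate.eval hb t‖ ≤ ‖t‖ :=
  (Tate.norm_lift_le (norm_prod_pow_le hb) t).trans_eq (one_mul _)

theorem Tate.eval_X (hb : ∀ i, ‖b i‖ ≤ ρ i) (i : Fin n) :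
    Tate.eval hb (Tate.X K ρ i) = b i :=
  (Tate.lift_mono (norm_prod_pow_le hb) _).trans (by simp)

theorem Tate.continuous_eval (hb : ∀ i, ‖b i‖ ≤ ρ i) : Continuous (Tate.eval (K := K) hb) :=
  (Tate.lift (K := K) (norm_prod_pow_le hb)).continuous

end Eval

end Norm

/-- A continuous linear map which is approximately surjective, with bounds, is surjective. -/
theorem exists_preimage_of_approx {K : Type*} [NontriviallyNormedField K] {V W : Type*}
    [NormedAddCommGroup V] [NormedSpace K V] [CompleteSpace V] [NormedAddCommGroup W]
    [NormedSpace K W] (Ψ : V →L[K] W) {C ε : ℝ} (hε0 : 0 ≤ ε) (hε : ε < 1)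
    (h : ∀ w, ∃ v, ‖v‖ ≤ C * ‖w‖ ∧ ‖w - Ψ v‖ ≤ ε * ‖w‖) (w : W) :
    ∃ v, Ψ v = w ∧ ‖v‖ ≤ C / (1 - ε) * ‖w‖ := by
  choose φ hφC hφε using h
  -- `r k` is the error left after `k` corrections. It decays like `ε ^ k`, and the sum of the
  -- corrections `φ (r k)` is the preimage.
  let r : ℕ → W := fun k => (fun x => x - Ψ (φ x))^[k] w
  have hr0 : r 0 = w := rfl
  have hrs : ∀ k, r (k + 1) = r k - Ψ (φ (r k)) := fun k => Function.iterate_succ_apply' _ _ _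
  have hr : ∀ k, ‖r k‖ ≤ ε ^ k * ‖w‖ := by
    intro k
    induction k with
    | zero => simp [hr0]
    | succ k ih =>
      rw [hrs, pow_succ', mul_assoc]
      exact (hφε _).trans (mul_le_mul_of_nonneg_left ih hε0)
  by_cases hw : w = 0
  · exact ⟨0, by simp [hw], by simp [hw]⟩
  have hC : 0 ≤ C := by
    have := (norm_nonneg _).trans (hφC w)
    exact nonneg_of_mul_nonneg_left this (norm_pos_iff.2 hw)
  have hb : ∀ k, ‖φ (r k)‖ ≤ C * ‖w‖ * ε ^ k := fun k =>
    (hφC _).trans (by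
      calc C * ‖r k‖ ≤ C * (ε ^ k * ‖w‖) := mul_le_mul_of_nonneg_left (hr k) hC
        _ = _ := by ring)
  have hg := (hasSum_geometric_of_lt_one hε0 hε).mul_left (C * ‖w‖)
  have hs : Summable fun k => φ (r k) := Summable.of_norm_bounded hg.summable hb
  refine ⟨∑' k, φ (r k), ?_, ?_⟩
  · have h1 := (Ψ.hasSum hs.hasSum).tendsto_sum_nat
    have h2 : ∀ k, ∑ i ∈ Finset.range k, Ψ (φ (r i)) = w - r k := by
      intro k
      induction k with
      | zero => simp [hr0]
      | succ k ih => rw [Finset.sum_range_succ, ih, hrs]; abel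
    have h3 : Tendsto r atTop (𝓝 0) := by
      refine squeeze_zero_norm hr ?_
      simpa using (tendsto_pow_atTop_nhds_zero_of_lt_one hε0 hε).mul_const ‖w‖
    have h4 : Tendsto (fun k => w - r k) atTop (𝓝 w) := by
      simpa using tendsto_const_nhds.sub h3
    exact tendsto_nhds_unique h1 (h4.congr fun k => (h2 k).symm)
  · exact (tsum_of_norm_bounded hg hb).trans (by rw [div_eq_mul_inv]; linarith [mul_right_comm C ‖w‖ (1 - ε)⁻¹])


/-! ### Leading exponents and division in Tate algebras -/

section Division

variable {K : Type u} [NontriviallyNormedField K] {n : ℕ} {ρ : Fin n → ℝ}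

/-- `ν` is the leading exponent of `f` for the polyradius `ρ`: the largest, in the lexicographic
order, among the exponents of the terms of maximal norm. -/
def IsLead (ρ : Fin n → ℝ) (f : MvPowerSeries (Fin n) K) (ν : Fin n →₀ ℕ) : Prop :=
  coeff ν f ≠ 0 ∧ ∀ μ, ‖coeff μ f‖ * wt ρ μ ≤ ‖coeff ν f‖ * wt ρ ν ∧
    (MonomialOrder.lex.toSyn ν < MonomialOrder.lex.toSyn μ →
      ‖coeff μ f‖ * wt ρ μ < ‖coeff ν f‖ * wt ρ ν)

theorem IsLead.pos (hρ : ∀ i, 0 < ρ i) {f : MvPowerSeries (Fin n) K} {ν : Fin n →₀ ℕ}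
    (h : IsLead ρ f ν) : 0 < ‖coeff ν f‖ * wt ρ ν :=
  mul_pos (norm_pos_iff.2 h.1) (wt_pos hρ ν)

variable [IsUltrametricDist K]

/-- Among the finitely many terms at least as large as one fixed nonzero term, maximize the pair
(size, exponent) lexicographically. -/
theorem exists_isLead (hρ : ∀ i, 0 < ρ i) {f : MvPowerSeries (Fin n) K} (hf : f ∈ Tate K ρ)
    (h0 : f ≠ 0) : ∃ ν, IsLead ρ f ν := by
  obtain ⟨μ₀, hμ₀⟩ := (ne_zero_iff_exists_coeff_ne_zero f).1 h0
  have hc : 0 < ‖coeff μ₀ f‖ * wt ρ μ₀ := mul_pos (norm_pos_iff.2 hμ₀) (wt_pos hρ _)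
  obtain ⟨ν, hν, hmax⟩ := (Tate.finite_lt hf hc).exists_maximalFor
    (fun ν => toLex (‖coeff ν f‖ * wt ρ ν, MonomialOrder.lex.toSyn ν)) _ ⟨μ₀, by simp⟩
  have hν' : ‖coeff μ₀ f‖ * wt ρ μ₀ ≤ ‖coeff ν f‖ * wt ρ ν := hν
  have hle : ∀ μ, ‖coeff μ f‖ * wt ρ μ ≤ ‖coeff ν f‖ * wt ρ ν := by
    intro μ
    by_contra hlt
    rw [not_le] at hlt
    have h1 := hmax (hν'.trans hlt.le) (Prod.Lex.toLex_le_toLex.2 (Or.inl hlt))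
    rcases Prod.Lex.toLex_le_toLex.1 h1 with h2 | ⟨h2, -⟩
    · exact lt_asymm hlt h2
    · exact hlt.ne h2.symm
  refine ⟨ν, fun h => ?_, fun μ => ⟨hle μ, fun hlt => (hle μ).lt_of_ne fun heq => ?_⟩⟩
  · rw [h, norm_zero, zero_mul] at hν'
    exact absurd hν' (not_le.2 hc)
  · have h1 := hmax (hν'.trans heq.ge) (Prod.Lex.toLex_le_toLex.2 (Or.inr ⟨heq.symm, hlt.le⟩))
    rcases Prod.Lex.toLex_le_toLex.1 h1 with h2 | ⟨-, h2⟩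
    · exact h2.ne heq
    · exact absurd hlt (not_lt.2 h2)

variable [hρ : Fact (∀ i, 0 < ρ i)]

/-- The coefficient functionals of a Tate algebra. -/
noncomputable def Tate.coeffL (ν : Fin n →₀ ℕ) : Tate K ρ →L[K] K :=
  LinearMap.mkContinuous
    { toFun := fun t => coeff ν t.1
      map_add' := fun _ _ => rfl
      map_smul' := fun _ _ => rfl } (wt ρ ν)⁻¹ fun t => by
    rw [inv_mul_eq_div, le_div_iff₀ (wt_pos hρ.out ν)]
    exact Tate.coeff_le t ν

/-- The terms of `f` beyond its leading exponent form an element of the Tate algebra. Each is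
strictly smaller than the leading term, hence so is the norm of that element; `ε` is the ratio. -/
theorem IsLead.exists_gap {f : Tate K ρ} {ν : Fin n →₀ ℕ} (h : IsLead ρ f.1 ν) :
    ∃ ε < 1, ∀ μ, MonomialOrder.lex.toSyn ν < MonomialOrder.lex.toSyn μ →
      ‖coeff μ f.1‖ * wt ρ μ ≤ ε * (‖coeff ν f.1‖ * wt ρ ν) := by
  classical
  have hN := h.pos hρ.out
  set N := ‖coeff ν f.1‖ * wt ρ ν
  let p : MvPowerSeries (Fin n) K := fun μ =>
    if MonomialOrder.lex.toSyn ν < MonomialOrder.lex.toSyn μ then coeff μ f.1 else 0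
  have hp : ∀ μ, coeff μ p =
    if MonomialOrder.lex.toSyn ν < MonomialOrder.lex.toSyn μ then coeff μ f.1 else 0 := fun _ => rfl
  have hpT : p ∈ Tate K ρ := by
    refine mem_Tate_of_finite (fun i => (hρ.out i).le) fun ε hε =>
      (Tate.finite_lt f.2 hε).subset fun μ hμ => ?_
    simp only [Set.mem_ofPred_eq, hp] at hμ
    split_ifs at hμ
    · exact hμ
    · simp [hε.not_ge] at hμ
  have hlt : ‖(⟨p, hpT⟩ : Tate K ρ)‖ < N := by
    refine Tate.norm_lt_of_forall hN fun μ => ?_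
    rw [hp]
    split_ifs with h'
    · exact (h.2 μ).2 h'
    · simpa using hN
  refine ⟨‖(⟨p, hpT⟩ : Tate K ρ)‖ / N, (div_lt_one hN).2 hlt, fun μ hμ => ?_⟩
  rw [div_mul_cancel₀ _ hN.ne']
  simpa [hp, hμ] using Tate.coeff_le (⟨p, hpT⟩ : Tate K ρ) μ

theorem exists_lt_one_forall_le {ι : Type*} [Finite ι] (ε : ι → ℝ) (h : ∀ i, ε i < 1) :
    ∃ δ, 0 < δ ∧ δ < 1 ∧ ∀ i, ε i ≤ δ := by
  have h1 : ∀ᶠ δ in 𝓝[<] (1 : ℝ), ∀ i, ε i ≤ δ := eventually_all.2 fun i =>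
    mem_nhdsWithin_of_mem_nhds ((lt_mem_nhds (h i)).mono fun _ hx => le_of_lt hx)
  have h2 : ∀ᶠ δ in 𝓝[<] (1 : ℝ), 0 < δ :=
    mem_nhdsWithin_of_mem_nhds (lt_mem_nhds one_pos)
  obtain ⟨δ, ⟨hδ1, hδ2⟩, hδ3⟩ := ((h1.and h2).and self_mem_nhdsWithin).exists
  exact ⟨δ, hδ2, hδ3, hδ1⟩

variable {ι : Type*} [Fintype ι] {f : ι → Tate K ρ} {e : ι → (Fin n →₀ ℕ)}

theorem Tate.coeff_mono_mul (κ : Fin n →₀ ℕ) (t : Tate K ρ) (μ : Fin n →₀ ℕ)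
    [Decidable (κ ≤ μ)] :
    coeff μ (Tate.mono K ρ κ * t).1 = if κ ≤ μ then coeff (μ - κ) t.1 else 0 := by
  classical
  have h := coeff_monomial_mul (R := K) μ κ t.1 1
  rw [one_mul] at h
  refine Eq.trans ?_ (h.trans ?_)
  · rfl
  · congr

/-- Well-founded induction on a strict bound `s` for the exponents of the terms larger than `ε * c`.
The largest such exponent `μ` is removed either by a multiple of some `f i` or by moving its term to
the remainder. By the gap, terms of `f i` beyond `e i` contribute at most `ε * c`, so every
remaining large term has exponent below `μ`. Values in `WithTop` allow the induction to be started
at `⊤`, where `hs` is empty. -/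
theorem Tate.exists_approx_division {ε c : ℝ} (hε : 0 < ε) (hc : 0 < c)
    (he : ∀ i, IsLead ρ (f i).1 (e i))
    (hgap : ∀ i μ, MonomialOrder.lex.toSyn (e i) < MonomialOrder.lex.toSyn μ →
      ‖coeff μ (f i).1‖ * wt ρ μ ≤ ε * (‖coeff (e i) (f i).1‖ * wt ρ (e i)))
    (s : WithTop (MonomialOrder.lex (σ := Fin n)).syn) (g : Tate K ρ) (hg : ‖g‖ ≤ c)
    (hs : ∀ μ, ε * c < ‖coeff μ g.1‖ * wt ρ μ → (MonomialOrder.lex.toSyn μ : WithTop _) < s) :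
    ∃ (q : ι → Tate K ρ) (r : Tate K ρ), (∀ ν i, e i ≤ ν → coeff ν r.1 = 0) ∧
      (∀ i, ‖q i‖ * (‖coeff (e i) (f i).1‖ * wt ρ (e i)) ≤ c) ∧ ‖r‖ ≤ c ∧
      ‖g - (∑ i, q i * f i + r)‖ ≤ ε * c := by
  classical
  induction s using WellFoundedLT.induction generalizing g with
  | ind s ih =>
  have hεc : 0 < ε * c := mul_pos hε hc
  by_cases hne : {μ | ε * c < ‖coeff μ g.1‖ * wt ρ μ}.Nonempty
  swap
  · refine ⟨0, 0, by simp, fun i => by simpa using hc.le, by simpa using hc.le, ?_⟩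
    simp only [Pi.zero_apply, zero_mul, Finset.sum_const_zero, add_zero, sub_zero]
    exact Tate.norm_le fun μ => not_lt.1 fun h => hne ⟨μ, h⟩
  have hfin : {μ | ε * c < ‖coeff μ g.1‖ * wt ρ μ}.Finite :=
    (Tate.finite_lt g.2 hεc).subset fun μ hμ => by
      rw [Set.mem_ofPred_eq] at hμ ⊢
      exact hμ.le
  obtain ⟨μ, hμ, hmax⟩ := hfin.exists_maximalFor (fun ν => MonomialOrder.lex.toSyn ν) _ hne
  have hle : ∀ μ', ε * c < ‖coeff μ' g.1‖ * wt ρ μ' →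
      MonomialOrder.lex.toSyn μ' ≤ MonomialOrder.lex.toSyn μ := fun μ' h' => by
    by_contra hlt
    exact hlt (hmax h' (not_le.1 hlt).le)
  have hw := fun ν => wt_nonneg (fun i => (hρ.out i).le) ν
  have hgμ := (Tate.coeff_le g μ).trans hg
  -- One reduction step: `x` has the same `μ`-term as `g` and no large term beyond `μ`, so the
  -- induction hypothesis applies to `g - x`.
  have hstep : ∀ x : Tate K ρ, coeff μ x.1 = coeff μ g.1 → (∀ μ', ‖coeff μ' x.1‖ * wt ρ μ' ≤ c) →
      (∀ μ', ε * c < ‖coeff μ' x.1‖ * wt ρ μ' →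
        MonomialOrder.lex.toSyn μ' ≤ MonomialOrder.lex.toSyn μ) →
      ∃ (q : ι → Tate K ρ) (r : Tate K ρ), (∀ ν i, e i ≤ ν → coeff ν r.1 = 0) ∧
      (∀ i, ‖q i‖ * (‖coeff (e i) (f i).1‖ * wt ρ (e i)) ≤ c) ∧ ‖r‖ ≤ c ∧
      ‖(g - x) - (∑ i, q i * f i + r)‖ ≤ ε * c := by
    intro x hx hxc hxle
    refine ih (MonomialOrder.lex.toSyn μ) (hs μ hμ) (g - x) ?_ fun μ' hμ' => ?_
    · have := IsUltrametricDist.norm_add_le_max g (-x)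
      rw [← sub_eq_add_neg, norm_neg] at this
      exact this.trans (max_le hg (Tate.norm_le hxc))
    · have hsub : coeff μ' (g - x).1 = coeff μ' g.1 - coeff μ' x.1 := rfl
      have hne' : μ' ≠ μ := by
        rintro rfl
        rw [hsub, hx, sub_self, norm_zero, zero_mul] at hμ'
        exact absurd hμ' (not_lt.2 hεc.le)
      have hor : ε * c < ‖coeff μ' g.1‖ * wt ρ μ' ∨ ε * c < ‖coeff μ' x.1‖ * wt ρ μ' := by
        rw [← lt_max_iff, ← max_mul_of_nonneg _ _ (hw μ')]
        refine hμ'.trans_le (mul_le_mul_of_nonneg_right ?_ (hw μ'))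
        have := IsUltrametricDist.norm_add_le_max (coeff μ' g.1) (-coeff μ' x.1)
        rwa [← sub_eq_add_neg, norm_neg, ← hsub] at this
      have hle' : MonomialOrder.lex.toSyn μ' ≤ MonomialOrder.lex.toSyn μ :=
        hor.elim (hle μ') (hxle μ')
      exact WithTop.coe_lt_coe.2 (lt_of_le_of_ne hle' fun h =>
        hne' (MonomialOrder.lex.toSyn.injective h))
  by_cases hdiv : ∃ i, e i ≤ μ
  · obtain ⟨i, hi⟩ := hdiv
    have hN := (he i).pos hρ.out
    set N := ‖coeff (e i) (f i).1‖ * wt ρ (e i) with hNdef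
    -- `a x ^ κ f i` cancels the term of exponent `μ` exactly. By multiplicativity of weights its
    -- norm is governed by the size of that term, which is at most `c`.
    set a := coeff μ g.1 / coeff (e i) (f i).1 with ha
    set κ := μ - e i with hκ
    have hκμ : κ + e i = μ := tsub_add_cancel_of_le hi
    have hA : ‖a‖ * wt ρ κ * N = ‖coeff μ g.1‖ * wt ρ μ := by
      rw [hNdef, ← hκμ, wt_add, ha, norm_div, hκμ]
      field_simp [norm_ne_zero_iff.2 (he i).1]
    have hcx : ∀ μ', coeff μ' ((a • Tate.mono K ρ κ) * f i).1 =
        a * if κ ≤ μ' then coeff (μ' - κ) (f i).1 else 0 := by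
      intro μ'
      rw [smul_mul_assoc, ← Tate.coeff_mono_mul]
      rfl
    have hxn : ∀ μ', κ ≤ μ' → ‖coeff μ' ((a • Tate.mono K ρ κ) * f i).1‖ * wt ρ μ' =
        ‖a‖ * wt ρ κ * (‖coeff (μ' - κ) (f i).1‖ * wt ρ (μ' - κ)) := by
      intro μ' h
      have : wt ρ μ' = wt ρ κ * wt ρ (μ' - κ) := by rw [← wt_add, add_tsub_cancel_of_le h]
      rw [hcx, if_pos h, norm_mul, this]
      ring
    have hA0 : 0 ≤ ‖a‖ * wt ρ κ := mul_nonneg (norm_nonneg _) (hw κ)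
    obtain ⟨q, r, hr, hq, hrc, hgr⟩ := hstep ((a • Tate.mono K ρ κ) * f i) (by
        rw [hcx, if_pos tsub_le_self, ← hκμ, add_tsub_cancel_left, hκμ, ha,
          div_mul_cancel₀ _ (he i).1]) (fun μ' => by
        by_cases h : κ ≤ μ'
        · rw [hxn μ' h]
          exact (mul_le_mul_of_nonneg_left ((he i).2 _).1 hA0).trans (hA.le.trans hgμ)
        · rw [hcx, if_neg h, mul_zero, norm_zero, zero_mul]; exact hc.le) (fun μ' hμ' => by
        by_cases h : κ ≤ μ'
        · rw [hxn μ' h] at hμ'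
          by_contra hlt
          have h1 : MonomialOrder.lex.toSyn (e i) < MonomialOrder.lex.toSyn (μ' - κ) := by
            rw [not_le, ← hκμ, ← add_tsub_cancel_of_le h, map_add, map_add] at hlt
            exact lt_of_add_lt_add_left hlt
          have h2 := mul_le_mul_of_nonneg_left (hgap i _ h1) hA0
          refine absurd (hμ'.trans_le h2) (not_lt.2 ?_)
          calc _ = ε * (‖a‖ * wt ρ κ * N) := by ring
            _ ≤ ε * c := mul_le_mul_of_nonneg_left (hA.le.trans hgμ) hε.le
        · rw [hcx, if_neg h, mul_zero, norm_zero, zero_mul] at hμ'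
          exact absurd hμ' (not_lt.2 hεc.le))
    set y : Tate K ρ := a • Tate.mono K ρ κ with hy
    refine ⟨q + Pi.single i y, r, hr, fun j => ?_, hrc, ?_⟩
    · by_cases hj : j = i
      · subst hj
        rw [Pi.add_apply, Pi.single_eq_same]
        refine (mul_le_mul_of_nonneg_right (IsUltrametricDist.norm_add_le_max _ _) hN.le).trans ?_
        rw [max_mul_of_nonneg _ _ hN.le]
        refine max_le (hq j) ?_
        rw [hy, norm_smul, Tate.norm_mono]
        exact hA.le.trans hgμ
      · rw [Pi.add_apply, Pi.single_eq_of_ne hj, add_zero]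
        exact hq j
    · have : ∑ j, (q + Pi.single i y : ι → Tate K ρ) j * f j = ∑ j, q j * f j + y * f i := by
        simp only [Pi.add_apply, add_mul, Finset.sum_add_distrib]
        congr 1
        rw [Finset.sum_eq_single i (fun j _ hj => by rw [Pi.single_eq_of_ne hj, zero_mul])
          (by simp), Pi.single_eq_same]
      rw [this]
      convert hgr using 2
      ring
  · push Not at hdiv
    have hcx : ∀ μ', coeff μ' (coeff μ g.1 • Tate.mono K ρ μ).1 =
        if μ' = μ then coeff μ g.1 else 0 := by
      intro μ'
      have : coeff μ' (coeff μ g.1 • Tate.mono K ρ μ).1 =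
        coeff μ g.1 * coeff μ' (Tate.mono K ρ μ).1 := rfl
      rw [this, Tate.coeff_mono]
      split_ifs <;> simp
    obtain ⟨q, r, hr, hq, hrc, hgr⟩ := hstep (coeff μ g.1 • Tate.mono K ρ μ)
      (by rw [hcx, if_pos rfl])
      (fun μ' => by
        rw [hcx]
        split_ifs with h
        · rw [h]; exact hgμ
        · simpa using hc.le) (fun μ' hμ' => by
        rw [hcx] at hμ'
        split_ifs at hμ' with h
        · rw [h]
        · rw [norm_zero, zero_mul] at hμ'
          exact absurd hμ' (not_lt.2 hεc.le))
    refine ⟨q, r + coeff μ g.1 • Tate.mono K ρ μ, fun ν i hν => ?_, hq, ?_, ?_⟩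
    · have : coeff ν (r + coeff μ g.1 • Tate.mono K ρ μ).1 =
        coeff ν r.1 + coeff ν (coeff μ g.1 • Tate.mono K ρ μ).1 := rfl
      rw [this, hr ν i hν, hcx, if_neg, add_zero]
      rintro rfl
      exact hdiv i hν
    · refine (IsUltrametricDist.norm_add_le_max _ _).trans (max_le hrc ?_)
      rw [norm_smul, Tate.norm_mono]
      exact hgμ
    · convert hgr using 2
      ring

/-- The series with no exponents above any of the `e i`. -/
noncomputable def Tate.remainders (K : Type u) [NontriviallyNormedField K] [IsUltrametricDist K]
    (ρ : Fin n → ℝ) {ι : Type*} (e : ι → (Fin n →₀ ℕ)) : Submodule K (Tate K ρ) where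
  carrier := {r | ∀ ν i, e i ≤ ν → coeff ν r.1 = 0}
  zero_mem' := fun _ _ _ => rfl
  add_mem' := fun {a b} ha hb ν i h => by
    have : coeff ν (a + b).1 = coeff ν a.1 + coeff ν b.1 := rfl
    rw [this, ha ν i h, hb ν i h, add_zero]
  smul_mem' := fun c a ha ν i h => by
    have : coeff ν (c • a).1 = c * coeff ν a.1 := rfl
    rw [this, ha ν i h, mul_zero]

theorem Tate.isClosed_remainders {ι : Type*} (e : ι → (Fin n →₀ ℕ)) :
    IsClosed (Tate.remainders K ρ e : Set (Tate K ρ)) := by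
  have : (Tate.remainders K ρ e : Set (Tate K ρ)) =
      ⋂ (ν) (i) (_ : e i ≤ ν), {t | Tate.coeffL ν t = 0} := by
    ext t
    simp only [Set.mem_iInter]
    rfl
  rw [this]
  exact isClosed_iInter fun ν => isClosed_iInter fun i => isClosed_iInter fun _ =>
    isClosed_eq (Tate.coeffL ν).continuous continuous_const

/-- Division with remainder by finitely many elements of a Tate algebra. -/
theorem Tate.exists_division [CompleteSpace K] (he : ∀ i, IsLead ρ (f i).1 (e i)) :
    ∃ C, ∀ g : Tate K ρ, ∃ (q : ι → Tate K ρ), ∃ r ∈ Tate.remainders K ρ e,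
      g = ∑ i, q i * f i + r ∧ ‖r‖ ≤ C * ‖g‖ := by
  classical
  have : CompleteSpace (Tate.remainders K ρ e) :=
    (Tate.isClosed_remainders e).completeSpace_coe
  choose ε hε hgap using fun i => (he i).exists_gap
  obtain ⟨δ, hδ0, hδ1, hδ⟩ := exists_lt_one_forall_le ε hε
  let N : ι → ℝ := fun i => ‖coeff (e i) (f i).1‖ * wt ρ (e i)
  have hN : ∀ i, 0 < N i := fun i => (he i).pos hρ.out
  -- Approximate division says that `Ψ (q, r) = ∑ q i f i + r` is surjective up to a factor `δ < 1`;
  -- successive approximation makes it exact.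
  let Ψ : (ι → Tate K ρ) × Tate.remainders K ρ e →L[K] Tate K ρ :=
    (∑ i, ((ContinuousLinearMap.mul K (Tate K ρ)).flip (f i)).comp
      ((ContinuousLinearMap.proj i).comp (ContinuousLinearMap.fst K _ _))) +
      (Tate.remainders K ρ e).subtypeL.comp (ContinuousLinearMap.snd K _ _)
  have hΨ : ∀ v, Ψ v = ∑ i, v.1 i * f i + v.2.1 := by
    intro v
    simp [Ψ, mul_comm]
  -- `C` must dominate each `(N i)⁻¹`, for the quotients, and `1`, for the remainder.
  let C : ℝ := 1 + ∑ i, (N i)⁻¹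
  have hC : ∀ i, (N i)⁻¹ ≤ C := fun i =>
    (Finset.single_le_sum (fun j _ => (inv_pos.2 (hN j)).le) (Finset.mem_univ i)).trans
      (le_add_of_nonneg_left zero_le_one)
  have hC1 : 1 ≤ C := le_add_of_nonneg_right (Finset.sum_nonneg fun j _ => (inv_pos.2 (hN j)).le)
  have hsurj := exists_preimage_of_approx Ψ (C := C) hδ0.le hδ1 (fun g => by
    by_cases hg : g = 0
    · exact ⟨0, by simp [hg], by simp [hg]⟩
    have hc := norm_pos_iff.2 hg
    obtain ⟨q, r, hr, hq, hrc, hgr⟩ := Tate.exists_approx_division hδ0 hc he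
      (fun i μ h => (hgap i μ h).trans (mul_le_mul_of_nonneg_right (hδ i) (hN i).le)) ⊤ g le_rfl
      (fun _ _ => WithTop.coe_lt_top _)
    refine ⟨(q, ⟨r, hr⟩), ?_, by rwa [hΨ]⟩
    refine max_le ((pi_norm_le_iff_of_nonneg (mul_nonneg (zero_le_one.trans hC1) hc.le)).2
      fun i => ?_) (hrc.trans (le_mul_of_one_le_left hc.le hC1))
    calc ‖q i‖ ≤ ‖g‖ / N i := (le_div_iff₀ (hN i)).2 (hq i)
      _ = (N i)⁻¹ * ‖g‖ := by rw [div_eq_inv_mul]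
      _ ≤ _ := mul_le_mul_of_nonneg_right (hC i) hc.le)
  refine ⟨C / (1 - δ), fun g => ?_⟩
  obtain ⟨v, hv, hvn⟩ := hsurj g
  exact ⟨v.1, v.2.1, v.2.2, by rw [← hΨ, hv], (norm_snd_le v).trans hvn⟩

end Division

/-! ### Noetherianity -/

/-- Dickson's lemma: an arbitrary set of exponents has finitely many elements below which all the
others lie. -/
theorem exists_finite_basis {n : ℕ} (E : Set (Fin n →₀ ℕ)) :
    ∃ (m : ℕ) (e : Fin m → (Fin n →₀ ℕ)), (∀ i, e i ∈ E) ∧ ∀ ν ∈ E, ∃ i, e i ≤ ν := by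
  have hfin : {ν | Minimal (· ∈ E) ν}.Finite :=
    WellQuasiOrderedLE.finite_of_isAntichain (setOfPred_minimal_antichain _)
  let F := hfin.toFinset
  refine ⟨F.card, fun i => (F.equivFin.symm i).1, fun i => ?_, fun ν hν => ?_⟩
  · have : (F.equivFin.symm i).1 ∈ F := (F.equivFin.symm i).2
    exact (hfin.mem_toFinset.1 this).1
  · obtain ⟨μ, hμν, hμ⟩ := exists_minimal_le_of_wellFoundedLT (· ∈ E) ν hν
    exact ⟨F.equivFin ⟨μ, hfin.mem_toFinset.2 hμ⟩, by simpa using hμν⟩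

section Noetherian

variable {K : Type u} [NontriviallyNormedField K] [IsUltrametricDist K] [CompleteSpace K] {n : ℕ}
  {ρ : Fin n → ℝ} [hρ : Fact (∀ i, 0 < ρ i)]

/-- A Gröbner basis of `I`: by Dickson's lemma finitely many leading exponents lie below all the
others. A nonzero `r ∈ I` has a leading exponent above some `e i`, where a remainder has no term. -/
theorem Tate.exists_leads (I : Ideal (Tate K ρ)) :
    ∃ (m : ℕ) (f : Fin m → Tate K ρ) (e : Fin m → (Fin n →₀ ℕ)), (∀ i, f i ∈ I) ∧
      (∀ i, IsLead ρ (f i).1 (e i)) ∧ ∀ r ∈ I, r ∈ Tate.remainders K ρ e → r = 0 := by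
  obtain ⟨m, e, he, hE⟩ := exists_finite_basis {ν | ∃ f ∈ I, IsLead ρ f.1 ν}
  choose f hf hfe using he
  refine ⟨m, f, e, hf, hfe, fun r hr hrem => ?_⟩
  by_contra h0
  obtain ⟨ν, hν⟩ := exists_isLead hρ.out r.2 (fun h => h0 (Subtype.ext h))
  obtain ⟨i, hi⟩ := hE ν ⟨r, hr, hν⟩
  exact hν.1 (hrem ν i hi)

/-- Dividing an element of `I` by a Gröbner basis leaves a remainder in `I`, hence zero. -/
theorem Tate.isNoetherianRing : IsNoetherianRing (Tate K ρ) := by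
  classical
  refine isNoetherianRing_iff_ideal_fg _ |>.2 fun I => ?_
  obtain ⟨m, f, e, hf, hfe, hI⟩ := Tate.exists_leads I
  obtain ⟨C, hC⟩ := Tate.exists_division hfe
  refine ⟨Finset.univ.image f, le_antisymm (Ideal.span_le.2 ?_) fun g hg => ?_⟩
  · simpa [Set.range_subset_iff] using hf
  · obtain ⟨q, r, hr, hgr, -⟩ := hC g
    have hsum : ∀ J : Ideal (Tate K ρ), (∀ i, f i ∈ J) → ∑ i, q i * f i ∈ J := fun J hJ =>
      J.sum_mem fun i _ => J.mul_mem_left _ (hJ i)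
    have hrI : r ∈ I := by
      have : r = g - ∑ i, q i * f i := by rw [hgr]; ring
      rw [this]
      exact I.sub_mem hg (hsum I hf)
    rw [hgr, hI r hrI hr, add_zero]
    exact hsum _ fun i => Ideal.subset_span (by simp)

/-- The remainder depends only on the class modulo `I`, and it is bounded by `C` times the norm of
any representative. For `g` in the closure of `I` these norms can be made arbitrarily small. -/
theorem Tate.isClosed_ideal (I : Ideal (Tate K ρ)) : IsClosed (I : Set (Tate K ρ)) := by
  obtain ⟨m, f, e, hf, hfe, hI⟩ := Tate.exists_leads I
  obtain ⟨C, hC⟩ := Tate.exists_division hfe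
  refine isClosed_of_closure_subset fun g hg => ?_
  have key : ∀ x : Tate K ρ, ∃ r ∈ Tate.remainders K ρ e, x - r ∈ I ∧ ‖r‖ ≤ C * ‖x‖ := by
    intro x
    obtain ⟨q, r, hr, hgr, hrC⟩ := hC x
    refine ⟨r, hr, ?_, hrC⟩
    rw [show x - r = ∑ i, q i * f i by rw [hgr]; ring]
    exact I.sum_mem fun i _ => I.mul_mem_left _ (hf i)
  obtain ⟨r, hr, hgr, -⟩ := key g
  suffices h0 : r = 0 by simpa [h0] using hgr
  have hle : ∀ h ∈ I, ‖r‖ ≤ C * ‖g - h‖ := by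
    intro h hh
    obtain ⟨r', hr', hgr', hrC'⟩ := key (g - h)
    have : r - r' = 0 := by
      refine hI _ ?_ (Submodule.sub_mem _ hr hr')
      have : r - r' = (g - h - r') - (g - r) + h := by ring
      rw [this]
      exact I.add_mem (I.sub_mem hgr' hgr) hh
    rwa [sub_eq_zero.1 this]
  obtain ⟨s, hs, hlim⟩ := mem_closure_iff_seq_limit.1 hg
  have h1 : Tendsto (fun k => C * ‖g - s k‖) atTop (𝓝 (C * ‖g - g‖)) :=
    ((tendsto_const_nhds.sub hlim).norm).const_mul C
  rw [sub_self, norm_zero, mul_zero] at h1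
  exact norm_le_zero_iff.1 (ge_of_tendsto' h1 fun k => hle _ (hs k))

end Noetherian


/-! ### Noetherianity of quasi-Washnitzer algebras -/

section QuasiWashnitzer

variable {K : Type u} [NontriviallyNormedField K] {n : ℕ}

/-- Take a Dickson basis `e i` of these exponents. If `ν ≥ e i` is leading for `σ`, comparing the
terms at `ν` and `e i` and cancelling `σ ^ e i` gives a bound that only improves when `σ` grows to
`ρ`. So the term at `ν` for `ρ` is at least the one at `e i`, which happens for finitely many `ν`.
-/
theorem finite_setOf_isLead [IsUltrametricDist K] {ρ : Fin n → ℝ} {f : MvPowerSeries (Fin n) K}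
    (hf : f ∈ Tate K ρ) :
    {ν | ∃ σ : Fin n → ℝ, (∀ i, 0 < σ i ∧ σ i ≤ ρ i) ∧ IsLead σ f ν}.Finite := by
  obtain ⟨m, e, he, hE⟩ := exists_finite_basis
    {ν | ∃ σ : Fin n → ℝ, (∀ i, 0 < σ i ∧ σ i ≤ ρ i) ∧ IsLead σ f ν}
  have hpos : ∀ i, 0 < ‖coeff (e i) f‖ * wt ρ (e i) := fun i => by
    obtain ⟨σ, hσ, h⟩ := he i
    exact mul_pos (norm_pos_iff.2 h.1) (wt_pos (fun j => (hσ j).1.trans_le (hσ j).2) _)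
  refine (Set.finite_iUnion fun i => Tate.finite_lt hf (hpos i)).subset fun ν hν => ?_
  obtain ⟨i, hi⟩ := hE ν hν
  obtain ⟨σ, hσ, h⟩ := hν
  refine Set.mem_iUnion.2 ⟨i, ?_⟩
  have hσ0 : ∀ j, 0 < σ j := fun j => (hσ j).1
  have h1 := (h.2 (e i)).1
  have hadd : ∀ τ : Fin n → ℝ, wt τ ν = wt τ (ν - e i) * wt τ (e i) := fun τ => by
    rw [← wt_add, tsub_add_cancel_of_le hi]
  rw [hadd, ← mul_assoc] at h1
  have h2 := le_of_mul_le_mul_right h1 (wt_pos hσ0 _)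
  rw [Set.mem_ofPred_eq, hadd, ← mul_assoc]
  refine mul_le_mul_of_nonneg_right (h2.trans ?_)
    (wt_nonneg (fun j => (hσ0 j).le.trans (hσ j).2) _)
  exact mul_le_mul_of_nonneg_left (wt_mono (fun j => (hσ0 j).le) (fun j => (hσ j).2) _)
    (norm_nonneg _)

/-- A sequence of polyradii decreasing to `r`. -/
noncomputable def approxRadius (r : Fin n → NNReal) (k : ℕ) (i : Fin n) : ℝ := r i + 1 / ((k : ℝ) + 1)

theorem lt_approxRadius (r : Fin n → NNReal) (k : ℕ) (i : Fin n) : r i < approxRadius r k i :=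
  lt_add_of_pos_right _ Nat.one_div_pos_of_nat

instance (r : Fin n → NNReal) (k : ℕ) : Fact (∀ i, 0 < approxRadius r k i) :=
  ⟨fun i => (r i).2.trans_lt (lt_approxRadius r k i)⟩

theorem eventually_approxRadius_le {r : Fin n → NNReal} {ρ : Fin n → ℝ} (h : ∀ i, r i < ρ i) :
    ∀ᶠ k in atTop, ∀ i, approxRadius r k i ≤ ρ i := by
  refine eventually_all.2 fun i => ?_
  have h1 : Tendsto (fun k : ℕ => (r i : ℝ) + 1 / ((k : ℝ) + 1)) atTop (𝓝 (r i + 0)) :=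
    tendsto_const_nhds.add tendsto_one_div_add_atTop_nhds_zero_nat
  rw [add_zero] at h1
  exact (h1.eventually (gt_mem_nhds (h i))).mono fun _ hk => le_of_lt hk

/-- The leading exponent of a germ of overconvergent series at the polyradius `r`. -/
def IsGermLead (r : Fin n → NNReal) (f : MvPowerSeries (Fin n) K) (ν : Fin n →₀ ℕ) : Prop :=
  ∀ᶠ k in hyperfilter ℕ, IsLead (approxRadius r k) f ν

variable [IsUltrametricDist K]

theorem eventually_mem_Tate {r : Fin n → NNReal} {f : MvPowerSeries (Fin n) K}
    (hf : f ∈ QuasiWashnitzer K r) : ∀ᶠ k in atTop, f ∈ Tate K (approxRadius r k) := by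
  obtain ⟨ρ, hρ, hfρ⟩ := hf
  filter_upwards [eventually_approxRadius_le hρ] with k hk
  exact Tate_anti K (fun i => (r i).2.trans (lt_approxRadius r k i).le) hk hfρ

/-- Only finitely many exponents are leading for some radius below `ρ`, so the ultrafilter selects
one of them. -/
theorem exists_isGermLead {r : Fin n → NNReal} {f : MvPowerSeries (Fin n) K}
    (hf : f ∈ QuasiWashnitzer K r) (h0 : f ≠ 0) : ∃ ν, IsGermLead r f ν := by
  obtain ⟨ρ, hρ, hfρ⟩ := hf
  have h1 : ∀ᶠ k in hyperfilter ℕ, ∃ ν ∈ {ν | ∃ σ : Fin n → ℝ, (∀ i, 0 < σ i ∧ σ i ≤ ρ i) ∧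
      IsLead σ f ν}, IsLead (approxRadius r k) f ν := by
    filter_upwards [Nat.hyperfilter_le_atTop (eventually_approxRadius_le hρ)] with k hk
    have h0' : ∀ i, 0 < approxRadius r k i := Fact.out
    obtain ⟨ν, hν⟩ := exists_isLead h0' (Tate_anti K (fun i => (h0' i).le) hk hfρ) h0
    exact ⟨ν, ⟨_, fun i => ⟨h0' i, hk i⟩, hν⟩, hν⟩
  obtain ⟨ν, -, hν⟩ := (Ultrafilter.eventually_exists_mem_iff (finite_setOf_isLead hfρ)).1 h1
  exact ⟨ν, hν⟩

/-- The Gröbner argument with germ leads. The division takes place in one Tate algebra, whose radius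
depends on `g`. The remainder has no exponent above any `e i`, so it cannot have a germ lead and
vanishes. -/
theorem QuasiWashnitzer.isNoetherianRing [CompleteSpace K] (r : Fin n → NNReal) :
    IsNoetherianRing (QuasiWashnitzer K r) := by
  classical
  refine isNoetherianRing_iff_ideal_fg _ |>.2 fun I => ?_
  obtain ⟨m, e, he, hE⟩ := exists_finite_basis {ν | ∃ f ∈ I, IsGermLead r f.1 ν}
  choose f hf hfe using he
  refine ⟨Finset.univ.image f, le_antisymm (Ideal.span_le.2 ?_) fun g hg => ?_⟩
  · simpa [Set.range_subset_iff] using hf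
  -- Each condition holds along the ultrafilter, so a single `k` satisfies them all.
  have hev : ∀ᶠ k in hyperfilter ℕ, (g.1 ∈ Tate K (approxRadius r k) ∧
      ∀ i, (f i).1 ∈ Tate K (approxRadius r k)) ∧ ∀ i, IsLead (approxRadius r k) (f i).1 (e i) :=
    Eventually.and (Nat.hyperfilter_le_atTop ((eventually_mem_Tate g.2).and
      (eventually_all.2 fun i => eventually_mem_Tate (f i).2))) (eventually_all.2 hfe)
  obtain ⟨k, ⟨hgk, hfk⟩, hlead⟩ := hev.exists
  obtain ⟨C, hC⟩ := Tate.exists_division (f := fun i => ⟨(f i).1, hfk i⟩) hlead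
  obtain ⟨q, t, ht, hgt, -⟩ := hC ⟨g.1, hgk⟩
  let φ : Tate K (approxRadius r k) →ₐ[K] QuasiWashnitzer K r :=
    Subalgebra.inclusion (Tate_le_quasiWashnitzer K (lt_approxRadius r k))
  have hg' : g = ∑ i, φ (q i) * f i + φ t := by
    have := congrArg φ hgt
    rw [map_add, map_sum] at this
    simp only [map_mul] at this
    exact this
  have hsum : ∀ J : Ideal (QuasiWashnitzer K r), (∀ i, f i ∈ J) → ∑ i, φ (q i) * f i ∈ J :=
    fun J hJ => J.sum_mem fun i _ => J.mul_mem_left _ (hJ i)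
  have htI : φ t ∈ I := by
    have : φ t = g - ∑ i, φ (q i) * f i := by rw [hg']; ring
    rw [this]
    exact I.sub_mem hg (hsum I hf)
  have ht0 : φ t = 0 := by
    by_contra h0
    obtain ⟨ν, hν⟩ := exists_isGermLead (φ t).2 (fun h => h0 (Subtype.ext h))
    obtain ⟨i, hi⟩ := hE ν ⟨_, htI, hν⟩
    obtain ⟨l, hl⟩ := hν.exists
    exact hl.1 (ht ν i hi)
  rw [hg', ht0, add_zero]
  exact hsum _ fun i => Ideal.subset_span (by simp)

end QuasiWashnitzer

/-! ### Algebras with enough finite-dimensional quotients -/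

section ResiduallyFinite

open scoped Pointwise

/-- The intersection of the ideals of finite codimension of the `K`-algebra `B` is zero. -/
def ResiduallyFinite (K : Type*) [Field K] (B : Type*) [CommRing B] [Algebra K B] : Prop :=
  ∀ b : B, b ≠ 0 → ∃ I : Ideal B, b ∉ I ∧ Module.Finite K (B ⧸ I)

/-- All residue fields of `B` are finite over `K`. -/
def FiniteResidueFields (K : Type*) [Field K] (B : Type*) [CommRing B] [Algebra K B] : Prop :=
  ∀ m : Ideal B, m.IsMaximal → Module.Finite K (B ⧸ m)

variable {K : Type*} [Field K] {B C : Type*} [CommRing B] [Algebra K B] [CommRing C] [Algebra K C]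

theorem FiniteResidueFields.of_surjective (h : FiniteResidueFields K B) {φ : B →ₐ[K] C}
    (hφ : Function.Surjective φ) : FiniteResidueFields K C := by
  intro m hm
  have hm' : (m.comap φ).IsMaximal := Ideal.comap_isMaximal_of_surjective φ hφ
  have := h _ hm'
  exact Module.Finite.of_surjective (Ideal.quotientMapₐ m φ le_rfl).toLinearMap
    (Ideal.quotientMap_surjective (H := le_rfl) hφ)

/-- Stating finite codimension through a finitely generated subspace of `B` lets these subspaces be
combined for products of ideals. -/
theorem finite_quotient_iff_exists {I : Ideal B} :
    Module.Finite K (B ⧸ I) ↔ ∃ N : Submodule K B, N.FG ∧ N ⊔ I.restrictScalars K = ⊤ := by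
  constructor
  · rintro ⟨s, hs⟩
    classical
    refine ⟨Submodule.span K (s.image (Function.surjInv Ideal.Quotient.mk_surjective)),
      ⟨_, rfl⟩, (Submodule.eq_top_iff').2 fun b => ?_⟩
    have hb : Ideal.Quotient.mkₐ K I b ∈
        Submodule.map (Ideal.Quotient.mkₐ K I).toLinearMap
        (Submodule.span K (s.image (Function.surjInv Ideal.Quotient.mk_surjective))) := by
      rw [Submodule.map_span]
      have : (Ideal.Quotient.mkₐ K I).toLinearMap ''
          (s.image (Function.surjInv Ideal.Quotient.mk_surjective) : Finset B) = s := by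
        ext x
        simp only [Finset.coe_image, Set.image_image]
        constructor
        · rintro ⟨y, hy, rfl⟩
          have : (Ideal.Quotient.mkₐ K I).toLinearMap
            (Function.surjInv Ideal.Quotient.mk_surjective y) = y :=
            Function.surjInv_eq Ideal.Quotient.mk_surjective y
          simpa only [this] using hy
        · intro hx
          exact ⟨x, hx, Function.surjInv_eq Ideal.Quotient.mk_surjective x⟩
      rw [this, hs]
      trivial
    obtain ⟨c, hc, hcb⟩ := hb
    rw [← sub_add_cancel b c, add_comm]
    exact Submodule.add_mem_sup hc (Ideal.Quotient.eq.1 hcb.symm)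
  · rintro ⟨N, hN, hNI⟩
    have : Module.Finite K N := Module.Finite.iff_fg.2 hN
    refine Module.Finite.of_surjective ((Ideal.Quotient.mkₐ K I).toLinearMap ∘ₗ N.subtype) ?_
    intro x
    obtain ⟨b, rfl⟩ := Ideal.Quotient.mk_surjective x
    obtain ⟨c, hc, d, hd, rfl⟩ := Submodule.mem_sup.1 (hNI ▸ Submodule.mem_top : b ∈ _)
    refine ⟨⟨c, hc⟩, Ideal.Quotient.eq.2 ?_⟩
    have : d ∈ I := hd
    simpa using this

/-- If `s` spans `B` modulo `m` over `K` and `t` generates `m ^ k` as an ideal, then the products `t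
* s` span `m ^ k` modulo `m ^ (k + 1)`. -/
theorem finite_quotient_pow [IsNoetherianRing B] {m : Ideal B} (h : Module.Finite K (B ⧸ m))
    (k : ℕ) : Module.Finite K (B ⧸ m ^ k) := by
  classical
  induction k with
  | zero =>
    rw [pow_zero, Ideal.one_eq_top]
    infer_instance
  | succ k ih =>
    obtain ⟨N, ⟨s, hs⟩, hNm⟩ := finite_quotient_iff_exists.1 h
    obtain ⟨P, hP, hPm⟩ := finite_quotient_iff_exists.1 ih
    obtain ⟨t, ht⟩ := (isNoetherianRing_iff_ideal_fg B).1 inferInstance (m ^ k)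
    refine finite_quotient_iff_exists.2 ⟨P ⊔ Submodule.span K (t * s : Finset B),
      hP.sup ⟨_, rfl⟩, ?_⟩
    rw [eq_top_iff, ← hPm, sup_assoc]
    refine sup_le_sup_left (fun x hx => ?_) P
    have hx' : x ∈ Ideal.span (t : Set B) := by rw [ht]; exact hx
    have hstep : ∀ a ∈ t, ∀ c : B, c * a ∈ Submodule.span K ((t * s : Finset B) : Set B) ⊔
        (m ^ (k + 1)).restrictScalars K := by
      intro a ha c
      have ham : a ∈ m ^ k := by rw [← ht]; exact Ideal.subset_span ha
      obtain ⟨d, hd, y, hy, rfl⟩ := Submodule.mem_sup.1 (hNm ▸ Submodule.mem_top : c ∈ _)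
      rw [add_mul]
      refine Submodule.add_mem_sup ?_ ?_
      · rw [← hs] at hd
        have : Submodule.span K (s : Set B) ≤ (Submodule.span K ((t * s : Finset B) : Set B)).comap
            (LinearMap.mulRight K a) := Submodule.span_le.2 fun z hz =>
          Submodule.subset_span (by
            rw [LinearMap.mulRight_apply, mul_comm z a]
            exact Finset.mem_coe.2 (Finset.mul_mem_mul ha hz))
        exact this hd
      · change y * a ∈ m ^ (k + 1)
        rw [pow_succ']
        exact Ideal.mul_mem_mul hy ham
    refine Submodule.span_induction (p := fun z _ => ∀ c : B, c * z ∈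
      Submodule.span K ((t * s : Finset B) : Set B) ⊔ (m ^ (k + 1)).restrictScalars K)
      (fun a ha c => hstep a ha c) (fun c => by simp)
      (fun a b _ _ iha ihb c => by rw [mul_add]; exact Submodule.add_mem _ (iha c) (ihb c))
      (fun b a _ iha c => by rw [smul_eq_mul, ← mul_assoc]; exact iha _) hx' 1 |> fun h => by
        simpa using h

/-- Suppose `b ≠ 0` lies in every ideal of finite codimension, and let `m` be a maximal ideal
containing its annihilator. Then `b` lies in all powers of `m`, so Krull's theorem gives `r ∈ m`
with `(1 - r) b = 0`. Thus `1 - r ∈ m`, which is absurd. -/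
theorem ResiduallyFinite.of_finiteResidueFields [IsNoetherianRing B]
    (h : FiniteResidueFields K B) : ResiduallyFinite K B := by
  intro b hb
  by_contra hcon
  push Not at hcon
  let A : Ideal B := Submodule.colon ⊥ {b}
  have hA : A ≠ ⊤ := by
    intro hA
    have : (1 : B) ∈ A := hA ▸ Submodule.mem_top
    have := Submodule.mem_colon_singleton.1 this
    simp at this
    exact hb this
  obtain ⟨m, hm, hAm⟩ := Ideal.exists_le_maximal A hA
  have hbm : b ∈ (⨅ i : ℕ, m ^ i • ⊤ : Submodule B B) := by
    refine (Submodule.mem_iInf _).2 fun i => ?_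
    by_contra hbi
    refine hcon (m ^ i) (fun h => hbi ?_) (finite_quotient_pow (h m hm) i)
    simpa using h
  obtain ⟨r, hr⟩ := (Ideal.mem_iInf_smul_pow_eq_bot_iff m b).1 hbm
  have : 1 - (r : B) ∈ A := by
    refine Submodule.mem_colon_singleton.2 ?_
    rw [Submodule.mem_bot, sub_smul, one_smul, hr, sub_self]
  exact hm.ne_top ((Ideal.eq_top_iff_one m).2 (by
    have := m.add_mem (hAm this) r.2
    simpa using this))

end ResiduallyFinite


/-! ### Finiteness of residue fields: the unit polydisc -/

section UnitPolydisc

variable (K : Type u) [NontriviallyNormedField K] [IsUltrametricDist K]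

/-- The valuation ring of `K`. -/
noncomputable abbrev Integers : ValuationSubring K := (NormedField.valuation (K := K)).valuationSubring

/-- The Tate algebra of the unit polydisc. -/
abbrev UnitTate (n : ℕ) : Subalgebra K (MvPowerSeries (Fin n) K) := Tate K fun _ => (1 : ℝ)

instance (n : ℕ) : Fact (∀ _ : Fin n, (0 : ℝ) < 1) := ⟨fun _ => one_pos⟩

variable {K}

theorem residue_eq_zero_iff (a : Integers K) : IsLocalRing.residue (Integers K) a = 0 ↔ ‖(a : K)‖ < 1 := by
  rw [IsLocalRing.residue_eq_zero_iff, IsLocalRing.mem_maximalIdeal, mem_nonunits_iff]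
  have ha : ‖(a : K)‖ ≤ 1 := a.2
  constructor
  · intro h
    refine ha.lt_of_ne fun h1 => h ?_
    have h0 : (a : K) ≠ 0 := fun h0 => by simp [h0] at h1
    have hinv : ‖(a : K)⁻¹‖ ≤ 1 := by rw [norm_inv, h1, inv_one]
    exact IsUnit.of_mul_eq_one ⟨(a : K)⁻¹, hinv⟩ (Subtype.ext (mul_inv_cancel₀ h0))
  · intro h hu
    obtain ⟨b, hb⟩ := hu.exists_right_inv
    have h1 : ‖(a : K)‖ * ‖(b : K)‖ = 1 := by
      have : ((a * b : Integers K) : K) = 1 := by rw [hb]; rfl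
      rw [← norm_mul]
      change ‖((a * b : Integers K) : K)‖ = 1
      rw [this, norm_one]
    have hb1 : ‖(b : K)‖ ≤ 1 := b.2
    have : ‖(a : K)‖ * ‖(b : K)‖ ≤ ‖(a : K)‖ * 1 := mul_le_mul_of_nonneg_left hb1 (norm_nonneg _)
    linarith

variable {n : ℕ}

@[simp] theorem wt_one (ν : Fin n →₀ ℕ) : wt (fun _ => (1 : ℝ)) ν = 1 := by simp [wt_eq_prod]

/-- An integral polynomial as an element of the Tate algebra. -/
noncomputable def integralPoly : MvPolynomial (Fin n) (Integers K) →+* UnitTate K n :=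
  MvPolynomial.eval₂Hom ((algebraMap K (UnitTate K n)).comp (Integers K).subtype) (Tate.X K _)

theorem coeff_integralPoly (F : MvPolynomial (Fin n) (Integers K)) (ν : Fin n →₀ ℕ) :
    coeff ν (integralPoly F).1 = ((F.coeff ν : Integers K) : K) := by
  have h : ((UnitTate K n).val : UnitTate K n →+* _).comp integralPoly =
      MvPolynomial.coeToMvPowerSeries.ringHom.comp (MvPolynomial.map (Integers K).subtype) := by
    refine MvPolynomial.ringHom_ext (fun a => ?_) fun i => ?_
    · simp [integralPoly]
      rfl
    · simp [integralPoly]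
      rfl
  have h2 := congrArg (coeff ν) (RingHom.congr_fun h F)
  refine h2.trans ?_
  simp only [RingHom.comp_apply, MvPolynomial.coeToMvPowerSeries.ringHom_apply,
    MvPolynomial.coeff_coe]
  exact MvPolynomial.coeff_map _ _ _

theorem norm_integralPoly_le (F : MvPolynomial (Fin n) (Integers K)) : ‖integralPoly F‖ ≤ 1 :=
  Tate.norm_le fun ν => by
    rw [coeff_integralPoly, wt_one, mul_one]
    exact (F.coeff ν).2

/-- Reduction of integral polynomials. -/
noncomputable def reduction (n : ℕ) : MvPolynomial (Fin n) (Integers K) →+*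
    MvPolynomial (Fin n) (IsLocalRing.ResidueField (Integers K)) :=
  MvPolynomial.map (IsLocalRing.residue (Integers K))

theorem reduction_surjective : Function.Surjective (reduction (K := K) n) :=
  MvPolynomial.map_surjective _ IsLocalRing.residue_surjective

theorem norm_integralPoly_lt_iff (F : MvPolynomial (Fin n) (Integers K)) :
    ‖integralPoly F‖ < 1 ↔ reduction n F = 0 := by
  have h0 : ∀ ν, (reduction n F).coeff ν = IsLocalRing.residue (Integers K) (F.coeff ν) := fun ν =>
    MvPolynomial.coeff_map _ _ _
  constructor
  · intro h
    ext ν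
    rw [h0, MvPolynomial.coeff_zero, residue_eq_zero_iff, ← coeff_integralPoly]
    have := Tate.coeff_le (integralPoly F) ν
    rw [wt_one, mul_one] at this
    exact this.trans_lt h
  · intro h
    refine Tate.norm_lt_of_forall one_pos fun ν => ?_
    rw [coeff_integralPoly, wt_one, mul_one, ← residue_eq_zero_iff, ← h0, h, MvPolynomial.coeff_zero]

/-- Keep only the finitely many coefficients of norm `1`. -/
theorem exists_integralPoly_approx {t : UnitTate K n} (ht : ‖t‖ ≤ 1) :
    ∃ F, ‖t - integralPoly F‖ < 1 := by
  classical
  have hfin := Tate.finite_lt t.2 one_pos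
  have hA : ∀ ν, coeff ν t.1 ∈ Integers K := fun ν => by
    have := (Tate.coeff_le t ν).trans ht
    rwa [wt_one, mul_one] at this
  let F : MvPolynomial (Fin n) (Integers K) :=
    ∑ ν ∈ hfin.toFinset, MvPolynomial.monomial ν ⟨coeff ν t.1, hA ν⟩
  have hF : ∀ ν, F.coeff ν = if ν ∈ hfin.toFinset then ⟨coeff ν t.1, hA ν⟩ else 0 := by
    intro ν
    rw [MvPolynomial.coeff_sum]
    simp only [MvPolynomial.coeff_monomial]
    simp
  refine ⟨F, Tate.norm_lt_of_forall one_pos fun ν => ?_⟩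
  have : coeff ν (t - integralPoly F).1 = coeff ν t.1 - coeff ν (integralPoly F).1 := rfl
  rw [this, coeff_integralPoly, hF]
  split_ifs with h
  · simp
  · have : ¬ (1 ≤ ‖coeff ν t.1‖ * wt (fun _ => (1 : ℝ)) ν) := by simpa using h
    simpa using not_le.1 this

theorem Tate.norm_le_of_mono {ρ : Fin n → ℝ} [Fact (∀ i, 0 < ρ i)] {V : Type*}
    [NormedAddCommGroup V] [NormedSpace K V] [IsUltrametricDist V] (D : Tate K ρ →L[K] V) {C : ℝ}
    (h : ∀ ν, ‖D (Tate.mono K ρ ν)‖ ≤ C * wt ρ ν) (t : Tate K ρ) : ‖D t‖ ≤ C * ‖t‖ := by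
  have hC : 0 ≤ C := by simpa using (norm_nonneg _).trans (h 0)
  have hs := D.hasSum (Tate.hasSum_mono t)
  rw [← hs.tsum_eq]
  refine IsUltrametricDist.norm_tsum_le_of_forall_le_of_nonneg (mul_nonneg hC (norm_nonneg _))
    fun ν => ?_
  rw [map_smul, norm_smul]
  calc _ ≤ ‖coeff ν t.1‖ * (C * wt ρ ν) := mul_le_mul_of_nonneg_left (h ν) (norm_nonneg _)
    _ = C * (‖coeff ν t.1‖ * wt ρ ν) := by ring
    _ ≤ _ := mul_le_mul_of_nonneg_left (Tate.coeff_le t ν) hC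

/-- Finite generation modulo a closed subspace needs to be checked only on monomials, up to a
relative error `ε < 1` and with bounds. `Tate.lift` extends the approximate expressions linearly to
all series, and `exists_preimage_of_approx` removes the error. -/
theorem Tate.exists_combination {ρ : Fin n → ℝ} [Fact (∀ i, 0 < ρ i)] [CompleteSpace K] {ι : Type*}
    [Fintype ι] {S : Type*} [NormedAddCommGroup S] [NormedSpace K S] [CompleteSpace S]
    [IsUltrametricDist S] (a : ι → S →L[K] Tate K ρ) (J : Submodule K (Tate K ρ))
    (hJ : IsClosed (J : Set (Tate K ρ))) {C ε : ℝ} (hε0 : 0 ≤ ε) (hε : ε < 1)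
    (h : (Fin n →₀ ℕ) → ι → S) (q : (Fin n →₀ ℕ) → Tate K ρ) (hh : ∀ ν β, ‖h ν β‖ ≤ C * wt ρ ν)
    (hq : ∀ ν, ‖q ν‖ ≤ C * wt ρ ν) (hqJ : ∀ ν, q ν ∈ J)
    (hhq : ∀ ν, ‖Tate.mono K ρ ν - ∑ β, a β (h ν β) - q ν‖ ≤ ε * wt ρ ν) (t : Tate K ρ) :
    ∃ x : ι → S, t - ∑ β, a β (x β) ∈ J := by
  have hρ : Fact (∀ i, 0 < ρ i) := inferInstance
  have hC : 0 ≤ C := by simpa using (norm_nonneg _).trans (hq 0)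
  have : CompleteSpace J := hJ.completeSpace_coe
  let Lh : ∀ β, Tate K ρ →L[K] S := fun β => Tate.lift fun ν => hh ν β
  let Lq : Tate K ρ →L[K] Tate K ρ := Tate.lift hq
  have hLq : ∀ t, Lq t ∈ J := fun t =>
    hJ.mem_of_tendsto (Tate.hasSum_lift hq t) (Eventually.of_forall fun s =>
      J.sum_mem fun ν _ => J.smul_mem _ (hqJ ν))
  let Ψ : (ι → S) × J →L[K] Tate K ρ :=
    (∑ β, (a β).comp ((ContinuousLinearMap.proj β).comp (ContinuousLinearMap.fst K _ _))) +
      J.subtypeL.comp (ContinuousLinearMap.snd K _ _)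
  have hΨ : ∀ v, Ψ v = ∑ β, a β (v.1 β) + v.2.1 := by
    intro v
    simp only [Ψ, add_apply, sum_apply]
    rfl
  let D : Tate K ρ →L[K] Tate K ρ := ContinuousLinearMap.id K _ - ∑ β, (a β).comp (Lh β) - Lq
  have hDa : ∀ t, D t = t - ∑ β, a β (Lh β t) - Lq t := fun t => by
    simp only [D, sub_apply, sum_apply]
    rfl
  have hD : ∀ t, ‖D t‖ ≤ ε * ‖t‖ := Tate.norm_le_of_mono D fun ν => by
    rw [hDa]
    simp only [Lh, Lq, Tate.lift_mono]
    exact hhq ν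
  obtain ⟨y, hy, -⟩ := exists_preimage_of_approx Ψ (C := C) hε0 hε
    (fun t => ⟨(fun β => Lh β t, ⟨Lq t, hLq t⟩), max_le
      ((pi_norm_le_iff_of_nonneg (mul_nonneg hC (norm_nonneg _))).2
        fun β => Tate.norm_lift_le (fun ν => hh ν β) t) (Tate.norm_lift_le hq t), by
      rw [hΨ, ← sub_sub, ← hDa]
      exact hD t⟩) t
  refine ⟨y.1, ?_⟩
  rw [← hy, hΨ, add_sub_cancel_left]
  exact y.2.2

theorem exists_spanning_of_finite {A R : Type*} [CommRing A] [CommRing R] {g : A →+* R}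
    (hg : g.Finite) : ∃ (b : ℕ) (w : Fin b → R), ∀ x, ∃ f : Fin b → A, x = ∑ β, g (f β) * w β := by
  let _ := g.toAlgebra
  have : Module.Finite A R := hg
  obtain ⟨b, w, hw⟩ := Module.Finite.exists_fin (R := A) (M := R)
  refine ⟨b, w, fun x => ?_⟩
  obtain ⟨f, hf⟩ := (Submodule.mem_span_range_iff_exists_fun A).1 (hw ▸ Submodule.mem_top : x ∈ _)
  exact ⟨f, hf.symm.trans (Finset.sum_congr rfl fun β _ => Algebra.smul_def _ _)⟩

theorem norm_sub_le_max' {V : Type*} [SeminormedAddCommGroup V] [IsUltrametricDist V] (x y : V) :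
    ‖x - y‖ ≤ max ‖x‖ ‖y‖ := by
  have := IsUltrametricDist.norm_add_le_max x (-y)
  rwa [← sub_eq_add_neg, norm_neg] at this

theorem norm_sum_mul_le {R ι : Type*} [NormedCommRing R] [IsUltrametricDist R] (s : Finset ι)
    {a b : ι → R} {c d : ℝ} (hc : 0 ≤ c) (hd : 0 ≤ d) (ha : ∀ i ∈ s, ‖a i‖ ≤ c)
    (hb : ∀ i ∈ s, ‖b i‖ ≤ d) : ‖∑ i ∈ s, a i * b i‖ ≤ c * d :=
  IsUltrametricDist.norm_sum_le_of_forall_le_of_nonneg (mul_nonneg hc hd) fun i hi =>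
    (norm_mul_le _ _).trans (mul_le_mul (ha i hi) (hb i hi) (norm_nonneg _) hc)

variable [CompleteSpace K]

/-- Noether normalization for quotients of the Tate algebra of the unit polydisc. -/
theorem UnitTate.noether_normalization (J : Ideal (UnitTate K n)) (hJ : J ≠ ⊤) :
    ∃ (s : ℕ) (θ : UnitTate K s →ₐ[K] UnitTate K n), (∀ h, θ h ∈ J → h = 0) ∧
      ∃ (b : ℕ) (w : Fin b → UnitTate K n), ∀ t, ∃ h : Fin b → UnitTate K s,
        t - ∑ β, θ (h β) * w β ∈ J := by
  classical
  -- Integral polynomials that agree with an element of `J` up to norm less than `1`. The image `J₁`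
  -- of `J₀` plays the role of the reduction of `J`.
  let J₀ : Ideal (MvPolynomial (Fin n) (Integers K)) :=
    { carrier := {F | ∃ q ∈ J, ‖integralPoly F - q‖ < 1}
      zero_mem' := ⟨0, J.zero_mem, by simp⟩
      add_mem' := by
        rintro F G ⟨q, hq, hF⟩ ⟨p, hp, hG⟩
        refine ⟨q + p, J.add_mem hq hp, ?_⟩
        rw [map_add, add_sub_add_comm]
        exact (IsUltrametricDist.norm_add_le_max _ _).trans_lt (max_lt hF hG)
      smul_mem' := by
        rintro H F ⟨q, hq, hF⟩
        refine ⟨integralPoly H * q, J.mul_mem_left _ hq, ?_⟩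
        rw [smul_eq_mul, map_mul, ← mul_sub]
        exact (norm_mul_le _ _).trans_lt (mul_lt_one_of_nonneg_of_lt_one_right
          (norm_integralPoly_le H) (norm_nonneg _) hF) }
  have hJ₀ : ∀ F, F ∈ J₀ ↔ ∃ q ∈ J, ‖integralPoly F - q‖ < 1 := fun _ => Iff.rfl
  let J₁ := J₀.map (reduction n)
  have hJ₁ : ∀ F, reduction n F ∈ J₁ ↔ F ∈ J₀ := by
    intro F
    refine ⟨fun h => ?_, fun h => Ideal.mem_map_of_mem _ h⟩
    obtain ⟨G, hG, hGF⟩ := (Ideal.mem_map_iff_of_surjective _ reduction_surjective).1 h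
    have h1 : F - G ∈ J₀ := ⟨0, J.zero_mem, by
      rw [sub_zero, norm_integralPoly_lt_iff, map_sub, hGF, sub_self]⟩
    simpa using J₀.add_mem h1 hG
  -- Otherwise `J` contains an element at distance less than `1` from `1`, which is a unit by the
  -- geometric series.
  have hJ₁top : J₁ ≠ ⊤ := by
    intro h
    have h1 : (1 : MvPolynomial (Fin n) (Integers K)) ∈ J₀ := by
      rw [← hJ₁, h]; exact Submodule.mem_top
    obtain ⟨q, hq, hlt⟩ := h1
    rw [map_one] at hlt
    refine hJ (J.eq_top_of_isUnit_mem hq ?_)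
    have := (Units.oneSub (1 - q) hlt).isUnit
    rwa [Units.val_oneSub, sub_sub_cancel] at this
  have : Nontrivial (MvPolynomial (Fin n) (IsLocalRing.ResidueField (Integers K)) ⧸ J₁) :=
    Ideal.Quotient.nontrivial_iff.2 hJ₁top
  -- Noether normalization over the residue field; the images of the variables under `g` are lifted
  -- to integral polynomials `Z`, and `θ` is evaluation at these.
  obtain ⟨s, g, hginj, hgfin⟩ := exists_finite_inj_algHom_of_fg
    (IsLocalRing.ResidueField (Integers K))
    (MvPolynomial (Fin n) (IsLocalRing.ResidueField (Integers K)) ⧸ J₁)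
  let red : MvPolynomial (Fin n) (Integers K) →+* _ := (Ideal.Quotient.mk J₁).comp (reduction n)
  have hred : Function.Surjective red :=
    Ideal.Quotient.mk_surjective.comp reduction_surjective
  have hredJ : ∀ F, red F = 0 ↔ F ∈ J₀ := fun F => by
    rw [← hJ₁]; exact Ideal.Quotient.eq_zero_iff_mem
  choose Z hZ using fun i => hred (g (MvPolynomial.X i))
  let Θ : MvPolynomial (Fin s) (Integers K) →+* MvPolynomial (Fin n) (Integers K) :=
    MvPolynomial.eval₂Hom MvPolynomial.C Z
  have hΘ : ∀ H, red (Θ H) = g (reduction s H) := by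
    intro H
    have : red.comp Θ = (g : _ →+* _).comp (reduction s) := by
      refine MvPolynomial.ringHom_ext (fun a => ?_) fun i => ?_
      · simp only [RingHom.comp_apply, Θ, MvPolynomial.eval₂Hom_C, red, reduction,
          MvPolynomial.map_C]
        exact (g.commutes _).symm
      · simp only [RingHom.comp_apply, Θ, MvPolynomial.eval₂Hom_X', hZ, reduction,
          MvPolynomial.map_X]
        rfl
    exact RingHom.congr_fun this H
  let θ : UnitTate K s →ₐ[K] UnitTate K n :=
    Tate.eval (b := fun i => integralPoly (Z i)) fun i => norm_integralPoly_le (Z i)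
  have hθn : ∀ h, ‖θ h‖ ≤ ‖h‖ := fun h => Tate.norm_eval_le _ h
  have hθΘ : ∀ H, θ (integralPoly H) = integralPoly (Θ H) := by
    intro H
    have : (θ : _ →+* _).comp integralPoly = integralPoly.comp Θ := by
      refine MvPolynomial.ringHom_ext (fun a => ?_) fun i => ?_
      · simp only [RingHom.comp_apply, Θ, MvPolynomial.eval₂Hom_C, integralPoly]
        exact θ.commutes _
      · simp only [RingHom.comp_apply, Θ, MvPolynomial.eval₂Hom_X', integralPoly]
        exact Tate.eval_X (fun i => norm_integralPoly_le (Z i)) i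
    exact RingHom.congr_fun this H
  refine ⟨s, θ, fun h hh => ?_, ?_⟩
  · by_contra h0
    obtain ⟨ν, hν⟩ := Tate.exists_norm_eq h
    rw [wt_one, mul_one] at hν
    have hn0 : coeff ν h.1 ≠ 0 := by
      rw [← norm_pos_iff, ← hν]; exact norm_pos_iff.2 h0
    -- Scaled to norm `1`, `h'` would have nonzero reduction. But `θ h' ∈ J` makes that reduction
    -- vanish, by injectivity of `g`.
    set h' := (coeff ν h.1)⁻¹ • h with hh'
    have hn1 : ‖h'‖ = 1 := by
      rw [hh', norm_smul, norm_inv, hν, inv_mul_cancel₀ (norm_ne_zero_iff.2 hn0)]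
    have hθJ : θ h' ∈ J := by
      rw [hh', map_smul, Algebra.smul_def]
      exact J.mul_mem_left _ hh
    obtain ⟨H, hH⟩ := exists_integralPoly_approx hn1.le
    have hΘJ : Θ H ∈ J₀ := ⟨θ h', hθJ, by
      rw [← hθΘ, norm_sub_rev, ← map_sub]
      exact (hθn _).trans_lt hH⟩
    have h1 : reduction s H = 0 := by
      apply hginj
      rw [← hΘ, map_zero]
      exact (hredJ _).2 hΘJ
    have h2 := (norm_integralPoly_lt_iff H).2 h1
    have h3 := (IsUltrametricDist.norm_add_le_max (h' - integralPoly H) (integralPoly H)).trans_lt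
      (max_lt hH h2)
    rw [sub_add_cancel, hn1] at h3
    exact lt_irrefl _ h3
  · obtain ⟨b, ω, hω⟩ := exists_spanning_of_finite (g := g.toRingHom) hgfin
    choose W hW using fun β => hred (ω β)
    let w : Fin b → UnitTate K n := fun β => integralPoly (W β)
    have hw : ∀ β, ‖w β‖ ≤ 1 := fun β => norm_integralPoly_le _
    have hspan : ∀ F, ∃ (H : Fin b → MvPolynomial (Fin s) (Integers K)) (q : UnitTate K n), q ∈ J ∧
        ‖integralPoly F - ∑ β, θ (integralPoly (H β)) * w β - q‖ < 1 := by
      intro F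
      obtain ⟨f, hf⟩ := hω (red F)
      choose H hH using fun β => reduction_surjective (f β)
      have hsum : red F = ∑ β, red (Θ (H β)) * red (W β) := by
        rw [hf]
        refine Finset.sum_congr rfl fun β _ => ?_
        rw [hΘ, hH, hW]
        rfl
      have hmem : F - ∑ β, Θ (H β) * W β ∈ J₀ := by
        rw [← hredJ, map_sub, hsum, map_sum, sub_eq_zero]
        exact Finset.sum_congr rfl fun β _ => (map_mul _ _ _).symm
      obtain ⟨q, hq, hlt⟩ := hmem
      refine ⟨H, q, hq, ?_⟩
      rw [map_sub, map_sum] at hlt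
      simp only [map_mul, ← hθΘ] at hlt
      exact hlt
    obtain ⟨H1, q1, hq1, h1⟩ := hspan 1
    choose He qe hqe he using fun (i : Fin n) (β : Fin b) => hspan (MvPolynomial.X i * W β)
    -- Only finitely many approximate relations are used, for `1` (index `none`) and for the
    -- products `x_i w_β`, so one `ε < 1` bounds all their errors.
    obtain ⟨ε, hε0, hε1, hε⟩ := exists_lt_one_forall_le (fun o : Option (Fin n × Fin b) =>
      o.elim ‖integralPoly 1 - ∑ β, θ (integralPoly (H1 β)) * w β - q1‖ fun p =>
        ‖integralPoly (MvPolynomial.X p.1 * W p.2) -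
          ∑ β, θ (integralPoly (He p.1 p.2 β)) * w β - qe p.1 p.2‖)
      (fun o => by cases o with
        | none => exact h1
        | some p => exact he p.1 p.2)
    -- Multiplication by a variable preserves `Q`: each `x_i w_β` is rewritten by its relation, and
    -- the ultrametric inequality keeps the error at `ε`. Hence all monomials satisfy `Q`.
    let Q : UnitTate K n → Prop := fun t => ∃ (h : Fin b → UnitTate K s) (q : UnitTate K n),
      (∀ β, ‖h β‖ ≤ 1) ∧ q ∈ J ∧ ‖t - ∑ β, θ (h β) * w β - q‖ ≤ ε
    have hX : ∀ i : Fin n, ‖Tate.X K (fun _ : Fin n => (1 : ℝ)) i‖ ≤ 1 := fun i =>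
      (Tate.norm_X i).le
    have hQX : ∀ i t, Q t → Q (Tate.X K _ i * t) := by
      rintro i t ⟨h, q, hh, hq, ht⟩
      refine ⟨fun β' => ∑ β, h β * integralPoly (He i β β'),
        Tate.X K _ i * q + ∑ β, θ (h β) * qe i β, fun β' => ?_, ?_, ?_⟩
      · refine (norm_sum_mul_le _ zero_le_one zero_le_one (fun β _ => hh β)
          (fun β _ => norm_integralPoly_le _)).trans_eq (mul_one 1)
      · exact J.add_mem (J.mul_mem_left _ hq) (J.sum_mem fun β _ => J.mul_mem_left _ (hqe i β))
      · have hw' : ∀ β, integralPoly (MvPolynomial.X i * W β) = Tate.X K _ i * w β := fun β => by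
          rw [map_mul]
          congr 1
          exact MvPolynomial.eval₂Hom_X' _ _ _
        have key : Tate.X K _ i * t - ∑ β', θ (∑ β, h β * integralPoly (He i β β')) * w β' -
            (Tate.X K _ i * q + ∑ β, θ (h β) * qe i β) =
            Tate.X K _ i * (t - ∑ β, θ (h β) * w β - q) + ∑ β, θ (h β) *
              (integralPoly (MvPolynomial.X i * W β) -
                ∑ β', θ (integralPoly (He i β β')) * w β' - qe i β) := by
          simp only [hw', map_sum, map_mul, Finset.sum_mul, mul_sub, Finset.mul_sum,
            Finset.sum_sub_distrib]
          rw [Finset.sum_comm]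
          simp only [mul_assoc, mul_left_comm (Tate.X K _ i)]
          abel
        rw [key]
        refine (IsUltrametricDist.norm_add_le_max _ _).trans (max_le ?_ ?_)
        · refine (norm_mul_le _ _).trans ?_
          calc _ ≤ 1 * ε := mul_le_mul (hX i) ht (norm_nonneg _) zero_le_one
            _ = ε := one_mul ε
        · exact (norm_sum_mul_le _ zero_le_one hε0.le (fun β _ => (hθn _).trans (hh β))
            (fun β _ => hε (some (i, β)))).trans_eq (one_mul ε)
    have hQ1 : Q 1 := ⟨fun β => integralPoly (H1 β), q1, fun β => norm_integralPoly_le _, hq1, by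
      have := hε none
      rwa [map_one] at this⟩
    have hQmul : ∀ ν t, Q t → Q (Tate.mono K _ ν * t) := by
      intro ν
      induction ν using Finsupp.induction_linear with
      | zero => intro t ht; rwa [Tate.mono_zero, one_mul]
      | add μ ν hμ hν => intro t ht; rw [Tate.mono_add, mul_assoc]; exact hμ _ (hν _ ht)
      | single i k =>
        induction k with
        | zero => intro t ht; rwa [Finsupp.single_zero, Tate.mono_zero, one_mul]
        | succ k ih =>
          intro t ht
          rw [Finsupp.single_add, Tate.mono_add, mul_assoc]
          exact ih _ (hQX i t ht)
    have hQ : ∀ ν, Q (Tate.mono K _ ν) := fun ν => by simpa using hQmul ν 1 hQ1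
    choose h q hh hq hhq using hQ
    have hq1 : ∀ ν, ‖q ν‖ ≤ 1 := by
      intro ν
      have e1 : ‖∑ β, θ (h ν β) * w β‖ ≤ 1 :=
        (norm_sum_mul_le _ zero_le_one zero_le_one (fun β _ => (hθn _).trans (hh ν β))
          (fun β _ => hw β)).trans_eq (mul_one 1)
      have e2 : ‖Tate.mono K (fun _ : Fin n => (1 : ℝ)) ν‖ ≤ 1 := by
        rw [Tate.norm_mono, wt_one]
      have e3 := norm_sub_le_max' (Tate.mono K (fun _ => (1 : ℝ)) ν)
        (∑ β, θ (h ν β) * w β)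
      have e4 := norm_sub_le_max'
        (Tate.mono K (fun _ => (1 : ℝ)) ν - ∑ β, θ (h ν β) * w β)
        (Tate.mono K (fun _ => (1 : ℝ)) ν - ∑ β, θ (h ν β) * w β - q ν)
      rw [sub_sub_cancel] at e4
      exact e4.trans (max_le (e3.trans (max_le e2 e1)) ((hhq ν).trans hε1.le))
    let θL : UnitTate K s →L[K] UnitTate K n := ⟨θ.toLinearMap, Tate.continuous_eval _⟩
    let a : Fin b → UnitTate K s →L[K] UnitTate K n := fun β =>
      ((ContinuousLinearMap.mul K (UnitTate K n)).flip (w β)).comp θL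
    refine ⟨b, w, Tate.exists_combination a (J.restrictScalars K) (Tate.isClosed_ideal J) hε0.le
      hε1 h q (C := 1) (fun ν β => ?_) (fun ν => ?_) hq fun ν => ?_⟩
    · rw [wt_one, mul_one]; exact hh ν β
    · rw [wt_one, mul_one]; exact hq1 ν
    · rw [wt_one, mul_one]; exact hhq ν

end UnitPolydisc


/-! ### Finiteness of residue fields -/

section Nullstellensatz

theorem _root_.RingHom.finite_of_spanning {A R : Type*} [CommRing A] [CommRing R] {g : A →+* R}
    {ι : Type*} [Fintype ι] (w : ι → R) (h : ∀ x, ∃ f : ι → A, x = ∑ β, g (f β) * w β) :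
    g.Finite := by
  let _ := g.toAlgebra
  change Module.Finite A R
  refine Module.Finite.of_surjective (Fintype.linearCombination A w) fun x => ?_
  obtain ⟨f, rfl⟩ := h x
  exact ⟨f, by simp [Fintype.linearCombination_apply, Algebra.smul_def]; rfl⟩

/-- `B ⧸ I` is finite over `A ⧸ θ⁻¹ I`, which is finite over `K`. -/
theorem finite_quotient_of_comap {K A B : Type*} [Field K] [CommRing A] [Algebra K A] [CommRing B]
    [Algebra K B] (θ : A →ₐ[K] B) (I : Ideal B)
    (hθ : ((Ideal.Quotient.mk I).comp (θ : A →+* B)).Finite)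
    (h : Module.Finite K (A ⧸ I.comap θ)) : Module.Finite K (B ⧸ I) := by
  have h1 : (Ideal.quotientMap I (θ : A →+* B) le_rfl).Finite :=
    RingHom.Finite.of_comp_finite (f := Ideal.Quotient.mk (I.comap (θ : A →+* B))) (by
      rwa [Ideal.quotientMap_comp_mk])
  have h2 : (algebraMap K (A ⧸ I.comap (θ : A →+* B))).Finite := RingHom.finite_algebraMap.2 h
  have h3 := h1.comp h2
  rw [← RingHom.finite_algebraMap]
  convert h3 using 1
  ext x
  simp only [RingHom.comp_apply, ← Ideal.Quotient.mk_algebraMap, Ideal.quotientMap_mk]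
  congr 1
  exact (θ.commutes x).symm

variable {K : Type u} [NontriviallyNormedField K] [IsUltrametricDist K] {n : ℕ}

theorem Tate.coeff_zero_X_mul {ρ : Fin n → ℝ} (i : Fin n) (t : Tate K ρ) :
    coeff 0 (Tate.X K ρ i * t).1 = 0 := by
  classical
  change coeff 0 (MvPowerSeries.monomial (Finsupp.single i 1) (1 : K) * t.1) = 0
  rw [coeff_monomial_mul, if_neg]
  simp

theorem Tate.mono_eq_prod_univ {ρ : Fin n → ℝ} (ν : Fin n →₀ ℕ) :
    Tate.mono K ρ ν = ∏ i, Tate.X K ρ i ^ ν i := by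
  rw [Tate.mono_eq_prod, Finsupp.prod_fintype _ _ (by simp)]

/-- A multiple of a variable has constant term zero, so a variable is not invertible. -/
theorem UnitTate.not_isField (n : ℕ) : ¬ IsField (UnitTate K (n + 1)) := by
  intro h
  have hX : Tate.X K (fun _ : Fin (n + 1) => (1 : ℝ)) 0 ≠ 0 := by
    rw [← norm_pos_iff, Tate.norm_X]; exact one_pos
  obtain ⟨y, hy⟩ := h.mul_inv_cancel hX
  have h0 := Tate.coeff_zero_X_mul 0 y
  rw [hy] at h0
  have : coeff 0 (1 : MvPowerSeries (Fin (n + 1)) K) = 0 := h0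
  simp at this

theorem UnitTate.algebraMap_surjective : Function.Surjective (algebraMap K (UnitTate K 0)) := by
  intro t
  refine ⟨coeff 0 t.1, Subtype.ext (MvPowerSeries.ext fun ν => ?_)⟩
  rw [Subsingleton.elim ν 0]
  change coeff 0 (C (coeff 0 t.1)) = _
  simp

variable [CompleteSpace K]

/-- By Noether normalization the residue field is finite over an injected Tate algebra in `s`
variables. That algebra is then itself a field, which forces `s = 0`. -/
theorem UnitTate.finiteResidueFields (n : ℕ) : FiniteResidueFields K (UnitTate K n) := by
  intro m hm
  obtain ⟨s, θ, hinj, b, w, hw⟩ := UnitTate.noether_normalization m hm.ne_top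
  let g : UnitTate K s →+* UnitTate K n ⧸ m := (Ideal.Quotient.mk m).comp (θ : _ →+* _)
  have hg : g.Finite := RingHom.finite_of_spanning (fun β => Ideal.Quotient.mk m (w β)) fun x => by
    obtain ⟨t, rfl⟩ := Ideal.Quotient.mk_surjective x
    obtain ⟨h, hh⟩ := hw t
    refine ⟨h, ?_⟩
    rw [← Ideal.Quotient.eq_zero_iff_mem, map_sub, sub_eq_zero] at hh
    rw [hh, map_sum]
    exact Finset.sum_congr rfl fun β _ => map_mul _ _ _
  have hginj : Function.Injective g := (injective_iff_map_eq_zero g).2 fun h hh =>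
    hinj h (Ideal.Quotient.eq_zero_iff_mem.1 hh)
  have hs : IsField (UnitTate K s) := by
    let _ := g.toAlgebra
    have : Module.Finite (UnitTate K s) (UnitTate K n ⧸ m) := hg
    exact isField_of_isIntegral_of_isField hginj ((Ideal.Quotient.maximal_ideal_iff_isField_quotient m).1 hm)
  obtain - | s := s
  · refine finite_quotient_of_comap θ m hg ?_
    rw [← RingHom.finite_algebraMap]
    exact RingHom.Finite.of_surjective _ (Ideal.Quotient.mk_surjective.comp
      UnitTate.algebraMap_surjective)
  · exact (UnitTate.not_isField s hs).elim

/-- A Tate algebra with radii in `√|K^×|` is finite over that of the unit polydisc. -/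
theorem Tate.exists_finite {ρ : Fin n → ℝ} (hρ : ∀ i, IsRadius K (ρ i)) :
    ∃ θ : UnitTate K n →ₐ[K] Tate K ρ, (θ : UnitTate K n →+* Tate K ρ).Finite := by
  classical
  have hfact : Fact (∀ i, 0 < ρ i) := ⟨fun i => (hρ i).1⟩
  choose hpos k hk c hc using hρ
  have hc0 : ∀ i, c i ≠ 0 := fun i => by
    rw [← norm_pos_iff, ← hc]; exact pow_pos (hpos i) _
  -- With `ρ_i ^ k_i = ‖c_i‖`, the elements `c_i⁻¹ x_i ^ k_i` have norm at most `1` and serve as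
  -- images of the variables.
  have hb : ∀ i, ‖(c i)⁻¹ • Tate.X K ρ i ^ k i‖ ≤ (1 : ℝ) := fun i => by
    rw [norm_smul, norm_inv, ← hc]
    calc _ ≤ (ρ i ^ k i)⁻¹ * ‖Tate.X K ρ i‖ ^ k i :=
          mul_le_mul_of_nonneg_left (norm_pow_le _ _) (inv_nonneg.2 (pow_pos (hpos i) _).le)
      _ = 1 := by rw [Tate.norm_X, inv_mul_cancel₀ (pow_pos (hpos i) _).ne']
  let θ : UnitTate K n →ₐ[K] Tate K ρ := Tate.eval hb
  let θL : UnitTate K n →L[K] Tate K ρ := ⟨θ.toLinearMap, Tate.continuous_eval hb⟩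
  -- The monomials with exponents below `k_i` are the generators: dividing exponents by `k_i` with
  -- remainder expresses every monomial exactly, so `ε = 0` below.
  let R := ∀ i, Fin (k i)
  let ex : R → (Fin n →₀ ℕ) := fun β => Finsupp.equivFunOnFinite.symm fun i => (β i : ℕ)
  let w : R → Tate K ρ := fun β => Tate.mono K ρ (ex β)
  let rem : (Fin n →₀ ℕ) → R := fun ν i => ⟨ν i % k i, Nat.mod_lt _ (hk i)⟩
  let quo : (Fin n →₀ ℕ) → (Fin n →₀ ℕ) := fun ν => Finsupp.equivFunOnFinite.symm fun i => ν i / k i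
  let cf : (Fin n →₀ ℕ) → K := fun ν => ∏ i, c i ^ (ν i / k i)
  have hmono : ∀ ν, θ (cf ν • Tate.mono K _ (quo ν)) * w (rem ν) = Tate.mono K ρ ν := by
    intro ν
    have h1 : θ (Tate.mono K _ (quo ν)) = ∏ i, ((c i)⁻¹ • Tate.X K ρ i ^ k i) ^ (ν i / k i) := by
      rw [Tate.mono_eq_prod_univ, map_prod]
      refine Finset.prod_congr rfl fun i _ => ?_
      rw [map_pow]
      congr 1
      exact Tate.eval_X hb i
    rw [map_smul, h1, Tate.mono_eq_prod_univ ν]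
    simp only [w]
    rw [Tate.mono_eq_prod_univ, Algebra.smul_def, map_prod, ← Finset.prod_mul_distrib,
      ← Finset.prod_mul_distrib]
    refine Finset.prod_congr rfl fun i _ => ?_
    rw [smul_pow, Algebra.smul_def, ← mul_assoc (algebraMap _ _ _), ← map_mul, ← mul_pow,
      mul_inv_cancel₀ (hc0 i), one_pow, map_one, one_mul, ← pow_mul, ← pow_add]
    congr 1
    exact Nat.div_add_mod _ _
  -- `‖cf ν‖` differs from `ρ ^ ν` by the weight of the remainder monomial, one of finitely many.
  obtain ⟨C, hC⟩ := (Set.finite_range fun β : R => (wt ρ (ex β))⁻¹).bddAbove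
  have hcf : ∀ ν, ‖cf ν‖ ≤ C * wt ρ ν := by
    intro ν
    have h1 : ‖cf ν‖ * wt ρ (ex (rem ν)) = wt ρ ν := by
      simp only [cf]
      rw [norm_prod, wt_eq_prod, wt_eq_prod, ← Finset.prod_mul_distrib]
      refine Finset.prod_congr rfl fun i _ => ?_
      rw [norm_pow, ← hc, ← pow_mul, ← pow_add]
      congr 1
      exact Nat.div_add_mod _ _
    have h2 : (wt ρ (ex (rem ν)))⁻¹ ≤ C := hC ⟨rem ν, rfl⟩
    calc ‖cf ν‖ = (wt ρ (ex (rem ν)))⁻¹ * wt ρ ν := by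
          rw [← h1]; field_simp [(wt_pos hpos (ex (rem ν))).ne']
      _ ≤ _ := mul_le_mul_of_nonneg_right h2 (wt_nonneg (fun i => (hpos i).le) ν)
  have hC0 : 0 ≤ C := by simpa using (norm_nonneg _).trans (hcf 0)
  refine ⟨θ, RingHom.finite_of_spanning w fun t => ?_⟩
  obtain ⟨x, hx⟩ := Tate.exists_combination
    (fun β : R => ((ContinuousLinearMap.mul K (Tate K ρ)).flip (w β)).comp θL) ⊥
    (by simp) le_rfl one_pos (fun ν β => if β = rem ν then cf ν • Tate.mono K _ (quo ν) else 0)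
    (fun _ => 0) (C := C) (ε := 0) (fun ν β => by
      split_ifs
      · rw [norm_smul, Tate.norm_mono, wt_one, mul_one]; exact hcf ν
      · rw [norm_zero]; exact mul_nonneg hC0 (wt_nonneg (fun i => (hpos i).le) ν))
    (fun ν => by rw [norm_zero]; exact mul_nonneg hC0 (wt_nonneg (fun i => (hpos i).le) ν))
    (fun ν => Submodule.zero_mem _) (fun ν => by
      have : ∑ β, ((ContinuousLinearMap.mul K (Tate K ρ)).flip (w β)).comp θL
          (if β = rem ν then cf ν • Tate.mono K _ (quo ν) else 0) = Tate.mono K ρ ν := by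
        rw [Finset.sum_eq_single (rem ν)]
        · rw [if_pos rfl, ← hmono]; rfl
        · intro β _ hβ
          rw [if_neg hβ, map_zero]
        · simp
      rw [this]
      simp) t
  refine ⟨x, ?_⟩
  rw [Submodule.mem_bot, sub_eq_zero] at hx
  exact hx

/-- A maximal ideal contracts to a maximal ideal along the finite map of `Tate.exists_finite`. -/
theorem Tate.finiteResidueFields {ρ : Fin n → ℝ} (hρ : ∀ i, IsRadius K (ρ i)) :
    FiniteResidueFields K (Tate K ρ) := by
  intro m hm
  obtain ⟨θ, hθ⟩ := Tate.exists_finite hρ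
  refine finite_quotient_of_comap θ m
    ((RingHom.Finite.of_surjective _ Ideal.Quotient.mk_surjective).comp hθ) ?_
  refine UnitTate.finiteResidueFields n _ ?_
  let _ := (θ : UnitTate K n →+* Tate K ρ).toAlgebra
  have : Module.Finite (UnitTate K n) (Tate K ρ) := hθ
  exact Ideal.isMaximal_comap_of_isIntegral_of_isMaximal m

end Nullstellensatz

/-! ### Rescaling of the variables -/

section Rescale

variable {K : Type u} [NontriviallyNormedField K] [IsUltrametricDist K] {n : ℕ}

theorem norm_coeff_rescale_le {ρ σ : Fin n → ℝ} {a : Fin n → K} (h0 : ∀ i, 0 ≤ σ i)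
    (h : ∀ i, ‖a i‖ * σ i ≤ ρ i) (p : MvPowerSeries (Fin n) K) (ν : Fin n →₀ ℕ) :
    ‖coeff ν (rescale a p)‖ * wt σ ν ≤ ‖coeff ν p‖ * wt ρ ν := by
  rw [coeff_rescale, norm_mul, mul_right_comm, mul_comm]
  refine mul_le_mul_of_nonneg_left ?_ (norm_nonneg _)
  rw [Finsupp.prod_fintype _ _ (by simp), norm_prod, wt_eq_prod, wt_eq_prod,
    ← Finset.prod_mul_distrib]
  refine Finset.prod_le_prod (fun i _ => mul_nonneg (norm_nonneg _) (pow_nonneg (h0 i) _))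
    fun i _ => ?_
  rw [norm_pow, ← mul_pow]
  exact pow_le_pow_left₀ (mul_nonneg (norm_nonneg _) (h0 i)) (h i) _

theorem rescale_mem_Tate {ρ σ : Fin n → ℝ} {a : Fin n → K} (h0 : ∀ i, 0 ≤ σ i)
    (h : ∀ i, ‖a i‖ * σ i ≤ ρ i) {p : MvPowerSeries (Fin n) K} (hp : p ∈ Tate K ρ) :
    rescale a p ∈ Tate K σ :=
  squeeze_zero (fun ν => mul_nonneg (norm_nonneg _) (wt_nonneg h0 ν))
    (norm_coeff_rescale_le h0 h p) (mem_Tate.1 hp)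

end Rescale


/-! ### Residue fields of quasi-Washnitzer algebras -/

section QuasiWashnitzerResidue

variable {K : Type u} [NontriviallyNormedField K] [IsUltrametricDist K] {n : ℕ}

theorem tendsto_wt_approxRadius (r : Fin n → NNReal) (ν : Fin n →₀ ℕ) :
    Tendsto (fun k => wt (approxRadius r k) ν) atTop (𝓝 (wt (fun i => (r i : ℝ)) ν)) := by
  simp only [wt_eq_prod]
  refine tendsto_finsetProd _ fun i _ => Tendsto.pow ?_ _
  have h := (tendsto_one_div_add_atTop_nhds_zero_nat (𝕜 := ℝ)).const_add (r i : ℝ)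
  rw [add_zero] at h
  exact h

/-- All but finitely many terms are below `1` already at some `ρ > r`; each of the others drops
below `1` as the radius decreases to `r`. -/
theorem exists_norm_lt_one {r : Fin n → NNReal} {p : MvPowerSeries (Fin n) K}
    (hp : p ∈ QuasiWashnitzer K r) (h : ∀ ν, ‖coeff ν p‖ * wt (fun i => (r i : ℝ)) ν < 1) :
    ∃ k, ∃ hk : p ∈ Tate K (approxRadius r k), ‖(⟨p, hk⟩ : Tate K (approxRadius r k))‖ < 1 := by
  obtain ⟨ρ, hρ, hpρ⟩ := hp
  have hρ0 : ∀ i, 0 < ρ i := fun i => (r i).2.trans_lt (hρ i)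
  have hfin := Tate.finite_lt hpρ one_pos
  have h1 : ∀ᶠ k in atTop, ∀ ν ∈ {ν | 1 ≤ ‖coeff ν p‖ * wt ρ ν},
      ‖coeff ν p‖ * wt (approxRadius r k) ν < 1 := by
    rw [eventually_all_finite hfin]
    intro ν _
    exact ((tendsto_wt_approxRadius r ν).const_mul _).eventually_lt_const (h ν)
  obtain ⟨k, hk1, hk2⟩ := (h1.and (eventually_approxRadius_le hρ)).exists
  have hk0 : ∀ i, 0 < approxRadius r k i := Fact.out
  refine ⟨k, Tate_anti K (fun i => (hk0 i).le) hk2 hpρ, Tate.norm_lt_of_forall one_pos fun ν => ?_⟩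
  by_cases hν : 1 ≤ ‖coeff ν p‖ * wt ρ ν
  · exact hk1 ν hν
  · exact (mul_le_mul_of_nonneg_left (wt_mono (fun i => (hk0 i).le) hk2 ν)
      (norm_nonneg _)).trans_lt (not_le.1 hν)

/-- Rescaling of the variables on an algebra of power series. -/
noncomputable def rescaleAlgHomK (a : Fin n → K) (S : Subalgebra K (MvPowerSeries (Fin n) K)) :
    S →ₐ[K] MvPowerSeries (Fin n) K where
  toFun p := rescale a p.1
  map_one' := map_one _
  map_mul' p q := map_mul (rescale a) p.1 q.1
  map_zero' := map_zero _
  map_add' p q := map_add (rescale a) p.1 q.1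
  commutes' c := by
    ext ν
    change coeff ν (rescale a (C c)) = coeff ν (C c)
    classical
    rw [coeff_rescale, coeff_C]
    split_ifs with h <;> simp [h]

/-- Rescaling of the variables, as a homomorphism to a Tate algebra. -/
noncomputable def QuasiWashnitzer.rescaleHom {r : Fin n → NNReal} {σ : Fin n → ℝ} {a : Fin n → K}
    (h0 : ∀ i, 0 ≤ σ i) (h : ∀ i, ‖a i‖ * σ i ≤ r i) : QuasiWashnitzer K r →ₐ[K] Tate K σ :=
  (rescaleAlgHomK a (QuasiWashnitzer K r)).codRestrict _ (by
    rintro ⟨p, ρ, hρ, hp⟩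
    exact rescale_mem_Tate h0 (fun i => (h i).trans (hρ i).le) hp)

/-- Rescaling of the variables of a Tate algebra. -/
noncomputable def Tate.rescaleHom {ρ σ : Fin n → ℝ} {a : Fin n → K}
    (h0 : ∀ i, 0 ≤ σ i) (h : ∀ i, ‖a i‖ * σ i ≤ ρ i) : Tate K ρ →ₐ[K] Tate K σ :=
  (rescaleAlgHomK a (Tate K ρ)).codRestrict _ (fun p => rescale_mem_Tate h0 h p.2)

theorem QuasiWashnitzer.mono_mem (r : Fin n → NNReal) (σ : Fin n → ℝ) (ν : Fin n →₀ ℕ) :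
    (Tate.mono K σ ν).1 ∈ QuasiWashnitzer K r :=
  ⟨fun i => r i + 1, fun _ => lt_add_one _, (Tate.mono K (fun i => r i + 1) ν).2⟩

variable [CompleteSpace K]

/-- Set the variables of radius `0` to zero and restrict to the closed polydisc of the remaining
radii. If `m` generated the unit ideal there, density would give `h ∈ m` whose image is within
distance less than `1` of `1`. By overconvergence `1 - h` then has norm less than `1` at some larger
radius, so `h` would be a unit. Hence `m` is the contraction of a maximal ideal of a Tate algebra
with radii in `√|K^×|`. -/
theorem QuasiWashnitzer.finiteResidueFields {r : Fin n → NNReal}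
    (hr : ∀ i, r i = 0 ∨ IsRadius K (r i)) : FiniteResidueFields K (QuasiWashnitzer K r) := by
  classical
  intro m hm
  -- Rescaling by `a i = 0` kills the variables with `r i = 0`. The radius `1` assigned to them in
  -- `σ` is an arbitrary admissible value, and `‖a i‖ * σ i = r i` in all cases.
  let a : Fin n → K := fun i => if r i = 0 then 0 else 1
  let σ : Fin n → ℝ := fun i => if r i = 0 then 1 else r i
  have hσ : ∀ i, IsRadius K (σ i) := fun i => by
    by_cases h : r i = 0
    · simp only [σ, if_pos h]
      exact ⟨one_pos, 1, one_pos, 1, by simp⟩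
    · simp only [σ, if_neg h]
      exact (hr i).resolve_left h
  have : Fact (∀ i, 0 < σ i) := ⟨fun i => (hσ i).1⟩
  have hσ0 : ∀ i, 0 ≤ σ i := fun i => (hσ i).1.le
  have haσ : ∀ i, ‖a i‖ * σ i = r i := fun i => by
    by_cases h : r i = 0 <;> simp [a, σ, h]
  have haσ' : ∀ i, ‖a i‖ * σ i ≤ σ i := fun i => by
    by_cases h : r i = 0 <;> simp [a, σ, h]
  have haa : a * a = a := by
    ext i
    by_cases h : r i = 0 <;> simp [a, h]
  let εW : QuasiWashnitzer K r →ₐ[K] Tate K σ :=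
    QuasiWashnitzer.rescaleHom hσ0 fun i => (haσ i).le
  let εT : Tate K σ →ₐ[K] Tate K σ := Tate.rescaleHom hσ0 haσ'
  have hεT : ∀ t, ‖εT t‖ ≤ ‖t‖ := fun t => Tate.norm_le fun ν =>
    (norm_coeff_rescale_le hσ0 haσ' t.1 ν).trans (Tate.coeff_le t ν)
  have hεε : ∀ h, εT (εW h) = εW h := fun h => Subtype.ext (by
    change rescale a (rescale a h.1) = rescale a h.1
    rw [rescale_rescale, haa])
  -- Truncations of `t` are polynomials, so they lie in the quasi-Washnitzer algebra.
  have hdense : ∀ t, ∀ η > 0, ∃ G, ‖εT t - εW G‖ < η := by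
    intro t η hη
    obtain ⟨s, hs⟩ := ((Tate.hasSum_mono t).eventually (Metric.ball_mem_nhds t hη)).exists
    have hmono := QuasiWashnitzer.mono_mem (K := K) r σ
    refine ⟨∑ ν ∈ s, coeff ν t.1 • ⟨_, hmono ν⟩, ?_⟩
    have h1 : εW (∑ ν ∈ s, coeff ν t.1 • ⟨_, hmono ν⟩) =
        εT (∑ ν ∈ s, coeff ν t.1 • Tate.mono K σ ν) := by
      rw [map_sum, map_sum]
      refine Finset.sum_congr rfl fun ν _ => ?_
      rw [map_smul, map_smul]
      rfl
    rw [h1, ← map_sub]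
    refine (hεT _).trans_lt ?_
    rw [← dist_eq_norm, dist_comm]
    exact hs
  have hJ : m.map εW ≠ ⊤ := by
    intro htop
    -- Elements of the extended ideal are approximated by images of elements of `m` itself:
    -- coefficients from the Tate algebra are replaced by nearby polynomials.
    have key : ∀ x ∈ m.map εW, ∀ δ > 0, ∃ h ∈ m, ‖εT x - εW h‖ < δ := by
      intro x hx
      refine Submodule.span_induction (p := fun x _ => ∀ δ > 0, ∃ h ∈ m, ‖εT x - εW h‖ < δ)
        ?_ ?_ ?_ ?_ hx
      · rintro _ ⟨h, hh, rfl⟩ δ hδ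
        refine ⟨h, hh, ?_⟩
        rw [hεε, sub_self, norm_zero]
        exact hδ
      · intro δ hδ
        exact ⟨0, m.zero_mem, by simpa using hδ⟩
      · intro x y _ _ ihx ihy δ hδ
        obtain ⟨h, hh, hhx⟩ := ihx δ hδ
        obtain ⟨h', hh', hhy⟩ := ihy δ hδ
        refine ⟨h + h', m.add_mem hh hh', ?_⟩
        rw [map_add, map_add, add_sub_add_comm]
        exact (IsUltrametricDist.norm_add_le_max _ _).trans_lt (max_lt hhx hhy)
      · intro g x _ ih δ hδ
        obtain ⟨h, hh, hhx⟩ := ih (δ / (‖εT g‖ + 1)) (by positivity)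
        obtain ⟨G, hG⟩ := hdense g (δ / (‖εW h‖ + 1)) (by positivity)
        refine ⟨G * h, m.mul_mem_left _ hh, ?_⟩
        have e : εT (g • x) - εW (G * h) = εT g * (εT x - εW h) + (εT g - εW G) * εW h := by
          rw [smul_eq_mul, map_mul, map_mul]; ring
        rw [e]
        rw [lt_div_iff₀ (by positivity)] at hhx hG
        refine (IsUltrametricDist.norm_add_le_max _ _).trans_lt (max_lt ?_ ?_)
        · refine ((norm_mul_le _ _).trans ?_).trans_lt hhx
          rw [mul_comm]
          exact mul_le_mul_of_nonneg_left (by linarith) (norm_nonneg _)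
        · refine ((norm_mul_le _ _).trans ?_).trans_lt hG
          exact mul_le_mul_of_nonneg_left (by linarith) (norm_nonneg _)
    obtain ⟨h, hh, hlt⟩ := key 1 (htop ▸ Submodule.mem_top) 1 one_pos
    -- Terms of `εW (1 - h)` for `σ` have the same size as those of `1 - h` for `r`, terms in the
    -- killed variables having weight zero.
    have hlt' : ∀ ν, ‖coeff ν (1 - h).1‖ * wt (fun i => (r i : ℝ)) ν < 1 := by
      intro ν
      have h1 : εT 1 - εW h = εW (1 - h) := by rw [map_sub, map_one, map_one]
      rw [h1] at hlt
      refine lt_of_eq_of_lt ?_ ((Tate.coeff_le _ ν).trans_lt hlt)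
      change _ = ‖coeff ν (rescale a (1 - h).1)‖ * _
      rw [coeff_rescale, norm_mul, mul_right_comm, mul_comm]
      congr 1
      rw [Finsupp.prod_fintype _ _ (by simp), norm_prod, wt_eq_prod, wt_eq_prod,
        ← Finset.prod_mul_distrib]
      refine Finset.prod_congr rfl fun i _ => ?_
      rw [norm_pow, ← mul_pow, haσ]
    obtain ⟨k, hk, hk1⟩ := exists_norm_lt_one (1 - h).2 hlt'
    have hu := (Units.oneSub _ hk1).isUnit
    rw [Units.val_oneSub] at hu
    have hu' := hu.map (Subalgebra.inclusion (Tate_le_quasiWashnitzer K (lt_approxRadius r k)))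
    refine hm.ne_top (m.eq_top_of_isUnit_mem hh ?_)
    convert hu'
    refine Subtype.ext ?_
    change h.1 = 1 - (1 - h.1)
    rw [sub_sub_cancel]
  obtain ⟨M, hM, hle⟩ := Ideal.exists_le_maximal _ hJ
  have hfin := Tate.finiteResidueFields hσ M hM
  have hcomap : m = M.comap εW := hm.eq_of_le (fun h => hM.ne_top (by
      rw [Ideal.eq_top_iff_one] at h ⊢
      simpa using h)) (Ideal.map_le_iff_le_comap.1 hle)
  refine Module.Finite.of_injective (Ideal.quotientMapₐ M εW hcomap.le).toLinearMap ?_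
  exact Ideal.quotientMap_injective' (H := hcomap.le) hcomap.ge

theorem Tate.residuallyFinite_of_surjective {ρ : Fin n → ℝ} (hρ : ∀ i, IsRadius K (ρ i)) {B : Type*}
    [CommRing B] [Algebra K B] {π : Tate K ρ →ₐ[K] B} (hπ : Function.Surjective π) :
    ResiduallyFinite K B := by
  have : Fact (∀ i, 0 < ρ i) := ⟨fun i => (hρ i).1⟩
  have := Tate.isNoetherianRing (K := K) (ρ := ρ)
  have : IsNoetherianRing B := isNoetherianRing_of_surjective _ _ (π : Tate K ρ →+* B) hπ
  exact ResiduallyFinite.of_finiteResidueFields ((Tate.finiteResidueFields hρ).of_surjective hπ)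

theorem QuasiWashnitzer.residuallyFinite_of_surjective {r : Fin n → NNReal}
    (hr : ∀ i, r i = 0 ∨ IsRadius K (r i)) {B : Type*}
    [CommRing B] [Algebra K B] {π : QuasiWashnitzer K r →ₐ[K] B} (hπ : Function.Surjective π) :
    ResiduallyFinite K B := by
  have := QuasiWashnitzer.isNoetherianRing (K := K) r
  have : IsNoetherianRing B := isNoetherianRing_of_surjective _ _ (π : QuasiWashnitzer K r →+* B) hπ
  exact ResiduallyFinite.of_finiteResidueFields
    ((QuasiWashnitzer.finiteResidueFields hr).of_surjective hπ)

theorem IsAffinoid.residuallyFinite {C : CommAlgCat.{u} K} (h : IsAffinoid K C) :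
    ResiduallyFinite K C := by
  obtain ⟨n, ρ, hρ, π, hπ⟩ := h
  exact Tate.residuallyFinite_of_surjective hρ hπ

theorem IsQuasiDagger.residuallyFinite {A : CommAlgCat.{u} K} (h : IsQuasiDagger K A) :
    ResiduallyFinite K A := by
  obtain ⟨n, r, hr, π, hπ⟩ := h
  exact QuasiWashnitzer.residuallyFinite_of_surjective hr hπ

end QuasiWashnitzerResidue


/-! ### Homomorphisms out of affinoid algebras -/

section Uniqueness

variable {K : Type u} [NontriviallyNormedField K] [IsUltrametricDist K] [CompleteSpace K]

/-- The kernel contains the ideal `g⁻¹ I`, which is closed and of finite codimension. A functional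
vanishing on such a subspace is continuous, whatever `g` is. -/
theorem Tate.continuous_of_vanishing {n : ℕ} {ρ : Fin n → ℝ} [Fact (∀ i, 0 < ρ i)] {B : Type*}
    [CommRing B] [Algebra K B] {I : Ideal B} (hI : Module.Finite K (B ⧸ I)) (l : B ⧸ I →ₗ[K] K)
    (g : Tate K ρ →ₐ[K] B) : Continuous fun t => l (Ideal.Quotient.mk I (g t)) := by
  let L : Tate K ρ →ₗ[K] K := l ∘ₗ (Ideal.Quotient.mkₐ K I).toLinearMap ∘ₗ g.toLinearMap
  change Continuous L
  let N : Submodule K (Tate K ρ) := (I.comap g).restrictScalars K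
  have hN : IsClosed (N : Set (Tate K ρ)) := Tate.isClosed_ideal (I.comap g)
  have hfin : FiniteDimensional K (Tate K ρ ⧸ N) := by
    have : FiniteDimensional K (B ⧸ I) := hI
    let F := (Ideal.Quotient.mkₐ K I).toLinearMap ∘ₗ g.toLinearMap
    have hF : LinearMap.ker F = N := by
      ext t
      exact Ideal.Quotient.eq_zero_iff_mem
    rw [← hF]
    exact (LinearMap.quotKerEquivRange F).symm.finiteDimensional
  refine L.continuous_iff_isClosed_ker.2 ?_
  refine Submodule.isClosed_mono_of_finiteDimensional_quotient hN (fun t ht => ?_)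
  have : Ideal.Quotient.mk I (g t) = 0 := Ideal.Quotient.eq_zero_iff_mem.2 ht
  change l (Ideal.Quotient.mk I (g t)) = 0
  rw [this, map_zero]

/-- These functionals stand in for a Hausdorff topology on `B`: they separate points and are
continuous along every homomorphism from a Tate algebra. -/
theorem ResiduallyFinite.exists_functional {B : Type*} [CommRing B] [Algebra K B]
    (h : ResiduallyFinite K B) {b : B} (hb : b ≠ 0) : ∃ l : B →ₗ[K] K, l b ≠ 0 ∧
      ∀ {n : ℕ} {ρ : Fin n → ℝ} [Fact (∀ i, 0 < ρ i)] (g : Tate K ρ →ₐ[K] B),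
        Continuous fun t => l (g t) := by
  obtain ⟨I, hbI, hI⟩ := h b hb
  have h1 : Ideal.Quotient.mk I b ≠ 0 := fun h0 => hbI (Ideal.Quotient.eq_zero_iff_mem.1 h0)
  obtain ⟨l, hl⟩ : ∃ l : B ⧸ I →ₗ[K] K, l (Ideal.Quotient.mk I b) ≠ 0 := by
    by_contra! hcon
    exact h1 ((Module.forall_dual_apply_eq_zero_iff K _).1 hcon)
  exact ⟨l ∘ₗ (Ideal.Quotient.mkₐ K I).toLinearMap, hl, fun g =>
    Tate.continuous_of_vanishing hI l g⟩

variable {n : ℕ} {ρ : Fin n → ℝ} [Fact (∀ i, 0 < ρ i)]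

theorem Tate.map_mono {B : Type*} [CommRing B] [Algebra K B] (f : Tate K ρ →ₐ[K] B)
    (ν : Fin n →₀ ℕ) : f (Tate.mono K ρ ν) = ∏ i, f (Tate.X K ρ i) ^ ν i := by
  rw [Tate.mono_eq_prod_univ, map_prod]
  exact Finset.prod_congr rfl fun i _ => map_pow _ _ _

/-- Homomorphisms from a Tate algebra to a residually finite algebra are determined by the images of
the variables. -/
theorem Tate.algHom_ext {B : Type*} [CommRing B] [Algebra K B] (hB : ResiduallyFinite K B)
    {f g : Tate K ρ →ₐ[K] B} (h : ∀ i, f (Tate.X K ρ i) = g (Tate.X K ρ i)) : f = g := by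
  ext t
  by_contra hne
  obtain ⟨l, hl, hc⟩ := hB.exists_functional (sub_ne_zero.2 hne)
  let S : Submodule K (Tate K ρ) := LinearMap.eqLocus (l ∘ₗ f.toLinearMap) (l ∘ₗ g.toLinearMap)
  have hS : IsClosed (S : Set (Tate K ρ)) := isClosed_eq (hc f) (hc g)
  have htop := Tate.eq_top_of_isClosed hS fun ν => by
    change l (f _) = l (g _)
    rw [Tate.map_mono, Tate.map_mono]
    simp only [h]
  have ht : l (f t) = l (g t) := (Submodule.eq_top_iff'.1 htop t : t ∈ S)
  rw [map_sub, ht, sub_self] at hl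
  exact hl rfl

theorem algHom_ext_of_surjective {B C : Type*} [CommRing B] [Algebra K B] [CommRing C]
    [Algebra K C] (hB : ResiduallyFinite K B) {π : Tate K ρ →ₐ[K] C} (hπ : Function.Surjective π)
    {f g : C →ₐ[K] B} (h : ∀ i, f (π (Tate.X K ρ i)) = g (π (Tate.X K ρ i))) : f = g := by
  have h1 : f.comp π = g.comp π := Tate.algHom_ext hB h
  ext c
  obtain ⟨t, rfl⟩ := hπ c
  exact DFunLike.congr_fun h1 t

end Uniqueness

/-! ### A Baire category argument -/

section Baire

variable {K : Type u} [NontriviallyNormedField K]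

/-- If the projections to `E` of countably many closed subspaces `V k` of Banach spaces `E × F k`
cover `E`, then one of the projections is surjective. -/
theorem exists_surjective_of_iUnion {E : Type*} [NormedAddCommGroup E] [NormedSpace K E]
    [CompleteSpace E] {F : ℕ → Type*} [∀ k, NormedAddCommGroup (F k)]
    [∀ k, NormedSpace K (F k)] [∀ k, CompleteSpace (F k)]
    (V : ∀ k, Submodule K (E × F k)) (hV : ∀ k, IsClosed (V k : Set (E × F k)))
    (h : ∀ x : E, ∃ k, ∃ y : F k, (x, y) ∈ V k) : ∃ k, ∀ x : E, ∃ y : F k, (x, y) ∈ V k := by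
  -- Bounding the second coordinate by an integer keeps the cover countable; some closure then has
  -- an interior point `x₀`.
  let U : ℕ × ℕ → Set E := fun p => closure {x | ∃ y : F p.1, (x, y) ∈ V p.1 ∧ ‖y‖ ≤ p.2}
  have hU : ⋃ p, U p = Set.univ := by
    refine Set.eq_univ_of_forall fun x => ?_
    obtain ⟨k, y, hy⟩ := h x
    obtain ⟨N, hN⟩ := exists_nat_ge ‖y‖
    exact Set.mem_iUnion.2 ⟨(k, N), subset_closure ⟨y, hy, hN⟩⟩
  obtain ⟨⟨k, N⟩, x₀, hx₀⟩ := nonempty_interior_of_iUnion_of_closed (fun p => isClosed_closure) hU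
  obtain ⟨δ, hδ, hball⟩ := Metric.mem_nhds_iff.1 (mem_interior_iff_mem_nhds.1 hx₀)
  refine ⟨k, ?_⟩
  -- Write `x = (x₀ + x) - x₀` and approximate both points inside `U (k, N)`; hence the bound `2 *
  -- N`.
  have happ : ∀ x : E, ‖x‖ < δ → ∀ η > 0, ∃ v ∈ V k, ‖v.2‖ ≤ 2 * N ∧ ‖x - v.1‖ < η := by
    intro x hx η hη
    have h1 : x₀ + x ∈ U (k, N) := hball (by simpa using hx)
    have h0 : x₀ ∈ U (k, N) := hball (Metric.mem_ball_self hδ)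
    obtain ⟨x1, ⟨y1, hy1, hn1⟩, hd1⟩ := Metric.mem_closure_iff.1 h1 (η / 2) (half_pos hη)
    obtain ⟨x2, ⟨y2, hy2, hn2⟩, hd2⟩ := Metric.mem_closure_iff.1 h0 (η / 2) (half_pos hη)
    refine ⟨(x1, y1) - (x2, y2), (V k).sub_mem hy1 hy2, ?_, ?_⟩
    · change ‖y1 - y2‖ ≤ _
      refine (norm_sub_le _ _).trans ?_
      change ‖y1‖ ≤ N at hn1
      change ‖y2‖ ≤ N at hn2
      linarith
    · change ‖x - (x1 - x2)‖ < η
      have e : x - (x1 - x2) = (x₀ + x - x1) - (x₀ - x2) := by abel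
      rw [e]
      rw [dist_eq_norm] at hd1 hd2
      exact (norm_sub_le _ _).trans_lt (by linarith)
  obtain ⟨c, hc⟩ := NormedField.exists_one_lt_norm K
  have hc0 : 0 < ‖c‖ := one_pos.trans hc
  have : CompleteSpace (V k) := (hV k).completeSpace_coe
  -- Scale `x` by `d` into the ball of radius `δ`, where `happ` applies. In the constant, `2` bounds
  -- the first coordinate, of norm at most `3/2 ‖x‖`, and the other entry bounds the second, since
  -- `‖d‖⁻¹ ≤ δ⁻¹ ‖c‖ ‖x‖`.
  have hsurj := exists_preimage_of_approx (K := K) (V := V k) (W := E)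
    ((ContinuousLinearMap.fst K E (F k)).comp (V k).subtypeL)
    (C := max 2 ((2 * N) * (δ⁻¹ * ‖c‖))) (ε := 1 / 2) (by norm_num) (by norm_num) (fun x => by
      by_cases hx : x = 0
      · exact ⟨0, by simp [hx], by simp [hx]⟩
      have hx0 : 0 < ‖x‖ := norm_pos_iff.2 hx
      obtain ⟨d, hd0, hd1, -, hd⟩ := rescale_to_shell hc hδ hx
      have hd0' : 0 < ‖d‖ := norm_pos_iff.2 hd0
      obtain ⟨v, hv, hv2, hv1⟩ := happ (d • x) hd1 (‖d‖ * (1 / 2 * ‖x‖)) (by positivity)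
      have e1 : ‖x - d⁻¹ • v.1‖ ≤ 1 / 2 * ‖x‖ := by
        have : x - d⁻¹ • v.1 = d⁻¹ • (d • x - v.1) := by rw [smul_sub, inv_smul_smul₀ hd0]
        rw [this, norm_smul, norm_inv, inv_mul_le_iff₀ hd0']
        exact hv1.le
      refine ⟨⟨d⁻¹ • v, (V k).smul_mem _ hv⟩, ?_, e1⟩
      change max ‖d⁻¹ • v.1‖ ‖d⁻¹ • v.2‖ ≤ _
      refine max_le ?_ ?_
      · have : ‖d⁻¹ • v.1‖ ≤ ‖x‖ + ‖x - d⁻¹ • v.1‖ := by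
          have := norm_sub_le x (x - d⁻¹ • v.1)
          rwa [sub_sub_cancel] at this
        refine this.trans (le_trans ?_ (mul_le_mul_of_nonneg_right (le_max_left _ _) hx0.le))
        linarith
      · rw [norm_smul, norm_inv]
        refine le_trans ?_ (mul_le_mul_of_nonneg_right (le_max_right _ _) hx0.le)
        calc ‖d‖⁻¹ * ‖v.2‖ ≤ (δ⁻¹ * ‖c‖ * ‖x‖) * (2 * N) :=
              mul_le_mul hd hv2 (norm_nonneg _) (by positivity)
          _ = _ := by ring)
  intro x
  obtain ⟨v, hv, -⟩ := hsurj x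
  refine ⟨v.1.2, ?_⟩
  rw [← hv]
  exact v.2

end Baire

/-! ### Radii -/

section Radii

variable {K : Type u} [NontriviallyNormedField K]

/-- The rational powers of some `‖c‖ > 1` lie in `√|K^×|` and are dense in the positive reals. -/
theorem exists_isRadius_between {a b : ℝ} (ha : 0 ≤ a) (hab : a < b) :
    ∃ ρ, IsRadius K ρ ∧ a < ρ ∧ ρ < b := by
  wlog ha0 : 0 < a generalizing a
  · obtain ⟨ρ, h1, h2, h3⟩ := this (a := b / 2) (by linarith) (by linarith) (by linarith)
    exact ⟨ρ, h1, by linarith, h3⟩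
  obtain ⟨c, hc⟩ := NormedField.exists_one_lt_norm K
  have hc0 : 0 < ‖c‖ := one_pos.trans hc
  have hlog : 0 < Real.log ‖c‖ := Real.log_pos hc
  obtain ⟨q, hq1, hq2⟩ := exists_rat_btwn (div_lt_div_of_pos_right (Real.log_lt_log ha0 hab) hlog)
  rw [div_lt_iff₀ hlog] at hq1
  rw [lt_div_iff₀ hlog] at hq2
  have hpos : 0 < ‖c‖ ^ (q : ℝ) := Real.rpow_pos_of_pos hc0 _
  refine ⟨‖c‖ ^ (q : ℝ), ⟨hpos, q.den, q.den_pos, c ^ q.num, ?_⟩, ?_, ?_⟩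
  · rw [← Real.rpow_natCast, ← Real.rpow_mul hc0.le, norm_zpow, ← Real.rpow_intCast]
    congr 1
    exact_mod_cast Rat.mul_den_eq_num q
  · rw [← Real.log_lt_log_iff ha0 hpos, Real.log_rpow hc0]
    exact hq1
  · rw [← Real.log_lt_log_iff hpos (ha0.trans hab), Real.log_rpow hc0]
    exact hq2

theorem IsRadius.min {a b : ℝ} (ha : IsRadius K a) (hb : IsRadius K b) : IsRadius K (min a b) := by
  rcases min_choice a b with h | h <;> rw [h] <;> assumption

end Radii


/-! ### Finite presentations of quasi-dagger algebras -/

namespace FinPresentation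

variable {K : Type u} [NontriviallyNormedField K] [IsUltrametricDist K]

/-- The kernel is finitely generated by Noetherianity, and finitely many overconvergent series share
a polyradius of convergence. -/
theorem nonempty_of_isQuasiDagger [CompleteSpace K] {A : CommAlgCat.{u} K}
    (hA : IsQuasiDagger K A) : Nonempty (FinPresentation A) := by
  obtain ⟨n, r, hr, π, hπ⟩ := hA
  obtain ⟨s, hs⟩ := (isNoetherianRing_iff_ideal_fg _).1
    (QuasiWashnitzer.isNoetherianRing (K := K) r) (RingHom.ker π)
  let f : Fin s.card → MvPowerSeries (Fin n) K := fun j => (s.equivFin.symm j).1.1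
  obtain ⟨k, hk⟩ := (eventually_all.2 fun j : Fin s.card =>
    eventually_mem_Tate (s.equivFin.symm j).1.2).exists
  refine ⟨n, r, hr, π, hπ, s.card, f, approxRadius r k, lt_approxRadius r k, hk, ?_⟩
  rw [← hs, spanIn]
  congr 1
  ext t
  constructor
  · intro ht
    exact ⟨s.equivFin ⟨t, ht⟩, by simp [f]⟩
  · rintro ⟨j, hj⟩
    have : t = (s.equivFin.symm j).1 := Subtype.ext hj
    rw [this]
    exact (s.equivFin.symm j).2

variable {A : CommAlgCat.{u} K} (P : FinPresentation A)

theorem exists_index {ρ : Fin P.n → ℝ} (h : ∀ k, P.r k < ρ k) :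
    ∃ i : P.Index, ∀ k, P.rad i k ≤ ρ k := by
  choose x hx h1 h2 using fun k => exists_isRadius_between (K := K) (P.r k).2
    (lt_min (h k) (P.lt k))
  exact ⟨OrderDual.toDual ⟨x, fun k => ⟨hx k, h1 k, (h2 k).le.trans (min_le_right _ _)⟩⟩,
    fun k => (h2 k).le.trans (min_le_left _ _)⟩

instance : Nonempty P.Index := let ⟨i, _⟩ := P.exists_index P.lt; ⟨i⟩

instance : IsDirectedOrder P.Index where
  directed i j := ⟨OrderDual.toDual ⟨fun k => min (P.rad i k) (P.rad j k), fun k =>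
      ⟨(P.rad_spec i k).1.min (P.rad_spec j k).1,
        lt_min (P.rad_spec i k).2.1 (P.rad_spec j k).2.1,
        (min_le_left _ _).trans (P.rad_spec i k).2.2⟩⟩,
    fun _ => min_le_left _ _, fun _ => min_le_right _ _⟩

theorem exists_mem_Tate_rad {p : MvPowerSeries (Fin P.n) K} (hp : p ∈ QuasiWashnitzer K P.r) :
    ∃ i : P.Index, p ∈ Tate K (P.rad i) := by
  obtain ⟨ρ, hρ, hp⟩ := hp
  obtain ⟨i, hi⟩ := P.exists_index hρ
  exact ⟨i, Tate_anti K (fun k => (P.rad_spec i k).1.1.le) hi hp⟩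

theorem Tate_rad_le (i : P.Index) : Tate K (P.rad i) ≤ QuasiWashnitzer K P.r :=
  Tate_le_quasiWashnitzer K fun k => (P.rad_spec i k).2.1

/-- The map `T(ρ') → A`. -/
noncomputable def ofTate (i : P.Index) : Tate K (P.rad i) →ₐ[K] A :=
  P.π.comp (Subalgebra.inclusion (P.Tate_rad_le i))

theorem toAlg_mk (i : P.Index) (t : Tate K (P.rad i)) :
    P.toAlg i (Ideal.Quotient.mk _ t) = P.ofTate i t := rfl

theorem transition_mk {i j : P.Index} (h : i ≤ j) (t : Tate K (P.rad i)) :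
    P.transition h (Ideal.Quotient.mk _ t) =
      Ideal.Quotient.mk _ (Subalgebra.inclusion (P.Tate_mono h) t) := rfl

theorem ofTate_inclusion {i j : P.Index} (h : i ≤ j) (t : Tate K (P.rad i)) :
    P.ofTate j (Subalgebra.inclusion (P.Tate_mono h) t) = P.ofTate i t := by
  rw [ofTate, ofTate, AlgHom.comp_apply, AlgHom.comp_apply, Subalgebra.inclusion_inclusion]

theorem toAlg_transition {i j : P.Index} (h : i ≤ j) (x : P.Level i) :
    P.toAlg j (P.transition h x) = P.toAlg i x := by
  obtain ⟨t, rfl⟩ := Ideal.Quotient.mk_surjective x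
  rw [transition_mk, toAlg_mk, toAlg_mk, P.ofTate_inclusion h]

theorem transition_transition {i j k : P.Index} (h : i ≤ j) (h' : j ≤ k) (x : P.Level i) :
    P.transition h' (P.transition h x) = P.transition (h.trans h') x := by
  obtain ⟨t, rfl⟩ := Ideal.Quotient.mk_surjective x
  rw [transition_mk, transition_mk, transition_mk, Subalgebra.inclusion_inclusion]

theorem exists_toAlg_eq (a : A) : ∃ (i : P.Index) (x : P.Level i), P.toAlg i x = a := by
  obtain ⟨t, rfl⟩ := P.surjective a
  obtain ⟨i, hi⟩ := P.exists_mem_Tate_rad t.2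
  exact ⟨i, Ideal.Quotient.mk _ ⟨t.1, hi⟩, rfl⟩

/-- A combination of the relations has finitely many coefficients, so it already exists over one
Tate algebra of the system. -/
theorem exists_mem_spanIn {t : QuasiWashnitzer K P.r}
    (ht : t ∈ spanIn (QuasiWashnitzer K P.r) P.f) :
    ∃ (i : P.Index) (y : Tate K (P.rad i)), y ∈ spanIn (Tate K (P.rad i)) P.f ∧ y.1 = t.1 := by
  have up : ∀ {i j : P.Index} (h : i ≤ j) (y : Tate K (P.rad i)),
      y ∈ spanIn (Tate K (P.rad i)) P.f →
      Subalgebra.inclusion (P.Tate_mono h) y ∈ spanIn (Tate K (P.rad j)) P.f := fun h y hy =>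
    Ideal.mem_comap.1 (spanIn_le_comap (P.Tate_mono h) P.f hy)
  refine Submodule.span_induction (p := fun t _ => ∃ (i : P.Index) (y : Tate K (P.rad i)),
    y ∈ spanIn (Tate K (P.rad i)) P.f ∧ y.1 = t.1) ?_ ?_ ?_ ?_ ht
  · rintro t ⟨j, hj⟩
    obtain ⟨i, hi⟩ := P.exists_mem_Tate_rad t.2
    exact ⟨i, ⟨t.1, hi⟩, Ideal.subset_span ⟨j, hj⟩, rfl⟩
  · obtain ⟨i⟩ := (inferInstance : Nonempty P.Index)
    exact ⟨i, 0, Ideal.zero_mem _, by rw [Subalgebra.coe_zero, Subalgebra.coe_zero]⟩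
  · rintro x y - - ⟨i, x', hx, hxe⟩ ⟨j, y', hy, hye⟩
    obtain ⟨k, hik, hjk⟩ := exists_ge_ge i j
    refine ⟨k, _, Ideal.add_mem _ (up hik x' hx) (up hjk y' hy), ?_⟩
    rw [Subalgebra.coe_add, Subalgebra.coe_add, Subalgebra.coe_inclusion, Subalgebra.coe_inclusion,
      hxe, hye]
  · rintro a x - ⟨i, x', hx, hxe⟩
    obtain ⟨j, hj⟩ := P.exists_mem_Tate_rad a.2
    obtain ⟨k, hik, hjk⟩ := exists_ge_ge i j
    refine ⟨k, _, Ideal.mul_mem_left _ ⟨a.1, P.Tate_mono hjk hj⟩ (up hik x' hx), ?_⟩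
    rw [smul_eq_mul, Subalgebra.coe_mul, Subalgebra.coe_mul, Subalgebra.coe_inclusion, hxe]

theorem exists_transition_eq_zero {i : P.Index} {x : P.Level i} (hx : P.toAlg i x = 0) :
    ∃ (j : P.Index) (h : i ≤ j), P.transition h x = 0 := by
  obtain ⟨t, rfl⟩ := Ideal.Quotient.mk_surjective x
  have ht : Subalgebra.inclusion (P.Tate_rad_le i) t ∈ spanIn (QuasiWashnitzer K P.r) P.f := by
    rw [toAlg_mk, ofTate, AlgHom.comp_apply] at hx
    rw [← P.ker_eq]
    exact RingHom.mem_ker.2 hx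
  obtain ⟨k, y, hk, hkt⟩ := P.exists_mem_spanIn ht
  obtain ⟨j, hij, hkj⟩ := exists_ge_ge i k
  refine ⟨j, hij, ?_⟩
  rw [transition_mk, Ideal.Quotient.eq_zero_iff_mem]
  have h := spanIn_le_comap (P.Tate_mono hkj) P.f hk
  rw [Ideal.mem_comap] at h
  have e : Subalgebra.inclusion (P.Tate_mono hij) t = Subalgebra.inclusion (P.Tate_mono hkj) y :=
    Subtype.ext (by
      rw [Subalgebra.coe_inclusion, Subalgebra.coe_inclusion, hkt, Subalgebra.coe_inclusion])
  rw [e]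
  exact h

theorem exists_transition_eq {i : P.Index} {x y : P.Level i} (h : P.toAlg i x = P.toAlg i y) :
    ∃ (j : P.Index) (h : i ≤ j), P.transition h x = P.transition h y := by
  obtain ⟨j, hj, h⟩ := P.exists_transition_eq_zero (i := i) (x := x - y) (by
    rw [map_sub, h, sub_self])
  exact ⟨j, hj, by rwa [map_sub, sub_eq_zero] at h⟩

theorem exists_forall_le {ι : Type*} [Finite ι] {i : P.Index} {Q : ι → P.Index → Prop}
    (hQ : ∀ a j k, j ≤ k → Q a j → Q a k) (h : ∀ a, ∃ j, i ≤ j ∧ Q a j) :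
    ∃ j, i ≤ j ∧ ∀ a, Q a j := by
  choose j _ h2 using h
  obtain ⟨M, hM⟩ := (Set.finite_range j).bddAbove
  obtain ⟨k, hk1, hk2⟩ := exists_ge_ge M i
  exact ⟨k, hk2, fun a => hQ a _ _ ((hM ⟨a, rfl⟩).trans hk1) (h2 a)⟩

variable [CompleteSpace K]

instance (i : P.Index) : Fact (∀ k, 0 < P.rad i k) := ⟨fun k => (P.rad_spec i k).1.1⟩

theorem residuallyFinite_level (i : P.Index) : ResiduallyFinite K (P.Level i) :=
  Tate.residuallyFinite_of_surjective (fun k => (P.rad_spec i k).1)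
    (Ideal.Quotient.mkₐ_surjective K _)

theorem residuallyFinite (P : FinPresentation A) : ResiduallyFinite K A :=
  QuasiWashnitzer.residuallyFinite_of_surjective P.isRadius P.surjective

/-- Each of the finitely many generators of the kernel dies at some later index, so the whole kernel
dies at a common one. -/
theorem exists_ker_le (i : P.Index) : ∃ (j : P.Index) (h : i ≤ j), ∀ x : P.Level i,
    P.toAlg i x = 0 → P.transition h x = 0 := by
  have := Tate.isNoetherianRing (K := K) (ρ := P.rad i)
  obtain ⟨s, hs⟩ := (isNoetherianRing_iff_ideal_fg (P.Level i)).1 inferInstance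
    (RingHom.ker (P.toAlg i))
  obtain ⟨j, hij, hj⟩ := P.exists_forall_le (ι := s) (i := i)
    (Q := fun x j => ∃ h : i ≤ j, P.transition h x.1 = 0)
    (fun x j k hjk ⟨hij, h⟩ => ⟨hij.trans hjk, by
      rw [← P.transition_transition hij hjk, h, map_zero]⟩)
    (fun x => by
      have hx : P.toAlg i x.1 = 0 := by
        have : x.1 ∈ RingHom.ker (P.toAlg i) := hs ▸ Ideal.subset_span x.2
        exact this
      obtain ⟨j, h, hj⟩ := P.exists_transition_eq_zero hx
      exact ⟨j, h, h, hj⟩)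
  refine ⟨j, hij, fun x hx => ?_⟩
  have hle : RingHom.ker (P.toAlg i) ≤ RingHom.ker (P.transition hij) := by
    rw [← hs, Ideal.span_le]
    intro y hy
    exact (hj ⟨y, hy⟩).2
  exact hle hx

/-- The pairs `(t, x)` with equal images in `A` form a closed subspace, because functionals
continuous on both factors separate `A`. Their projections cover `Tate K σ` as the level shrinks to
`r`, so by Baire one projection is onto. -/
theorem exists_range_le {n : ℕ} {σ : Fin n → ℝ} [Fact (∀ i, 0 < σ i)] (φ : Tate K σ →ₐ[K] A) :
    ∃ i : P.Index, ∀ t, ∃ x : Tate K (P.rad i), φ t = P.ofTate i x := by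
  -- A cofinal sequence of indices, as Baire needs countably many.
  choose i hi using fun k => P.exists_index (lt_approxRadius P.r k)
  let V : ∀ k, Submodule K (Tate K σ × Tate K (P.rad (i k))) := fun k =>
    LinearMap.eqLocus (φ.toLinearMap ∘ₗ LinearMap.fst K _ _)
      ((P.ofTate (i k)).toLinearMap ∘ₗ LinearMap.snd K _ _)
  have hVmem : ∀ k t x, (t, x) ∈ V k ↔ φ t = P.ofTate (i k) x := fun k t x => Iff.rfl
  obtain ⟨k, hk⟩ := exists_surjective_of_iUnion V (fun k => by
    rw [← isOpen_compl_iff, isOpen_iff_mem_nhds]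
    rintro ⟨t, x⟩ htx
    have hne : φ t ≠ P.ofTate (i k) x := htx
    obtain ⟨l, hl, hc⟩ := P.residuallyFinite.exists_functional (sub_ne_zero.2 hne)
    have hcont : Continuous fun z : Tate K σ × Tate K (P.rad (i k)) =>
        l (φ z.1) - l (P.ofTate (i k) z.2) :=
      ((hc φ).comp continuous_fst).sub ((hc (P.ofTate (i k))).comp continuous_snd)
    rw [map_sub] at hl
    filter_upwards [hcont.continuousAt.eventually_ne hl] with z hz hzV
    apply hz
    have : φ z.1 = P.ofTate (i k) z.2 := hzV
    rw [this, sub_self])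
    (fun t => by
      obtain ⟨p, hp⟩ := P.surjective (φ t)
      obtain ⟨k, hk⟩ := (eventually_mem_Tate p.2).exists
      refine ⟨k, ⟨p.1, Tate_anti K (fun l => (P.rad_spec (i k) l).1.1.le) (hi k) hk⟩, ?_⟩
      rw [hVmem]
      exact hp.symm)
  exact ⟨i k, hk⟩

/-- Every homomorphism from an affinoid algebra to a quasi-dagger algebra factors through one of the
affinoid algebras of the direct system. -/
theorem exists_factor {C : Type*} [CommRing C] [Algebra K C] {n : ℕ} {σ : Fin n → ℝ}
    [Fact (∀ i, 0 < σ i)] {π : Tate K σ →ₐ[K] C} (hπ : Function.Surjective π) (φ : C →ₐ[K] A) :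
    ∃ (i : P.Index) (ψ : C →ₐ[K] P.Level i), (P.toAlg i).comp ψ = φ := by
  obtain ⟨i, hi⟩ := P.exists_range_le (φ.comp π)
  have hi' : ∀ c, ∃ x : P.Level i, P.toAlg i x = φ c := fun c => by
    obtain ⟨t, rfl⟩ := hπ c
    obtain ⟨x, hx⟩ := hi t
    exact ⟨Ideal.Quotient.mk _ x, hx.symm⟩
  -- `s` is only a set-theoretic lift. Its failure to be a homomorphism lies in the kernel of `A(ρ')
  -- → A` and disappears at `j`.
  choose s hs using hi'
  obtain ⟨j, hij, hj⟩ := P.exists_ker_le i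
  have key : ∀ x y, P.toAlg i x = P.toAlg i y → P.transition hij x = P.transition hij y := by
    intro x y hxy
    rw [← sub_eq_zero, ← map_sub]
    exact hj _ (by rw [map_sub, hxy, sub_self])
  refine ⟨j,
    { toFun := fun c => P.transition hij (s c)
      map_one' := (key _ 1 (by rw [hs, map_one, map_one])).trans (map_one _)
      map_mul' := fun c d => (key _ (s c * s d) (by simp only [hs, map_mul])).trans (map_mul _ _ _)
      map_zero' := (key _ 0 (by rw [hs, map_zero, map_zero])).trans (map_zero _)
      map_add' := fun c d => (key _ (s c + s d) (by simp only [hs, map_add])).trans (map_add _ _ _)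
      commutes' := fun a => (key _ (algebraMap K _ a) (by
        rw [hs, AlgHom.commutes, AlgHom.commutes])).trans (AlgHom.commutes _ _) }, ?_⟩
  ext c
  exact (P.toAlg_transition hij (s c)).trans (hs c)

/-- The images of the finitely many variables agree at a later index, and they determine a
homomorphism to the residually finite `P.Level j`. -/
theorem exists_transition_comp_eq {C : Type*} [CommRing C] [Algebra K C] {n : ℕ} {σ : Fin n → ℝ}
    [Fact (∀ i, 0 < σ i)] {π : Tate K σ →ₐ[K] C} (hπ : Function.Surjective π) {i : P.Index}
    {ψ ψ' : C →ₐ[K] P.Level i} (h : (P.toAlg i).comp ψ = (P.toAlg i).comp ψ') :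
    ∃ (j : P.Index) (hij : i ≤ j), (P.transition hij).comp ψ = (P.transition hij).comp ψ' := by
  obtain ⟨j, hij, hj⟩ := P.exists_forall_le (ι := Fin n) (i := i)
    (Q := fun l j => ∃ h : i ≤ j, P.transition h (ψ (π (Tate.X K σ l))) =
      P.transition h (ψ' (π (Tate.X K σ l))))
    (fun x j k hjk ⟨hij, h⟩ => ⟨hij.trans hjk, by
      rw [← P.transition_transition hij hjk, h, P.transition_transition]⟩)
    (fun l => by
      obtain ⟨j, hj, h⟩ := P.exists_transition_eq (DFunLike.congr_fun h (π (Tate.X K σ l)))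
      exact ⟨j, hj, hj, h⟩)
  exact ⟨j, hij, algHom_ext_of_surjective (P.residuallyFinite_level j) hπ fun l => (hj l).2⟩

end FinPresentation


/-! ### Power series on polydiscs -/

section Identity

variable {K : Type u} [NontriviallyNormedField K] [IsUltrametricDist K] {n : ℕ} {ρ : Fin n → ℝ}

theorem infinite_closedBall {r : ℝ} (hr : 0 < r) : {x : K | ‖x‖ ≤ r}.Infinite := by
  have : {x : K | ‖x‖ ≤ r} ∈ 𝓝 (0 : K) := by
    filter_upwards [Metric.ball_mem_nhds (0 : K) hr] with x hx
    simpa using (mem_ball_zero_iff.1 hx).le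
  exact infinite_of_mem_nhds (0 : K) this

/-- A power series converging on a polydisc and vanishing at its points is zero. -/
theorem eq_zero_of_hasSum_zero (hρ : ∀ i, 0 < ρ i) {p : MvPowerSeries (Fin n) K}
    (hp : p ∈ Tate K ρ) (h : ∀ x : Fin n → K, (∀ i, ‖x i‖ ≤ ρ i) →
      HasSum (fun ν : Fin n →₀ ℕ => coeff ν p * ν.prod fun i k => x i ^ k) 0) : p = 0 := by
  classical
  have : Fact (∀ i, 0 < ρ i) := ⟨hρ⟩
  by_contra hp0
  obtain ⟨ν₀, hν₀⟩ : ∃ ν, coeff ν p ≠ 0 := by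
    by_contra! hcon
    exact hp0 (MvPowerSeries.ext fun ν => by simpa using hcon ν)
  -- `d` is the least total degree of a term of `p`, and `P` below is the homogeneous part of that
  -- degree.
  have hex : ∃ d, ∃ ν : Fin n →₀ ℕ, coeff ν p ≠ 0 ∧ ∑ i, ν i = d := ⟨_, ν₀, hν₀, rfl⟩
  obtain ⟨ν₁, hν₁, hd⟩ := Nat.find_spec hex
  set d := Nat.find hex
  have hmin : ∀ ν, coeff ν p ≠ 0 → d ≤ ∑ i, ν i := fun ν hν => Nat.find_min' hex ⟨ν, hν, rfl⟩
  let S : Finset (Fin n →₀ ℕ) := Finset.finsuppAntidiag Finset.univ d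
  have hS : ∀ ν, ν ∈ S ↔ ∑ i, ν i = d := fun ν => by simp [S, Finset.mem_finsuppAntidiag]
  let P : MvPolynomial (Fin n) K := ∑ ν ∈ S, MvPolynomial.monomial ν (coeff ν p)
  have hP : P ≠ 0 := by
    intro h0
    have h1 : P.coeff ν₁ = coeff ν₁ p := by
      simp only [P, MvPolynomial.coeff_sum, MvPolynomial.coeff_monomial]
      rw [Finset.sum_ite_eq' S ν₁, if_pos ((hS _).2 hd)]
    rw [h0, MvPolynomial.coeff_zero] at h1
    exact hν₁ h1.symm
  obtain ⟨y, hy, hPy⟩ : ∃ y : Fin n → K, (∀ i, ‖y i‖ ≤ ρ i) ∧ MvPolynomial.eval y P ≠ 0 := by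
    by_contra! hcon
    refine hP (MvPolynomial.funext_set (fun i => {x : K | ‖x‖ ≤ ρ i})
      (fun i => infinite_closedBall (hρ i)) fun y hy => ?_)
    rw [map_zero]
    exact hcon y fun i => hy i trivial
  have hPe : ∀ s : K, MvPolynomial.eval (fun i => s * y i) P = s ^ d * MvPolynomial.eval y P := by
    intro s
    simp only [P, map_sum, MvPolynomial.eval_monomial, Finset.mul_sum]
    refine Finset.sum_congr rfl fun ν hν => ?_
    rw [Finsupp.prod_fintype _ _ (by simp), Finsupp.prod_fintype _ _ (by simp)]
    simp only [mul_pow, Finset.prod_mul_distrib, Finset.prod_pow_eq_pow_sum, (hS ν).1 hν]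
    ring
  let t : Tate K ρ := ⟨p, hp⟩
  -- On the line `s y` the value `s ^ d P(y)` must cancel against terms of degree at least `d + 1`,
  -- of size at most `‖t‖ ‖s‖ ^ (d + 1)`. Letting `s → 0` contradicts `P(y) ≠ 0`.
  have key : ∀ s : K, s ≠ 0 → ‖s‖ ≤ 1 → ‖MvPolynomial.eval y P‖ ≤ ‖t‖ * ‖s‖ := by
    intro s hs0 hs
    have hs1 := h (fun i => s * y i) fun i => by
      rw [norm_mul]
      exact (mul_le_of_le_one_left (norm_nonneg _) hs).trans (hy i)
    have hs2 : HasSum (fun ν : Fin n →₀ ℕ => if ν ∈ S then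
        coeff ν p * ν.prod fun i k => (s * y i) ^ k else 0)
        (MvPolynomial.eval (fun i => s * y i) P) := by
      simp only [P, map_sum, MvPolynomial.eval_monomial]
      convert hasSum_sum_of_ne_finset_zero (s := S) (f := fun ν : Fin n →₀ ℕ => if ν ∈ S then
        coeff ν p * ν.prod fun i k => (s * y i) ^ k else 0) (fun ν hν => if_neg hν) using 1
      · exact Finset.sum_congr rfl fun ν hν => (if_pos hν).symm
      · infer_instance
    have hs3 := hs1.sub hs2
    rw [hPe] at hs3
    have hle : ‖(0 : K) - s ^ d * MvPolynomial.eval y P‖ ≤ ‖t‖ * ‖s‖ ^ (d + 1) := by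
      rw [← hs3.tsum_eq]
      refine IsUltrametricDist.norm_tsum_le_of_forall_le_of_nonneg (by positivity) fun ν => ?_
      by_cases hν : ν ∈ S
      · rw [if_pos hν, sub_self, norm_zero]; positivity
      rw [if_neg hν, sub_zero]
      by_cases h0 : coeff ν p = 0
      · rw [h0, zero_mul, norm_zero]; positivity
      have hdeg : d + 1 ≤ ∑ i, ν i :=
        Nat.lt_of_le_of_ne (hmin ν h0) fun h' => hν ((hS ν).2 h'.symm)
      rw [Finsupp.prod_fintype _ _ (by simp)]
      simp only [mul_pow, Finset.prod_mul_distrib, Finset.prod_pow_eq_pow_sum]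
      rw [norm_mul, norm_mul, mul_left_comm, mul_comm, norm_pow]
      refine mul_le_mul ?_ (pow_le_pow_of_le_one (norm_nonneg _) hs hdeg) (by positivity)
        (norm_nonneg _)
      refine le_trans (mul_le_mul_of_nonneg_left ?_ (norm_nonneg _)) (Tate.coeff_le t ν)
      rw [norm_prod, wt_eq_prod]
      refine Finset.prod_le_prod (fun i _ => norm_nonneg _) fun i _ => ?_
      rw [norm_pow]
      exact pow_le_pow_left₀ (norm_nonneg _) (hy i) _
    rw [zero_sub, norm_neg, norm_mul, norm_pow, pow_succ, mul_left_comm] at hle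
    exact le_of_mul_le_mul_left hle (pow_pos (norm_pos_iff.2 hs0) d)
  have hpos : 0 < ‖MvPolynomial.eval y P‖ := norm_pos_iff.2 hPy
  have ht : 0 < ‖t‖ := by
    obtain ⟨s, hs, hs'⟩ := NormedField.exists_norm_lt K one_pos
    have := hpos.trans_le (key s (norm_pos_iff.1 hs) hs'.le)
    exact pos_of_mul_pos_left this (norm_nonneg _)
  obtain ⟨s, hs, hs'⟩ := NormedField.exists_norm_lt K
    (lt_min one_pos (div_pos hpos ht))
  have h1 := key s (norm_pos_iff.1 hs) (hs'.le.trans (min_le_left _ _))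
  have h2 := hs'.trans_le (min_le_right _ _)
  rw [lt_div_iff₀ ht, mul_comm] at h2
  exact h1.not_gt h2

theorem HasEntireExpansion.unique {p q : MvPowerSeries (Fin n) K} {F : (Fin n → K) → K}
    (hp : HasEntireExpansion p F) (hq : HasEntireExpansion q F) : p = q := by
  rw [← sub_eq_zero]
  refine eq_zero_of_hasSum_zero (ρ := fun _ => 1) (fun _ => one_pos)
    (sub_mem (mem_Tate.2 (hp.1 _)) (mem_Tate.2 (hq.1 _))) fun x _ => ?_
  simpa [sub_mul] using (hp.2 x).sub (hq.2 x)

variable [CompleteSpace K] [Fact (∀ i, 0 < ρ i)]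

theorem Tate.hasSum_eval_point {x : Fin n → K} (hx : ∀ i, ‖x i‖ ≤ ρ i) (t : Tate K ρ) :
    HasSum (fun ν : Fin n →₀ ℕ => coeff ν t.1 * ν.prod fun i k => x i ^ k)
      (Tate.eval (K := K) hx t) :=
  Tate.hasSum_eval hx t

theorem Tate.ext_eval {s t : Tate K ρ} (h : ∀ (x : Fin n → K) (hx : ∀ i, ‖x i‖ ≤ ρ i),
    Tate.eval (K := K) hx s = Tate.eval (K := K) hx t) : s = t := by
  have h1 : (s - t).1 = 0 := eq_zero_of_hasSum_zero Fact.out (s - t).2 fun x hx => by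
    have := Tate.hasSum_eval_point hx (s - t)
    rwa [map_sub, h x hx, sub_self] at this
  rw [← sub_eq_zero]
  exact Subtype.ext h1

theorem HasEntireExpansion.eval_eq {p : MvPowerSeries (Fin n) K} {F : (Fin n → K) → K}
    (hp : HasEntireExpansion p F) (h : p ∈ Tate K ρ) {x : Fin n → K} (hx : ∀ i, ‖x i‖ ≤ ρ i) :
    Tate.eval (K := K) hx (⟨p, h⟩ : Tate K ρ) = F x :=
  (Tate.hasSum_eval_point hx _).unique (hp.2 x)

end Identity

/-! ### Pullback along entire maps -/

section Pullback

variable {K : Type u} [NontriviallyNormedField K] [IsUltrametricDist K] [CompleteSpace K]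

theorem residuallyFinite_of_finite {B : Type*} [CommRing B] [Algebra K B] [Module.Finite K B] :
    ResiduallyFinite K B := fun _ hb => ⟨⊥, by simpa using hb, inferInstance⟩

theorem Tate.residuallyFinite {n : ℕ} {ρ : Fin n → ℝ} (h : ∀ i, IsRadius K (ρ i)) :
    ResiduallyFinite K (Tate K ρ) :=
  Tate.residuallyFinite_of_surjective h (π := AlgHom.id K _) Function.surjective_id

variable {n m l : ℕ} {ρ : Fin n → ℝ} {σ : Fin m → ℝ} {τ : Fin l → ℝ} [Fact (∀ i, 0 < ρ i)]
  [Fact (∀ i, 0 < σ i)] [Fact (∀ i, 0 < τ i)]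

/-- `h` is the pullback of functions along the entire map `g`, which maps the polydisc of radius `ρ`
to that of radius `σ`. -/
def IsPullback (g : (Fin n → K) → (Fin m → K)) (h : Tate K σ →ₐ[K] Tate K ρ) : Prop :=
  ∀ j, HasEntireExpansion (h (Tate.X K σ j)).1 (fun x => g x j) ∧ ‖h (Tate.X K σ j)‖ ≤ σ j

/-- The definition only constrains the images of the variables; uniqueness of homomorphisms
identifies `h` with evaluation, and thereby makes it contractive. -/
theorem IsPullback.eq_eval (hρ : ∀ i, IsRadius K (ρ i)) {g : (Fin n → K) → (Fin m → K)}
    {h : Tate K σ →ₐ[K] Tate K ρ} (hg : IsPullback g h) : h = Tate.eval fun j => (hg j).2 :=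
  Tate.algHom_ext (Tate.residuallyFinite hρ) fun i => (Tate.eval_X (fun j => (hg j).2) i).symm

theorem IsPullback.norm_le (hρ : ∀ i, IsRadius K (ρ i)) {g : (Fin n → K) → (Fin m → K)}
    {h : Tate K σ →ₐ[K] Tate K ρ} (hg : IsPullback g h) (t : Tate K σ) : ‖h t‖ ≤ ‖t‖ := by
  rw [hg.eq_eval hρ]
  exact Tate.norm_eval_le _ t

theorem IsPullback.unique (hρ : ∀ i, IsRadius K (ρ i)) {g : (Fin n → K) → (Fin m → K)}
    {h h' : Tate K σ →ₐ[K] Tate K ρ} (hg : IsPullback g h) (hg' : IsPullback g h') : h = h' :=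
  Tate.algHom_ext (Tate.residuallyFinite hρ) fun i => Subtype.ext ((hg i).1.unique (hg' i).1)

theorem IsPullback.norm_apply_le {g : (Fin n → K) → (Fin m → K)}
    {h : Tate K σ →ₐ[K] Tate K ρ} (hg : IsPullback g h) {x : Fin n → K} (hx : ∀ i, ‖x i‖ ≤ ρ i)
    (j : Fin m) : ‖g x j‖ ≤ σ j := by
  rw [← (hg j).1.eval_eq (h (Tate.X K σ j)).2 hx]
  exact (Tate.norm_eval_le hx _).trans (hg j).2

theorem IsPullback.eval {g : (Fin n → K) → (Fin m → K)}
    {h : Tate K σ →ₐ[K] Tate K ρ} (hg : IsPullback g h) {x : Fin n → K} (hx : ∀ i, ‖x i‖ ≤ ρ i)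
    (t : Tate K σ) :
    Tate.eval (K := K) hx (h t) = Tate.eval (K := K) (hg.norm_apply_le hx) t := by
  have : (Tate.eval (K := K) hx).comp h = Tate.eval (K := K) (hg.norm_apply_le hx) :=
    Tate.algHom_ext residuallyFinite_of_finite fun j => by
      rw [Tate.eval_X]
      exact (hg j).1.eval_eq (h (Tate.X K σ j)).2 hx
  exact DFunLike.congr_fun this t

/-- `h t` and the expansion of the entire composite have the same value at every point of the
polydisc, so the identity theorem makes them equal. -/
theorem IsPullback.hasEntireExpansion {g : (Fin n → K) → (Fin m → K)}
    {h : Tate K σ →ₐ[K] Tate K ρ} (hg : IsPullback g h) {t : Tate K σ} {F : (Fin m → K) → K}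
    (ht : HasEntireExpansion t.1 F) : HasEntireExpansion (h t).1 (fun x => F (g x)) := by
  obtain ⟨q, hq⟩ := IsEntire.comp ⟨_, ht⟩ fun j => ⟨_, (hg j).1⟩
  have hq' : q ∈ Tate K ρ := hq.1 ρ
  have : h t = ⟨q, hq'⟩ := Tate.ext_eval fun x hx => by
    rw [hg.eval hx, hq.eval_eq hq' hx]
    exact ht.eval_eq t.2 (hg.norm_apply_le hx)
  rw [this]
  exact hq

theorem IsPullback.comp (hτ : ∀ i, IsRadius K (τ i)) {g : (Fin n → K) → (Fin m → K)}
    {f : (Fin l → K) → (Fin n → K)} {h : Tate K σ →ₐ[K] Tate K ρ} {h' : Tate K ρ →ₐ[K] Tate K τ}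
    (hg : IsPullback g h) (hf : IsPullback f h') : IsPullback (fun x => g (f x)) (h'.comp h) :=
  fun j => ⟨hf.hasEntireExpansion (hg j).1, (hf.norm_le hτ _).trans (hg j).2⟩

theorem hasEntireExpansion_X (j : Fin n) :
    HasEntireExpansion (Tate.X K ρ j).1 (fun x => x j) := by
  classical
  refine ⟨fun c => isRestricted_monomial c _ _, fun x => ?_⟩
  have h := hasSum_single (f := fun ν : Fin n →₀ ℕ =>
      coeff ν (Tate.X K ρ j).1 * ν.prod (fun i k => x i ^ k))
      (Finsupp.single j 1) (fun ν hν => by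
        rw [Tate.X, Tate.coeff_mono, if_neg hν, zero_mul])
  simpa [Tate.X, Tate.coeff_mono] using h

theorem isPullback_inclusion {ρ' : Fin n → ℝ} [Fact (∀ i, 0 < ρ' i)] (h : ∀ i, ρ i ≤ ρ' i) :
    IsPullback (fun x => x) (Subalgebra.inclusion (Tate_anti K
      (fun i => ((Fact.out : ∀ i, 0 < ρ i) i).le) h) : Tate K ρ' →ₐ[K] Tate K ρ) := fun j => by
  have : Subalgebra.inclusion (Tate_anti K (fun i => ((Fact.out : ∀ i, 0 < ρ i) i).le) h)
      (Tate.X K ρ' j) = Tate.X K ρ j := Subtype.ext rfl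
  rw [this, Tate.norm_X]
  exact ⟨hasEntireExpansion_X j, h j⟩

/-- `R` bounds the Gauss norms of the components of `g` on the source polydisc. -/
theorem exists_isPullback {g : (Fin n → K) → (Fin m → K)} (hg : ∀ j, IsEntire fun x => g x j)
    (ρ : Fin n → ℝ) [Fact (∀ i, 0 < ρ i)] : ∃ R : ℝ, ∀ (σ : Fin m → ℝ) [Fact (∀ i, 0 < σ i)],
      (∀ j, R ≤ σ j) → ∃ h : Tate K σ →ₐ[K] Tate K ρ, IsPullback g h := by
  choose p hp using hg
  let q : Fin m → Tate K ρ := fun j => ⟨p j, (hp j).1 ρ⟩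
  obtain ⟨R, hR⟩ := (Set.finite_range fun j => ‖q j‖).bddAbove
  refine ⟨R, fun σ _ hσ => ?_⟩
  have hb : ∀ j, ‖q j‖ ≤ σ j := fun j => (hR ⟨j, rfl⟩).trans (hσ j)
  refine ⟨Tate.eval hb, fun j => ?_⟩
  rw [Tate.eval_X]
  exact ⟨hp j, hb j⟩

end Pullback

/-! ### Entire functional calculus -/

section Calculus

variable {K : Type u} [NontriviallyNormedField K] [IsUltrametricDist K]
  {n : ℕ} {ρ : Fin n → ℝ} [Fact (∀ i, 0 < ρ i)] {C : Type u} [CommRing C] [Algebra K C]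
  {π : Tate K ρ →ₐ[K] C}

theorem residueNorm_le (t : Tate K ρ) : residueNorm π (π t) ≤ ‖t‖ :=
  csInf_le ⟨0, by rintro x ⟨t, -, rfl⟩; exact norm_nonneg t⟩ ⟨t, rfl, rfl⟩

theorem residueNorm_nonneg (c : C) : 0 ≤ residueNorm π c :=
  Real.sInf_nonneg (by rintro x ⟨t, -, rfl⟩; exact norm_nonneg t)

theorem exists_norm_lt_of_residueNorm_lt (hπ : Function.Surjective π) {c : C} {ε : ℝ}
    (h : residueNorm π c < ε) : ∃ t, π t = c ∧ ‖t‖ < ε := by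
  obtain ⟨t, ht⟩ := hπ c
  obtain ⟨x, ⟨s, hs, rfl⟩, hlt⟩ := exists_lt_of_csInf_lt (s := {x : ℝ | ∃ t : Tate K ρ, π t = c ∧
    x = gaussNorm (fun a : K => ‖a‖) ρ t.1}) ⟨_, t, ht, rfl⟩ h
  exact ⟨s, hs, hlt⟩

variable [CompleteSpace K]

/-- The kernel of `π` is closed, so the residue seminorm separates points. -/
theorem IsValue.unique (hπ : Function.Surjective π) {k : ℕ} {p : MvPowerSeries (Fin k) K}
    {b : Fin k → C} {c d : C} (hc : IsValue π p b c) (hd : IsValue π p b d) : c = d := by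
  obtain ⟨t, ht⟩ := hπ (c - d)
  have hmem : t ∈ RingHom.ker π := by
    rw [← SetLike.mem_coe, ← (Tate.isClosed_ideal (RingHom.ker π)).closure_eq,
      Metric.mem_closure_iff]
    intro ε hε
    obtain ⟨s, hs1, hs2⟩ := ((hc.eventually (gt_mem_nhds hε)).and
      (hd.eventually (gt_mem_nhds hε))).exists
    obtain ⟨x, hx, hxε⟩ := exists_norm_lt_of_residueNorm_lt hπ hs1
    obtain ⟨y, hy, hyε⟩ := exists_norm_lt_of_residueNorm_lt hπ hs2
    refine ⟨t - (x - y), ?_, ?_⟩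
    · rw [SetLike.mem_coe, RingHom.mem_ker, map_sub, map_sub, ht, hx, hy]
      abel
    · rw [dist_eq_norm, sub_sub_cancel]
      exact (norm_sub_le_max' x y).trans_lt (max_lt hxε hyε)
  rw [RingHom.mem_ker, ht, sub_eq_zero] at hmem
  exact hmem

/-- The functional calculus of a quotient of a Tate algebra. -/
theorem exists_calculus (hπ : Function.Surjective π) {k : ℕ} (b : Fin k → C) :
    ∃ R : ℝ, ∀ (σ : Fin k → ℝ) [Fact (∀ i, 0 < σ i)], (∀ j, R ≤ σ j) →
      ∃ φ : Tate K σ →ₐ[K] C, (∀ j, φ (Tate.X K σ j) = b j) ∧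
        ∀ t : Tate K σ, IsValue π t.1 b (φ t) := by
  choose y hy using fun j => hπ (b j)
  obtain ⟨R, hR⟩ := (Set.finite_range fun j => ‖y j‖).bddAbove
  refine ⟨R, fun σ _ hσ => ?_⟩
  have hb : ∀ j, ‖y j‖ ≤ σ j := fun j => (hR ⟨j, rfl⟩).trans (hσ j)
  have hX : ∀ j, Tate.eval hb (Tate.X K σ j) = y j := Tate.eval_X hb
  refine ⟨π.comp (Tate.eval hb), fun j => ?_, fun t => ?_⟩
  · rw [AlgHom.comp_apply, hX, hy]
  · have hsum := Tate.hasSum_mono t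
    have h0 : Tendsto (fun s : Finset (Fin k →₀ ℕ) =>
        ‖t - ∑ ν ∈ s, coeff ν t.1 • Tate.mono K σ ν‖) atTop (𝓝 0) := by
      have := (tendsto_const_nhds (x := t)).sub hsum
      rw [sub_self] at this
      simpa using this.norm
    refine squeeze_zero (fun s => residueNorm_nonneg _) (fun s => ?_) h0
    have e : π.comp (Tate.eval hb) t - ∑ ν ∈ s, coeff ν t.1 • ν.prod (fun i l => b i ^ l) =
        π (Tate.eval hb (t - ∑ ν ∈ s, coeff ν t.1 • Tate.mono K σ ν)) := by
      rw [map_sub, map_sub, map_sum, map_sum]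
      congr 1
      refine Finset.sum_congr rfl fun ν _ => ?_
      rw [map_smul, map_smul, Tate.map_mono, map_prod, Finsupp.prod_fintype _ _ (by simp)]
      simp only [hX, map_pow, hy]
    rw [e]
    exact (residueNorm_le _).trans (Tate.norm_eval_le hb _)

end Calculus


/-! ### Polydiscs exhausting affine space -/

section Discs

variable (K : Type u) [NontriviallyNormedField K] [IsUltrametricDist K]

/-- The absolute value of some element of `K`, larger than `1`. -/
noncomputable def bigRadius : ℝ := ‖(NormedField.exists_one_lt_norm K).choose‖

theorem one_lt_bigRadius : 1 < bigRadius K := (NormedField.exists_one_lt_norm K).choose_spec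

/-- The polyradius of the `N`-th polydisc. -/
noncomputable def discRadius (n N : ℕ) : Fin n → ℝ := fun _ => bigRadius K ^ N

theorem isRadius_discRadius (n N : ℕ) (i : Fin n) : IsRadius K (discRadius K n N i) :=
  ⟨pow_pos (one_pos.trans (one_lt_bigRadius K)) N, 1, one_pos,
    (NormedField.exists_one_lt_norm K).choose ^ N, by rw [pow_one, norm_pow]; rfl⟩

instance (n N : ℕ) : Fact (∀ i, 0 < discRadius K n N i) :=
  ⟨fun i => (isRadius_discRadius K n N i).1⟩

variable {K}

theorem discRadius_mono {n N N' : ℕ} (h : N ≤ N') (i : Fin n) :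
    discRadius K n N i ≤ discRadius K n N' i :=
  pow_le_pow_right₀ (one_lt_bigRadius K).le h

theorem exists_le_discRadius (n : ℕ) (R : ℝ) : ∃ N, ∀ N' ≥ N, ∀ i, R ≤ discRadius K n N' i := by
  obtain ⟨N, hN⟩ := pow_unbounded_of_one_lt R (one_lt_bigRadius K)
  exact ⟨N, fun N' h i => hN.le.trans (discRadius_mono h i)⟩

variable (K) in
/-- The `N`-th polydisc, given by its affinoid algebra. -/
noncomputable def disc (n N : ℕ) : Affinoid K :=
  ⟨CommAlgCat.of K (Tate K (discRadius K n N)), n, discRadius K n N, isRadius_discRadius K n N,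
    AlgHom.id K _, Function.surjective_id⟩

/-- The homomorphism underlying a morphism of affinoid algebras. -/
abbrev Affinoid.algHom {C D : Affinoid K} (h : C ⟶ D) : C.obj →ₐ[K] D.obj := h.hom.hom

/-- A homomorphism as a morphism of affinoid algebras. -/
abbrev Affinoid.ofAlgHom {C D : Affinoid K} (h : C.obj →ₐ[K] D.obj) : C ⟶ D :=
  ObjectProperty.homMk (CommAlgCat.ofHom h)

theorem Affinoid.hom_ext {C D : Affinoid K} {h h' : C ⟶ D}
    (e : Affinoid.algHom h = Affinoid.algHom h') : h = h' :=
  ObjectProperty.hom_ext _ (CommAlgCat.hom_ext e)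

variable [CompleteSpace K]

/-- The morphism `h` between polydiscs is given by the entire map `g`. -/
def IsDiscPullback {n m N N' : ℕ} (g : (⟨n⟩ : AffineSpaces K) ⟶ ⟨m⟩) (h : disc K m N' ⟶ disc K n N) :
    Prop :=
  IsPullback g.toFun (Affinoid.algHom h : Tate K (discRadius K m N') →ₐ[K] Tate K (discRadius K n N))

theorem IsDiscPullback.unique {n m N N' : ℕ} {g : (⟨n⟩ : AffineSpaces K) ⟶ ⟨m⟩}
    {h h' : disc K m N' ⟶ disc K n N} (hg : IsDiscPullback g h) (hg' : IsDiscPullback g h') :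
    h = h' :=
  Affinoid.hom_ext (IsPullback.unique (isRadius_discRadius K n N) hg hg')

theorem IsDiscPullback.comp {n m l N N' N'' : ℕ} {f : (⟨l⟩ : AffineSpaces K) ⟶ ⟨n⟩}
    {g : (⟨n⟩ : AffineSpaces K) ⟶ ⟨m⟩} {h : disc K m N' ⟶ disc K n N}
    {h' : disc K n N ⟶ disc K l N''} (hg : IsDiscPullback g h) (hf : IsDiscPullback f h') :
    IsDiscPullback (f ≫ g) (h ≫ h') :=
  IsPullback.comp (isRadius_discRadius K l N'') hg hf

theorem exists_isDiscPullback {n m : ℕ} (g : (⟨n⟩ : AffineSpaces K) ⟶ ⟨m⟩) (N : ℕ) :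
    ∃ N', ∃ h : disc K m N' ⟶ disc K n N, IsDiscPullback g h := by
  obtain ⟨R, hR⟩ := exists_isPullback g.isEntire (discRadius K n N)
  obtain ⟨N', hN'⟩ := exists_le_discRadius (K := K) m R
  obtain ⟨h, hh⟩ := hR (discRadius K m N') (hN' N' le_rfl)
  exact ⟨N', Affinoid.ofAlgHom h, hh⟩

/-- The inclusion of a polydisc in a larger one. -/
noncomputable def discRes (n : ℕ) {N N' : ℕ} (h : N ≤ N') : disc K n N' ⟶ disc K n N :=
  Affinoid.ofAlgHom (C := disc K n N') (D := disc K n N) (Subalgebra.inclusion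
    (Tate_anti K (fun i => (isRadius_discRadius K n N i).1.le) (discRadius_mono h)))

theorem isDiscPullback_discRes (n : ℕ) {N N' : ℕ} (h : N ≤ N') :
    IsDiscPullback (𝟙 _) (discRes (K := K) n h) :=
  isPullback_inclusion (discRadius_mono h)

theorem isDiscPullback_id (n N : ℕ) : IsDiscPullback (𝟙 _) (𝟙 (disc K n N)) := fun j =>
  ⟨hasEntireExpansion_X j, (Tate.norm_X j).le⟩

theorem IsDiscPullback.comp_discRes {n m N N' N'' : ℕ} {g : (⟨n⟩ : AffineSpaces K) ⟶ ⟨m⟩}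
    {h : disc K m N' ⟶ disc K n N} (hg : IsDiscPullback g h) (hle : N' ≤ N'') :
    IsDiscPullback g (discRes m hle ≫ h) := by
  have := (isDiscPullback_discRes m hle).comp hg
  rwa [Category.comp_id] at this

theorem IsDiscPullback.discRes_comp {n m N N' N'' : ℕ} {g : (⟨n⟩ : AffineSpaces K) ⟶ ⟨m⟩}
    {h : disc K m N' ⟶ disc K n N} (hg : IsDiscPullback g h) (hle : N'' ≤ N) :
    IsDiscPullback g (h ≫ discRes n hle) := by
  have := hg.comp (isDiscPullback_discRes n hle)
  rwa [Category.id_comp] at this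

theorem discRes_discRes (n : ℕ) {N N' N'' : ℕ} (h : N ≤ N') (h' : N' ≤ N'') :
    discRes (K := K) n h' ≫ discRes n h = discRes n (h.trans h') :=
  ((isDiscPullback_discRes n h).comp_discRes h').unique (isDiscPullback_discRes n _)

variable (K) in
/-- The direct system of polydiscs exhausting affine space. -/
noncomputable def discFunctor (n : ℕ) : ℕ ⥤ (Affinoid K)ᵒᵖ where
  obj N := Opposite.op (disc K n N)
  map h := (discRes n h.le).op
  map_id N := congrArg Quiver.Hom.op
    ((isDiscPullback_discRes n le_rfl).unique (isDiscPullback_id n N))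
  map_comp h h' := by
    rw [← op_comp, discRes_discRes]

end Discs


/-! ### The EFC algebra of a presheaf on affinoid spaces -/

section Germs

variable {K : Type u} [NontriviallyNormedField K] [IsUltrametricDist K] [CompleteSpace K]

/-- The functor sending a presheaf to its germs along the polydiscs exhausting `𝔸ⁿ`. -/
noncomputable abbrev germFunctor (n : ℕ) : ((Affinoid K)ᵒᵖ ⥤ Type u) ⥤ Type u :=
  (Functor.whiskeringLeft _ _ _).obj (discFunctor K n) ⋙ colim

variable {X Y : (Affinoid K)ᵒᵖ ⥤ Type u}

/-- The germ of a section over a polydisc. -/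
noncomputable def germ {n : ℕ} (N : ℕ) (x : X.obj (Opposite.op (disc K n N))) :
    (germFunctor n).obj X :=
  colimit.ι (discFunctor K n ⋙ X) N x

theorem exists_germ {n : ℕ} (z : (germFunctor n).obj X) : ∃ N x, germ (X := X) (n := n) N x = z :=
  Types.jointly_surjective' z

theorem germ_eq_iff {n N N' : ℕ} {x : X.obj (Opposite.op (disc K n N))}
    {y : X.obj (Opposite.op (disc K n N'))} : germ N x = germ N' y ↔
      ∃ (M : ℕ) (h : N ≤ M) (h' : N' ≤ M),
        X.map (discRes n h).op x = X.map (discRes n h').op y := by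
  refine (Types.FilteredColimit.colimit_eq_iff (discFunctor K n ⋙ X)).trans ?_
  exact ⟨fun ⟨M, f, g, h⟩ => ⟨M, f.le, g.le, h⟩, fun ⟨M, f, g, h⟩ => ⟨M, homOfLE f, homOfLE g, h⟩⟩

theorem germFunctor_map_germ {n N : ℕ} (α : X ⟶ Y) (x : X.obj (Opposite.op (disc K n N))) :
    (germFunctor n).map α (germ N x) = germ N (α.app _ x) :=
  ConcreteCategory.congr_hom (ι_colimMap (Functor.whiskerLeft (discFunctor K n) α) N) x

/-- Pullbacks along one entire map agree once restricted from a common larger target disc, so the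
arbitrary choice of radius in `germMap` is harmless. -/
theorem germ_pullback_eq {n m N N₁ N₂ : ℕ} {g : (⟨n⟩ : AffineSpaces K) ⟶ ⟨m⟩}
    {h₁ : disc K m N₁ ⟶ disc K n N} {h₂ : disc K m N₂ ⟶ disc K n N} (hg₁ : IsDiscPullback g h₁)
    (hg₂ : IsDiscPullback g h₂) (x : X.obj (Opposite.op (disc K n N))) :
    germ N₁ (X.map h₁.op x) = germ N₂ (X.map h₂.op x) := by
  refine germ_eq_iff.2 ⟨max N₁ N₂, le_max_left _ _, le_max_right _ _, ?_⟩
  rw [← Functor.map_comp_apply, ← Functor.map_comp_apply, ← op_comp, ← op_comp,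
    (hg₁.comp_discRes (le_max_left N₁ N₂)).unique (hg₂.comp_discRes (le_max_right N₁ N₂))]

/-- The action of an entire map on germs. -/
noncomputable def germMap {n m : ℕ} (g : (⟨n⟩ : AffineSpaces K) ⟶ ⟨m⟩)
    (X : (Affinoid K)ᵒᵖ ⥤ Type u) : (germFunctor n).obj X ⟶ (germFunctor m).obj X :=
  colimit.desc (discFunctor K n ⋙ X) (Cocone.mk ((germFunctor m).obj X)
    { app := fun N => ↾fun x => germ (exists_isDiscPullback g N).choose
        (X.map (exists_isDiscPullback g N).choose_spec.choose.op x)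
      naturality := fun N N' h => by
        have h1 := (exists_isDiscPullback g N).choose_spec.choose_spec
        have h2 := (exists_isDiscPullback g N').choose_spec.choose_spec
        have key : ∀ x : X.obj (Opposite.op (disc K n N)),
            germ _ (X.map (exists_isDiscPullback g N').choose_spec.choose.op
              (X.map (discRes n h.le).op x)) =
            germ _ (X.map (exists_isDiscPullback g N).choose_spec.choose.op x) := fun x => by
          rw [← germ_pullback_eq (h2.discRes_comp h.le) h1 x, op_comp, Functor.map_comp_apply]
        ext x
        exact key x })

theorem germMap_germ {n m N N' : ℕ} {g : (⟨n⟩ : AffineSpaces K) ⟶ ⟨m⟩}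
    {h : disc K m N' ⟶ disc K n N} (hg : IsDiscPullback g h)
    (x : X.obj (Opposite.op (disc K n N))) : germMap g X (germ N x) = germ N' (X.map h.op x) := by
  refine (ConcreteCategory.congr_hom (colimit.ι_desc (F := discFunctor K n ⋙ X) _ N) x).trans ?_
  exact germ_pullback_eq (exists_isDiscPullback g N).choose_spec.choose_spec hg x

variable (K) in
/-- The functor sending an affine space to the functor of germs along the polydiscs exhausting it. -/
noncomputable def germs : AffineSpaces K ⥤ ((Affinoid K)ᵒᵖ ⥤ Type u) ⥤ Type u where
  obj A := germFunctor A.dim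
  map g :=
    { app := fun X => germMap g X
      naturality := fun X Y α => by
        ext z
        obtain ⟨N, x, rfl⟩ := exists_germ z
        obtain ⟨N', h, hg⟩ := exists_isDiscPullback g N
        change germMap g Y ((germFunctor _).map α (germ N x)) =
          (germFunctor _).map α (germMap g X (germ N x))
        rw [germFunctor_map_germ, germMap_germ hg,
          germMap_germ hg, germFunctor_map_germ, NatTrans.naturality_apply] }
  map_id A := by
    ext X z
    obtain ⟨N, x, rfl⟩ := exists_germ z
    refine (germMap_germ (isDiscPullback_id A.dim N) x).trans ?_
    rw [op_id, Functor.map_id_apply]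
    rfl
  map_comp f g := by
    ext X z
    obtain ⟨N, x, rfl⟩ := exists_germ z
    obtain ⟨N', h, hf⟩ := exists_isDiscPullback f N
    obtain ⟨N'', h', hg⟩ := exists_isDiscPullback g N'
    refine (germMap_germ (hg.comp hf) x).trans ?_
    change _ = germMap g X (germMap f X (germ N x))
    rw [germMap_germ hf, germMap_germ hg, op_comp, Functor.map_comp_apply]

variable (K) in
/-- The functor from presheaves on affinoid spaces to set-valued functors on affine spaces. -/
noncomputable def presheafToEFC : ((Affinoid K)ᵒᵖ ⥤ Type u) ⥤ AffineSpaces K ⥤ Type u :=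
  (germs K).flip

/-- At each affine space the functor is a precomposition followed by a colimit, and both commute
with colimits. -/
instance (J : Type*) [Category* J] [HasColimitsOfShape J (Type u)] :
    PreservesColimitsOfShape J (presheafToEFC K) :=
  preservesColimitsOfShape_of_evaluation _ _ fun A =>
    inferInstanceAs (PreservesColimitsOfShape J (germFunctor A.dim))

end Germs


/-! ### Products of affine spaces -/

section Products

variable {K : Type u} [NontriviallyNormedField K] [IsUltrametricDist K] [CompleteSpace K]

/-- The product of finitely many affine spaces. -/
def productCone {k : ℕ} (D : Discrete (Fin k) ⥤ AffineSpaces K) : Cone D where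
  pt := ⟨∑ j, (D.obj ⟨j⟩).dim⟩
  π := Discrete.natTrans fun ⟨j⟩ => AffineSpaces.Map.mk
    (fun x i => x (finSigmaFinEquiv (n := fun j => (D.obj ⟨j⟩).dim) ⟨j, i⟩))
    fun _ => isEntire_coord _

/-- `productCone` is a limit cone. -/
def productConeIsLimit {k : ℕ} (D : Discrete (Fin k) ⥤ AffineSpaces K) :
    IsLimit (productCone D) where
  lift s := AffineSpaces.Map.mk
    (fun x a => (s.π.app ⟨(finSigmaFinEquiv.symm a).1⟩).toFun x (finSigmaFinEquiv.symm a).2)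
    fun a => (s.π.app ⟨(finSigmaFinEquiv.symm a).1⟩).isEntire (finSigmaFinEquiv.symm a).2
  fac s := by
    rintro ⟨j⟩
    refine AffineSpaces.Map.ext (funext fun x => funext fun i => ?_)
    change (s.π.app ⟨(finSigmaFinEquiv.symm (finSigmaFinEquiv
      (n := fun j => (D.obj ⟨j⟩).dim) ⟨j, i⟩)).1⟩).toFun x _ = _
    rw [Equiv.symm_apply_apply]
  uniq s m hm := by
    refine AffineSpaces.Map.ext (funext fun x => funext fun a => ?_)
    obtain ⟨⟨j, i⟩, rfl⟩ := finSigmaFinEquiv.surjective a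
    change _ = (s.π.app ⟨(finSigmaFinEquiv.symm (finSigmaFinEquiv
      (n := fun j => (D.obj ⟨j⟩).dim) ⟨j, i⟩)).1⟩).toFun x _
    rw [Equiv.symm_apply_apply, ← hm ⟨j⟩]
    rfl

/-- A functor is an EFC algebra as soon as it turns the coordinates of affine spaces into
bijections. -/
theorem isEFC_of_bijective {F : AffineSpaces K ⥤ Type u}
    (h : ∀ n, Function.Bijective fun (z : F.obj ⟨n⟩) (i : Fin n) =>
      F.map (AffineSpaces.coord n i) z) : IsEFC K F where
  preserves k := ⟨fun {D} => by
    refine preservesLimit_of_preserves_limit_cone (productConeIsLimit D) ?_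
    refine ((Types.isLimit_iff _).2 fun s _ => ?_).some
    have hco : ∀ (j : Fin k) (i : Fin (D.obj ⟨j⟩).dim) (x : F.obj (productCone D).pt),
        F.map (AffineSpaces.coord _ i) (F.map ((productCone D).π.app ⟨j⟩) x) =
          F.map (AffineSpaces.coord _ (finSigmaFinEquiv
            (n := fun j => (D.obj ⟨j⟩).dim) ⟨j, i⟩)) x := fun j i x => by
      rw [← Functor.map_comp_apply]
      rfl
    let t : ∀ j : Fin k, F.obj ⟨(D.obj ⟨j⟩).dim⟩ := fun j => s ⟨j⟩
    obtain ⟨x, hx⟩ := (h _).2 fun a => F.map (AffineSpaces.coord _ (finSigmaFinEquiv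
      (n := fun j => (D.obj ⟨j⟩).dim).symm a).2) (t (finSigmaFinEquiv.symm a).1)
    refine ⟨x, fun ⟨j⟩ => (h _).1 (funext fun i => ?_), fun y hy => (h _).1 (funext fun a => ?_)⟩
    · refine (hco j i x).trans ((congrFun hx _).trans ?_)
      rw [Equiv.symm_apply_apply]
    · refine Eq.trans ?_ (congrFun hx a).symm
      obtain ⟨⟨j, i⟩, rfl⟩ := finSigmaFinEquiv.surjective a
      rw [Equiv.symm_apply_apply]
      refine (hco j i y).symm.trans ?_
      exact congrArg _ (hy ⟨j⟩)⟩

end Products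

/-! ### The EFC algebra of an algebra -/

section HomPresheaf

variable (K : Type u) [NontriviallyNormedField K] [IsUltrametricDist K]

/-- The presheaf of homomorphisms from affinoid algebras to an algebra. -/
def homPresheaf : CommAlgCat.{u} K ⥤ (Affinoid K)ᵒᵖ ⥤ Type u :=
  yoneda ⋙ (Functor.whiskeringLeft _ _ _).obj (IsAffinoid K).ι.op

/-- Homomorphisms from Tate algebras of large radius to `B` correspond to tuples of elements. -/
structure IsEvaluable (B : Type u) [CommRing B] [Algebra K B] : Prop where
  residuallyFinite : ResiduallyFinite K B
  exists_algHom : ∀ {n : ℕ} (b : Fin n → B), ∃ (N : ℕ) (φ : Tate K (discRadius K n N) →ₐ[K] B),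
    ∀ i, φ (Tate.X K _ i) = b i

variable {K} [CompleteSpace K]

theorem IsAffinoid.isEvaluable {C : CommAlgCat.{u} K} (h : IsAffinoid K C) : IsEvaluable K C where
  residuallyFinite := h.residuallyFinite
  exists_algHom {n} b := by
    obtain ⟨m, ρ, hρ, π, hπ⟩ := h
    have : Fact (∀ i, 0 < ρ i) := ⟨fun i => (hρ i).1⟩
    obtain ⟨R, hR⟩ := exists_calculus hπ b
    obtain ⟨N, hN⟩ := exists_le_discRadius (K := K) n R
    obtain ⟨φ, hφ, -⟩ := hR (discRadius K n N) (hN N le_rfl)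
    exact ⟨N, φ, hφ⟩

theorem FinPresentation.exists_level {A : CommAlgCat.{u} K} (P : FinPresentation A) {ι : Type*}
    [Finite ι] (a : ι → A) : ∃ (i : P.Index) (x : ι → P.Level i), ∀ k, P.toAlg i (x k) = a k := by
  obtain ⟨i₀⟩ := (inferInstance : Nonempty P.Index)
  obtain ⟨i, -, hi⟩ := P.exists_forall_le (ι := ι) (i := i₀)
    (Q := fun k i => ∃ x : P.Level i, P.toAlg i x = a k)
    (fun k i j hij ⟨x, hx⟩ => ⟨P.transition hij x, by rw [P.toAlg_transition, hx]⟩)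
    (fun k => by
      obtain ⟨i, x, hx⟩ := P.exists_toAlg_eq (a k)
      obtain ⟨j, hj, hij⟩ := exists_ge_ge i₀ i
      exact ⟨j, hj, P.transition hij x, by rw [P.toAlg_transition, hx]⟩)
  choose x hx using hi
  exact ⟨i, x, hx⟩

theorem FinPresentation.isAffinoid_level {A : CommAlgCat.{u} K} (P : FinPresentation A)
    (i : P.Index) : IsAffinoid K (CommAlgCat.of K (P.Level i)) := (P.system.obj i).property

theorem IsQuasiDagger.isEvaluable {A : CommAlgCat.{u} K} (h : IsQuasiDagger K A) :
    IsEvaluable K A where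
  residuallyFinite := h.residuallyFinite
  exists_algHom {n} b := by
    obtain ⟨P⟩ := FinPresentation.nonempty_of_isQuasiDagger h
    obtain ⟨i, x, hx⟩ := P.exists_level b
    obtain ⟨N, φ, hφ⟩ := (P.isAffinoid_level i).isEvaluable.exists_algHom x
    exact ⟨N, (P.toAlg i).comp φ, fun k => by rw [AlgHom.comp_apply, hφ, hx]⟩

/-- A homomorphism from the algebra of a disc as a section of the presheaf of homomorphisms. -/
noncomputable abbrev ofDisc {n N : ℕ} {B : CommAlgCat.{u} K} (φ : Tate K (discRadius K n N) →ₐ[K] B) :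
    ((homPresheaf K).obj B).obj (Opposite.op (disc K n N)) :=
  show CommAlgCat.of K (Tate K (discRadius K n N)) ⟶ B from CommAlgCat.ofHom φ

/-- The homomorphism underlying a section of the presheaf of homomorphisms. -/
noncomputable abbrev toAlgHom {n N : ℕ} {B : CommAlgCat.{u} K}
    (φ : ((homPresheaf K).obj B).obj (Opposite.op (disc K n N))) :
    Tate K (discRadius K n N) →ₐ[K] B :=
  CommAlgCat.Hom.hom φ

theorem homPresheaf_ext {n N : ℕ} {B : CommAlgCat.{u} K} (hB : ResiduallyFinite K B)
    {φ ψ : ((homPresheaf K).obj B).obj (Opposite.op (disc K n N))}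
    (h : ∀ i, toAlgHom φ (Tate.X K _ i) = toAlgHom ψ (Tate.X K _ i)) : φ = ψ :=
  CommAlgCat.hom_ext (Tate.algHom_ext hB h)

theorem toAlgHom_map_discRes {n N N' : ℕ} {B : CommAlgCat.{u} K} (h : N ≤ N')
    (φ : ((homPresheaf K).obj B).obj (Opposite.op (disc K n N))) (i : Fin n) :
    toAlgHom (((homPresheaf K).obj B).map (discRes n h).op φ) (Tate.X K _ i) =
      toAlgHom φ (Tate.X K _ i) := by
  refine congrArg (toAlgHom φ) (Subtype.ext ?_)
  exact ((isDiscPullback_discRes n h) i).1.unique (hasEntireExpansion_X (ρ := discRadius K n N) i)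

/-- The value of a germ on the affine line. -/
noncomputable def value (B : CommAlgCat.{u} K) :
    (germFunctor 1).obj ((homPresheaf K).obj B) ⟶ (forget (CommAlgCat.{u} K)).obj B :=
  colimit.desc (discFunctor K 1 ⋙ (homPresheaf K).obj B)
    (Cocone.mk ((forget (CommAlgCat.{u} K)).obj B)
    { app := fun N => ↾fun φ => toAlgHom (N := N) φ (Tate.X K _ 0)
      naturality := fun N N' h => by
        ext φ
        exact toAlgHom_map_discRes (B := B) h.le φ 0 })

theorem value_germ {B : CommAlgCat.{u} K} {N : ℕ}
    (φ : ((homPresheaf K).obj B).obj (Opposite.op (disc K 1 N))) :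
    value B (germ N φ) = toAlgHom φ (Tate.X K _ 0) :=
  ConcreteCategory.congr_hom
    (colimit.ι_desc (F := discFunctor K 1 ⋙ (homPresheaf K).obj B) _ N) φ

theorem value_germMap {B : CommAlgCat.{u} K} {n N : ℕ} (g : (⟨n⟩ : AffineSpaces K) ⟶ ⟨1⟩)
    {p : MvPowerSeries (Fin n) K} (hp : HasEntireExpansion p fun x => g.toFun x 0)
    (φ : ((homPresheaf K).obj B).obj (Opposite.op (disc K n N))) :
    value B (germMap g _ (germ N φ)) = toAlgHom φ ⟨p, hp.1 _⟩ := by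
  obtain ⟨N', h, hg⟩ := exists_isDiscPullback g N
  rw [germMap_germ hg, value_germ]
  exact congrArg (toAlgHom φ) (Subtype.ext ((hg 0).1.unique hp))

theorem value_germMap_coord {B : CommAlgCat.{u} K} {n N : ℕ} (i : Fin n)
    (φ : ((homPresheaf K).obj B).obj (Opposite.op (disc K n N))) :
    value B (germMap (AffineSpaces.coord n i) _ (germ N φ)) = toAlgHom φ (Tate.X K _ i) :=
  value_germMap (AffineSpaces.coord n i) (hasEntireExpansion_X (ρ := discRadius K n N) i) φ

theorem germ_ext {B : CommAlgCat.{u} K} (hB : IsEvaluable K B) {n N N' : ℕ}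
    {φ : ((homPresheaf K).obj B).obj (Opposite.op (disc K n N))}
    {ψ : ((homPresheaf K).obj B).obj (Opposite.op (disc K n N'))}
    (h : ∀ i, toAlgHom φ (Tate.X K _ i) = toAlgHom ψ (Tate.X K _ i)) : germ N φ = germ N' ψ := by
  refine germ_eq_iff.2 ⟨max N N', le_max_left _ _, le_max_right _ _, ?_⟩
  refine homPresheaf_ext hB.residuallyFinite fun i => ?_
  rw [toAlgHom_map_discRes, toAlgHom_map_discRes, h]

/-- A germ on the line is a homomorphism from the Tate algebra of a large disc. It is determined by
the image of the variable, and every element is such an image once the radius is large. -/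
theorem value_bijective {B : CommAlgCat.{u} K} (hB : IsEvaluable K B) :
    Function.Bijective (value B) := by
  refine ⟨fun z w h => ?_, fun b => ?_⟩
  · obtain ⟨N, φ, rfl⟩ := exists_germ z
    obtain ⟨N', ψ, rfl⟩ := exists_germ w
    rw [value_germ, value_germ] at h
    exact germ_ext hB fun i => by rw [Subsingleton.elim i 0]; exact h
  · obtain ⟨N, φ, hφ⟩ := hB.exists_algHom fun _ : Fin 1 => b
    exact ⟨germ N (ofDisc φ), (value_germ _).trans (hφ 0)⟩

/-- In the same way germs on `𝔸ⁿ` are `n`-tuples of elements, which is product preservation. -/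
theorem isEFC_homPresheaf {B : CommAlgCat.{u} K} (hB : IsEvaluable K B) :
    IsEFC K ((presheafToEFC K).obj ((homPresheaf K).obj B)) := by
  refine isEFC_of_bijective fun n => ⟨fun z w h => ?_, fun w => ?_⟩
  · obtain ⟨N, φ, rfl⟩ := exists_germ z
    obtain ⟨N', ψ, rfl⟩ := exists_germ w
    refine germ_ext hB fun i => ?_
    rw [← value_germMap_coord, ← value_germMap_coord]
    exact congrArg (value B) (congrFun h i)
  · obtain ⟨N, φ, hφ⟩ := hB.exists_algHom fun i => value B (w i)
    refine ⟨germ N (ofDisc φ), funext fun i => (value_bijective hB).1 ?_⟩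
    exact (value_germMap_coord i _).trans (hφ i)

end HomPresheaf


/-! ### Entire functional calculus -/

section Calculus

variable {K : Type u} [NontriviallyNormedField K] [IsUltrametricDist K] [CompleteSpace K]

/-- The germ `z` may be represented by the homomorphism that `exists_calculus` builds for `π`,
because both take the same values on the variables; that one is computed by convergent sums. -/
theorem isValue_value {C : CommAlgCat.{u} K} {n : ℕ} {ρ : Fin n → ℝ} (hρ : ∀ i, IsRadius K (ρ i))
    {π : Tate K ρ →ₐ[K] C} (hπ : Function.Surjective π) {k : ℕ}
    {g : (⟨k⟩ : AffineSpaces K) ⟶ ⟨1⟩} {p : MvPowerSeries (Fin k) K}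
    (hp : HasEntireExpansion p fun x => g.toFun x 0)
    (z : (germFunctor k).obj ((homPresheaf K).obj C)) :
    IsValue π p (fun i => value C (germMap (AffineSpaces.coord k i) _ z))
      (value C (germMap g _ z)) := by
  have : Fact (∀ i, 0 < ρ i) := ⟨fun i => (hρ i).1⟩
  obtain ⟨N, φ, rfl⟩ := exists_germ z
  obtain ⟨R, hR⟩ := exists_calculus hπ fun i => toAlgHom φ (Tate.X K _ i)
  obtain ⟨N', hN'⟩ := exists_le_discRadius (K := K) k R
  obtain ⟨ψ, hψ, hv⟩ := hR (discRadius K k N') (hN' N' le_rfl)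
  have hC : IsEvaluable K C := IsAffinoid.isEvaluable ⟨n, ρ, hρ, π, hπ⟩
  rw [germ_ext (ψ := ofDisc ψ) hC fun i => (hψ i).symm, value_germMap g hp]
  have hb : (fun i => value C (germMap (AffineSpaces.coord k i) _ (germ N' (ofDisc ψ)))) =
      fun i => toAlgHom φ (Tate.X K _ i) := funext fun i => (value_germMap_coord i _).trans (hψ i)
  rw [hb]
  exact hv ⟨p, hp.1 _⟩

/-- The germ `z` is represented by a calculus homomorphism into the level followed by `P.toAlg i`;
uniqueness of sums at that level identifies its value with `c`. -/
theorem FinPresentation.value_germMap_eq {A : CommAlgCat.{u} K} (P : FinPresentation A)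
    (i : P.Index) {k : ℕ} {g : (⟨k⟩ : AffineSpaces K) ⟶ ⟨1⟩} {p : MvPowerSeries (Fin k) K}
    (hp : HasEntireExpansion p fun x => g.toFun x 0)
    (z : (germFunctor k).obj ((homPresheaf K).obj A)) {b : Fin k → P.Level i} {c : P.Level i}
    (hb : ∀ j, value A (germMap (AffineSpaces.coord k j) _ z) = P.toAlg i (b j))
    (hc : IsValue (Ideal.Quotient.mkₐ K (spanIn (Tate K (P.rad i)) P.f)) p b c) :
    value A (germMap g _ z) = P.toAlg i c := by
  have hπ := Ideal.Quotient.mkₐ_surjective K (spanIn (Tate K (P.rad i)) P.f)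
  obtain ⟨R, hR⟩ := exists_calculus hπ b
  obtain ⟨N', hN'⟩ := exists_le_discRadius (K := K) k R
  obtain ⟨ψ, hψ, hv⟩ := hR (discRadius K k N') (hN' N' le_rfl)
  have hA : IsEvaluable K A := IsQuasiDagger.isEvaluable
    ⟨P.n, P.r, P.isRadius, P.π, P.surjective⟩
  obtain ⟨N, φ, rfl⟩ := exists_germ z
  rw [germ_ext (ψ := ofDisc ((P.toAlg i).comp ψ)) hA fun j => ?_, value_germMap g hp]
  · exact congrArg (P.toAlg i) (IsValue.unique hπ (hv ⟨p, hp.1 _⟩) hc)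
  · rw [← value_germMap_coord, hb, ← hψ]
    rfl

end Calculus

/-! ### Extension of the functional calculus to ind-objects -/

section IndObjects

variable (K : Type u) [NontriviallyNormedField K] [IsUltrametricDist K]

/-- The presheaf of homomorphisms to an affinoid algebra is representable. -/
noncomputable def yonedaIso : yoneda ≅ (IsAffinoid K).ι ⋙ homPresheaf K :=
  NatIso.ofComponents
    (fun C => NatIso.ofComponents
      (fun D => ((IsAffinoid K).fullyFaithfulι.homEquiv (X := D.unop) (Y := C)).toIso)
      fun _ => rfl)
    fun _ => rfl

variable [CompleteSpace K]

/-- An ind-object is a filtered colimit of representables, and finite products of sets commute with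
filtered colimits. -/
theorem isEFC_of_isIndObject {X : (Affinoid K)ᵒᵖ ⥤ Type u} (hX : IsIndObject X) :
    IsEFC K ((presheafToEFC K).obj X) := by
  let P := hX.presentation
  have h : ∀ i, IsEFC K ((P.F ⋙ yoneda ⋙ presheafToEFC K).obj i) := fun i =>
    ⟨fun n =>
      have : PreservesLimitsOfShape (Discrete (Fin n))
          ((presheafToEFC K).obj (((IsAffinoid K).ι ⋙ homPresheaf K).obj (P.F.obj i))) :=
        (isEFC_homPresheaf (IsAffinoid.isEvaluable (P.F.obj i).property)).preserves n
      preservesLimitsOfShape_of_natIso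
        ((presheafToEFC K).mapIso ((yonedaIso K).app (P.F.obj i))).symm⟩
  refine ⟨fun n => ?_⟩
  exact (ObjectProperty.preservesLimitsOfShape (Discrete (Fin n))).prop_of_isColimit
    (isColimitOfPreserves (presheafToEFC K) P.isColimit) fun i => (h i).preserves n

/-- The extension by filtered colimits of the entire functional calculus of affinoid algebras. -/
noncomputable def indToEFC : Ind (Affinoid K) ⥤ EFCAlg K :=
  (IsEFC K).lift (Ind.inclusion _ ⋙ presheafToEFC K) fun X =>
    isEFC_of_isIndObject K X.isIndObject_inclusion_obj

/-- Filtered colimits of ind-objects are computed among presheaves, and the inclusion of the full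
subcategory of EFC algebras reflects colimits. -/
instance : PreservesFilteredColimitsOfSize.{u, u} (indToEFC K) where
  preserves_filtered_colimits J _ _ := by
    have : PreservesColimitsOfShape J (indToEFC K ⋙ (IsEFC K).ι) :=
      inferInstanceAs (PreservesColimitsOfShape J (Ind.inclusion _ ⋙ presheafToEFC K))
    exact preservesColimitsOfShape_of_reflects_of_preserves (indToEFC K) (IsEFC K).ι

end IndObjects

/-! ### Underlying sets of the associated EFC algebras -/

section Underlying

variable {K : Type u} [NontriviallyNormedField K] [IsUltrametricDist K] [CompleteSpace K]

variable {D : Type*} [Category.{u} D] {F : D ⥤ Ind (Affinoid K)} {H : D ⥤ CommAlgCat.{u} K}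
  (a : F ⋙ Ind.inclusion (Affinoid K) ≅ H ⋙ homPresheaf K) (hH : ∀ d, IsEvaluable K (H.obj d))

theorem value_naturality {A B : CommAlgCat.{u} K} (f : A ⟶ B)
    (z : (germFunctor 1).obj ((homPresheaf K).obj A)) :
    value B ((germFunctor 1).map ((homPresheaf K).map f) z) = f.hom (value A z) := by
  obtain ⟨N, φ, rfl⟩ := exists_germ z
  rw [germFunctor_map_germ, value_germ, value_germ]
  rfl

/-- The underlying set of the EFC algebra of an ind-object corepresented by an algebra. -/
noncomputable def underlyingIso :
    (F ⋙ indToEFC K) ⋙ EFCAlg.underlying K ≅ H ⋙ forget (CommAlgCat.{u} K) :=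
  Functor.isoWhiskerRight a (germFunctor 1) ≪≫ NatIso.ofComponents
    (fun d => (Equiv.ofBijective _ (value_bijective (hH d))).toIso) (fun {d d'} f => by
      ext z
      exact value_naturality (H.map f) z)

theorem underlyingIso_hom_app_map (d : D) {k : ℕ} (g : (⟨k⟩ : AffineSpaces K) ⟶ ⟨1⟩)
    (z : ((F ⋙ indToEFC K).obj d).obj.obj ⟨k⟩) :
    (underlyingIso a hH).hom.app d (((F ⋙ indToEFC K).obj d).obj.map g z) =
      value (H.obj d) (germMap g _ ((germFunctor k).map (a.hom.app d) z)) :=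
  congrArg (value (H.obj d)) (NatTrans.naturality_apply ((germs K).map g) (a.hom.app d) z).symm

end Underlying


/-! ### Quasi-dagger algebras as ind-objects -/

section IndAffinoid

variable {K : Type u} [NontriviallyNormedField K] [IsUltrametricDist K]

namespace FinPresentation

variable {A : CommAlgCat.{u} K} (P : FinPresentation A)

/-- The section of the presheaf of homomorphisms given by `A(ρ') → A`. -/
noncomputable def levelSection (i : P.Index) :
    ((homPresheaf K).obj A).obj (Opposite.op (P.system.obj i)) :=
  CommAlgCat.ofHom (P.toAlg i)

/-- The cocone of presheaves given by the maps `A(ρ') → A`. -/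
noncomputable def presheafι :
    P.system ⋙ yoneda ⟶ (Functor.const P.Index).obj ((homPresheaf K).obj A) where
  app i := yonedaEquiv.symm (P.levelSection i)
  naturality i j h := by
    ext C ψ
    refine CommAlgCat.hom_ext (AlgHom.ext fun c => ?_)
    exact P.toAlg_transition h.le _

variable [CompleteSpace K]

/-- The presheaf of homomorphisms to `A` is the colimit of the affinoid algebras `A(ρ')`. -/
noncomputable def isColimitPresheafι :
    IsColimit (Cocone.mk ((homPresheaf K).obj A) P.presheafι) := by
  refine evaluationJointlyReflectsColimits _ fun C => ?_
  obtain ⟨⟨C, hC⟩⟩ := C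
  -- At each `C` there are two conditions: existence of a factorization through a level
  -- (`exists_factor`), and its uniqueness at a later index (`exists_transition_comp_eq`).
  refine Types.FilteredColimit.isColimitOf' _ _ (fun φ => ?_) fun i ψ ψ' h => ?_
  · obtain ⟨n, ρ, hρ, π, hπ⟩ := hC
    have : Fact (∀ i, 0 < ρ i) := ⟨fun i => (hρ i).1⟩
    obtain ⟨i, ψ, hψ⟩ := P.exists_factor hπ (CommAlgCat.Hom.hom φ)
    exact ⟨i, Affinoid.ofAlgHom (C := ⟨C, _⟩) (D := P.system.obj i) ψ,
      CommAlgCat.hom_ext hψ.symm⟩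
  · obtain ⟨n, ρ, hρ, π, hπ⟩ := hC
    have : Fact (∀ i, 0 < ρ i) := ⟨fun i => (hρ i).1⟩
    obtain ⟨j, hij, hj⟩ := P.exists_transition_comp_eq hπ (i := i)
      (ψ := Affinoid.algHom (D := P.system.obj i) ψ) (ψ' := Affinoid.algHom (D := P.system.obj i) ψ')
      (congrArg CommAlgCat.Hom.hom h)
    exact ⟨j, homOfLE hij, Affinoid.hom_ext hj⟩

/-- The polyradii form a type in the lowest universe; `AsSmall` lifts the index category to universe
`u`. -/
theorem isIndObject (P : FinPresentation A) : IsIndObject ((homPresheaf K).obj A) :=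
  .mk
    { I := AsSmall.{u} P.Index
      F := AsSmall.down ⋙ P.system
      ι := Functor.whiskerLeft AsSmall.down P.presheafι
      isColimit := P.isColimitPresheafι.whiskerEquivalence AsSmall.equiv.symm }

end FinPresentation

variable (K) [CompleteSpace K]

theorem isIndObject_restrictedYoneda (A : QDagger K) : IsIndObject ((restrictedYoneda K).obj A) :=
  (FinPresentation.nonempty_of_isQuasiDagger A.property).some.isIndObject

/-- The functor from quasi-dagger algebras to ind-objects of affinoid algebras. -/
noncomputable def toInd : QDagger K ⥤ Ind (Affinoid K) :=
  ObjectProperty.lift _ (restrictedYoneda K) (isIndObject_restrictedYoneda K) ⋙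
    (Ind.equivalence _).inverse

/-- The ind-object of `A` represents the homomorphisms from affinoid algebras to `A`. -/
noncomputable def toIndCompInclusion :
    toInd K ⋙ Ind.inclusion (Affinoid K) ≅ restrictedYoneda K :=
  Functor.isoWhiskerLeft
    (ObjectProperty.lift _ (restrictedYoneda K) (isIndObject_restrictedYoneda K))
    (Functor.isoWhiskerRight (Ind.equivalence _).counitIso (ObjectProperty.ι _))

namespace FinPresentation

variable {K} {A : QDagger K} (P : FinPresentation A.obj)

/-- The maps `A(ρ') → A` as morphisms of ind-objects. -/
noncomputable def indι : P.system ⋙ Ind.yoneda ⟶ (Functor.const P.Index).obj ((toInd K).obj A) where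
  app i := Ind.inclusion.fullyFaithful.preimage
    (Ind.yonedaCompInclusion.hom.app (P.system.obj i) ≫ P.presheafι.app i ≫
      (toIndCompInclusion K).inv.app A)
  naturality i j h := (Ind.inclusion (Affinoid K)).map_injective <| by
    have h1 := Ind.yonedaCompInclusion.hom.naturality (P.system.map h)
    have h2 := (P.presheafι.naturality h).trans (Category.comp_id _)
    rw [Functor.map_comp, Functor.FullyFaithful.map_preimage]
    refine (Category.assoc _ _ _).symm.trans ((congrArg (· ≫ P.presheafι.app j ≫
      (toIndCompInclusion K).inv.app A) h1).trans ((Category.assoc _ _ _).trans ?_))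
    refine Eq.trans ?_ ((Ind.inclusion.fullyFaithful.map_preimage _).symm.trans
      (congrArg (Ind.inclusion _).map (Category.comp_id _).symm))
    refine congrArg (_ ≫ ·) ((Category.assoc _ _ _).symm.trans ?_)
    exact congrArg (· ≫ (toIndCompInclusion K).inv.app A) h2

theorem inclusion_map_indι_app (i : P.Index) :
    (Ind.inclusion (Affinoid K)).map (P.indι.app i) =
      Ind.yonedaCompInclusion.hom.app (P.system.obj i) ≫ P.presheafι.app i ≫
        (toIndCompInclusion K).inv.app A :=
  Ind.inclusion.fullyFaithful.map_preimage _

/-- The ind-object of `A` is the colimit of the system of affinoid algebras `A(ρ')`. -/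
noncomputable def isColimitIndι : IsColimit (Cocone.mk ((toInd K).obj A) P.indι) := by
  refine isColimitOfReflects (Ind.inclusion (Affinoid K)) ?_
  refine IsColimit.ofIsoColimit ((IsColimit.precomposeHomEquiv
    (Functor.isoWhiskerLeft P.system Ind.yonedaCompInclusion) _).symm P.isColimitPresheafι)
    (Cocone.ext ((toIndCompInclusion K).app A).symm fun i => ?_)
  exact (Category.assoc _ _ _).trans (P.inclusion_map_indι_app i).symm

theorem yonedaEquiv_indι (i : P.Index) :
    yonedaEquiv (Ind.yonedaCompInclusion.inv.app (P.system.obj i) ≫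
      (Ind.inclusion (Affinoid K)).map (P.indι.app i) ≫ (toIndCompInclusion K).hom.app A) =
    CommAlgCat.ofHom (P.toAlg i) := by
  rw [inclusion_map_indι_app]
  simp only [Category.assoc]
  rw [Iso.inv_hom_id_app_assoc]
  exact yonedaEquiv.apply_symm_apply _

end FinPresentation

end IndAffinoid


/-! ### Full faithfulness -/

section FullyFaithful

variable {K : Type u} [NontriviallyNormedField K] [IsUltrametricDist K]

theorem hasEntireExpansion_mvPolynomial {k : ℕ} (q : MvPolynomial (Fin k) K) :
    HasEntireExpansion (q : MvPowerSeries (Fin k) K) fun x => MvPolynomial.eval x q := by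
  refine ⟨fun c => ?_, fun x => ?_⟩
  · refine tendsto_const_nhds.congr' ?_
    filter_upwards [q.support.finite_toSet.compl_mem_cofinite] with ν hν
    have : MvPolynomial.coeff ν q = 0 := MvPolynomial.notMem_support_iff.1 hν
    simp [this]
  · have h := hasSum_sum_of_ne_finset_zero (L := .unconditional _) (f := fun ν : Fin k →₀ ℕ =>
      coeff ν (q : MvPowerSeries (Fin k) K) * ν.prod fun i l => x i ^ l) (s := q.support)
      fun ν hν => by simp [MvPolynomial.notMem_support_iff.1 hν]
    simpa [MvPolynomial.eval_eq, Finsupp.prod] using h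

theorem Tate.algHom_mvPolynomial {k : ℕ} {ρ : Fin k → ℝ} {B : Type*} [CommRing B] [Algebra K B]
    (φ : Tate K ρ →ₐ[K] B) (q : MvPolynomial (Fin k) K) :
    φ ⟨q, (hasEntireExpansion_mvPolynomial q).1 ρ⟩ =
      MvPolynomial.aeval (fun i => φ (Tate.X K ρ i)) q := by
  have h : (Tate K ρ).val.comp (MvPolynomial.aeval (Tate.X K ρ)) =
      MvPolynomial.coeToMvPowerSeries.algHom K := by
    refine MvPolynomial.algHom_ext fun i => ?_
    rw [AlgHom.comp_apply, MvPolynomial.aeval_X, MvPolynomial.coeToMvPowerSeries.algHom_apply]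
    simp
    rfl
  have hq : MvPolynomial.aeval (Tate.X K ρ) q =
      ⟨q, (hasEntireExpansion_mvPolynomial q).1 ρ⟩ := Subtype.ext (by
    refine (DFunLike.congr_fun h q).trans ?_
    rw [MvPolynomial.coeToMvPowerSeries.algHom_apply]
    simp)
  rw [← hq, ← AlgHom.comp_apply, MvPolynomial.comp_aeval]

/-- A map commuting with polynomial operations is an algebra homomorphism. -/
theorem exists_algHom_of_aeval {A B : Type*} [CommRing A] [CommRing B] [Algebra K A] [Algebra K B]
    (ψ : A → B) (h : ∀ {k : ℕ} (q : MvPolynomial (Fin k) K) (a : Fin k → A),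
      ψ (MvPolynomial.aeval a q) = MvPolynomial.aeval (fun i => ψ (a i)) q) :
    ∃ f : A →ₐ[K] B, ⇑f = ψ := by
  refine ⟨AlgHom.mk' ⟨⟨⟨ψ, ?_⟩, fun a b => ?_⟩, ?_, fun a b => ?_⟩ fun c a => ?_, rfl⟩
  · simpa using h (1 : MvPolynomial (Fin 0) K) Fin.elim0
  · have := h (MvPolynomial.X 0 * MvPolynomial.X 1 : MvPolynomial (Fin 2) K) ![a, b]
    rw [map_mul, map_mul] at this
    simpa using this
  · simpa using h (0 : MvPolynomial (Fin 0) K) Fin.elim0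
  · have := h (MvPolynomial.X 0 + MvPolynomial.X 1 : MvPolynomial (Fin 2) K) ![a, b]
    rw [map_add, map_add] at this
    simpa using this
  · have := h (c • MvPolynomial.X 0 : MvPolynomial (Fin 1) K) ![a]
    rw [map_smul, map_smul] at this
    simpa using this

variable [CompleteSpace K]

/-- The morphism of affine spaces given by a polynomial. -/
noncomputable def polyMap {k : ℕ} (q : MvPolynomial (Fin k) K) : (⟨k⟩ : AffineSpaces K) ⟶ ⟨1⟩ :=
  AffineSpaces.Map.mk (fun x _ => MvPolynomial.eval x q) fun _ => ⟨q, hasEntireExpansion_mvPolynomial q⟩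

theorem value_germMap_polyMap {B : CommAlgCat.{u} K} {k : ℕ} (q : MvPolynomial (Fin k) K)
    (z : (germFunctor k).obj ((homPresheaf K).obj B)) :
    value B (germMap (polyMap q) _ z) =
      MvPolynomial.aeval (fun i => value B (germMap (AffineSpaces.coord k i) _ z)) q := by
  obtain ⟨N, φ, rfl⟩ := exists_germ z
  rw [value_germMap _ (hasEntireExpansion_mvPolynomial q), Tate.algHom_mvPolynomial]
  exact congrArg (fun b => MvPolynomial.aeval b q) (funext fun i => (value_germMap_coord i φ).symm)

theorem exists_germ_coord {B : CommAlgCat.{u} K} (hB : IsEvaluable K B) {k : ℕ} (b : Fin k → B) :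
    ∃ z, ∀ i, value B (germMap (AffineSpaces.coord k i) _ z) = b i := by
  obtain ⟨N, φ, hφ⟩ := hB.exists_algHom b
  exact ⟨germ N (ofDisc φ), fun i => (value_germMap_coord i _).trans (hφ i)⟩

theorem germ_coord_ext {B : CommAlgCat.{u} K} (hB : IsEvaluable K B) {k : ℕ}
    {z w : (germFunctor k).obj ((homPresheaf K).obj B)}
    (h : ∀ i, value B (germMap (AffineSpaces.coord k i) _ z) =
      value B (germMap (AffineSpaces.coord k i) _ w)) : z = w := by
  obtain ⟨N, φ, rfl⟩ := exists_germ z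
  obtain ⟨N', ψ, rfl⟩ := exists_germ w
  refine germ_ext hB fun i => ?_
  rw [← value_germMap_coord, ← value_germMap_coord, h]

variable {A B : CommAlgCat.{u} K}

/-- A morphism between the EFC algebras of `A` and `B` comes from an algebra homomorphism. -/
theorem exists_algHom_value (hA : IsEvaluable K A)
    (h : (presheafToEFC K).obj ((homPresheaf K).obj A) ⟶
      (presheafToEFC K).obj ((homPresheaf K).obj B)) :
    ∃ f : A →ₐ[K] B, ∀ z : (germFunctor 1).obj ((homPresheaf K).obj A),
      value B (h.app ⟨1⟩ z) = f (value A z) := by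
  let t : ∀ k, (germFunctor k).obj ((homPresheaf K).obj A) →
    (germFunctor k).obj ((homPresheaf K).obj B) := fun k z => h.app ⟨k⟩ z
  have ht : ∀ {k : ℕ} (g : (⟨k⟩ : AffineSpaces K) ⟶ ⟨1⟩) z,
      t 1 (germMap g _ z) = germMap g _ (t k z) := fun g z => NatTrans.naturality_apply h g z
  let s := Function.surjInv (value_bijective hA).2
  -- `ψ` is `h` on the affine line, transported through the bijection `value`. Naturality of `h`
  -- with respect to polynomial maps makes it an algebra homomorphism.
  let ψ : A → B := fun a => value B (t 1 (s a))
  have hψ : ∀ z, value B (t 1 z) = ψ (value A z) := fun z => by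
    have : s (value A z) = z := (value_bijective hA).1 (Function.surjInv_eq _ _)
    exact congrArg (fun w => value B (t 1 w)) this.symm
  have key : ∀ {k : ℕ} (q : MvPolynomial (Fin k) K) (a : Fin k → A),
      ψ (MvPolynomial.aeval a q) = MvPolynomial.aeval (fun i => ψ (a i)) q := fun {k} q a => by
    obtain ⟨z, hz⟩ := exists_germ_coord hA a
    obtain rfl : _ = a := funext hz
    refine (congrArg ψ (value_germMap_polyMap q z)).symm.trans ?_
    rw [← hψ, ht, value_germMap_polyMap]
    refine congrArg (fun b => MvPolynomial.aeval b q) (funext fun i => ?_)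
    rw [← ht, hψ]
  obtain ⟨f, hf⟩ := exists_algHom_of_aeval ψ key
  exact ⟨f, fun z => (hψ z).trans (congrFun hf _).symm⟩

/-- Pulling `φ` back along a homomorphism from a disc to `C` that sends the variable to `c` gives a
germ on the line. The value at `c` of the image of `φ` under `η` is read off from the image of this
germ. -/
theorem presheafToEFC_map_injective {η η' : (homPresheaf K).obj A ⟶ (homPresheaf K).obj B}
    (h : (presheafToEFC K).map η = (presheafToEFC K).map η') : η = η' := by
  have hg : ∀ z, (germFunctor 1).map η z = (germFunctor 1).map η' z :=
    fun z => ConcreteCategory.congr_hom (NatTrans.congr_app h ⟨1⟩) z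
  ext ⟨C⟩ φ
  refine CommAlgCat.hom_ext (AlgHom.ext fun c => ?_)
  obtain ⟨N, θ, hθ⟩ := C.property.isEvaluable.exists_algHom fun _ : Fin 1 => c
  let θ' : disc K 1 N ⟶ C := Affinoid.ofAlgHom (C := disc K 1 N) θ
  have key : ∀ η : (homPresheaf K).obj A ⟶ (homPresheaf K).obj B,
      CommAlgCat.Hom.hom (η.app (Opposite.op C) φ) c =
        value B ((germFunctor 1).map η (germ N (((homPresheaf K).obj A).map θ'.op φ))) := by
    intro η
    rw [germFunctor_map_germ, value_germ, NatTrans.naturality_apply, ← hθ 0]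
    rfl
  exact (key η).trans ((congrArg (value B) (hg _)).trans (key η').symm)

/-- The algebra homomorphism extracted on the line induces the given morphism on `𝔸¹`, hence on
every `𝔸ⁿ`, as germs there are determined by their coordinates. -/
instance : ((IsQuasiDagger K).ι ⋙ homPresheaf K ⋙ presheafToEFC K).Full where
  map_surjective {A B} h := by
    obtain ⟨f, hf⟩ := exists_algHom_value A.property.isEvaluable h
    refine ⟨ObjectProperty.homMk (CommAlgCat.ofHom f), ?_⟩
    have h1 : ∀ z : (germFunctor 1).obj ((homPresheaf K).obj A.obj),
        (germFunctor 1).map ((homPresheaf K).map (CommAlgCat.ofHom f)) z = h.app ⟨1⟩ z := fun z =>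
      (value_bijective B.property.isEvaluable).1 ((value_naturality _ z).trans (hf z).symm)
    ext ⟨n⟩ z
    refine germ_coord_ext B.property.isEvaluable fun i => congrArg (value B.obj) ?_
    refine Eq.trans ?_ ((h1 (germMap (AffineSpaces.coord n i) _ z)).trans ?_)
    · exact (NatTrans.naturality_apply ((germs K).map (AffineSpaces.coord n i))
        ((homPresheaf K).map (CommAlgCat.ofHom f)) z)
    exact NatTrans.naturality_apply h (AffineSpaces.coord n i) z

instance : ((IsQuasiDagger K).ι ⋙ homPresheaf K ⋙ presheafToEFC K).Faithful where
  map_injective {A B f f'} h := by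
    refine ObjectProperty.hom_ext _ (CommAlgCat.hom_ext (AlgHom.ext fun a => ?_))
    obtain ⟨z, rfl⟩ := (value_bijective A.property.isEvaluable).2 a
    refine (value_naturality f.hom z).symm.trans (Eq.trans ?_ (value_naturality f'.hom z))
    exact congrArg (value B.obj) (ConcreteCategory.congr_hom (NatTrans.congr_app h ⟨1⟩) z)

variable (K) in
/-- The EFC algebra of a quasi-dagger algebra in terms of its presheaf. -/
noncomputable def toIndIndToEFCIso : (toInd K ⋙ indToEFC K) ⋙ (IsEFC K).ι ≅
    (IsQuasiDagger K).ι ⋙ homPresheaf K ⋙ presheafToEFC K :=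
  Functor.isoWhiskerRight (toIndCompInclusion K) (presheafToEFC K)

instance : (toInd K ⋙ indToEFC K).Full :=
  Functor.Full.of_comp_faithful_iso (toIndIndToEFCIso K)

instance : (toInd K ⋙ indToEFC K).Faithful :=
  Functor.Faithful.of_comp_iso (toIndIndToEFCIso K)

/-- A map of presheaves and the homomorphism realizing its effect on germs induce the same map of
germs, so they coincide. -/
instance : (restrictedYoneda K).Full where
  map_surjective {A B} η := by
    obtain ⟨f, hf⟩ := ((IsQuasiDagger K).ι ⋙ homPresheaf K ⋙ presheafToEFC K).map_surjective
      (X := A) (Y := B) ((presheafToEFC K).map η)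
    exact ⟨f, presheafToEFC_map_injective hf⟩

instance : (toInd K).Full := Functor.Full.of_comp_faithful_iso (toIndCompInclusion K)

instance : (toInd K).Faithful := Functor.Faithful.of_comp _ (indToEFC K)

end FullyFaithful


/-! ### Identification of the functional calculi -/

section Underlying

variable (K : Type u) [NontriviallyNormedField K] [IsUltrametricDist K] [CompleteSpace K]

/-- The underlying set of the EFC algebra of an affinoid algebra. -/
noncomputable def affinoidUnderlyingIso :
    (Ind.yoneda ⋙ indToEFC K) ⋙ EFCAlg.underlying K ≅
      (IsAffinoid K).ι ⋙ forget (CommAlgCat.{u} K) :=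
  underlyingIso (Ind.yonedaCompInclusion ≪≫ yonedaIso K) fun C => C.property.isEvaluable

/-- The underlying set of the EFC algebra of a quasi-dagger algebra. -/
noncomputable def qdaggerUnderlyingIso :
    (toInd K ⋙ indToEFC K) ⋙ EFCAlg.underlying K ≅
      (IsQuasiDagger K).ι ⋙ forget (CommAlgCat.{u} K) :=
  underlyingIso (toIndCompInclusion K) fun A => A.property.isEvaluable

theorem isFunctionalCalculus_affinoidUnderlyingIso :
    IsFunctionalCalculus (Ind.yoneda ⋙ indToEFC K) (affinoidUnderlyingIso K) := by
  intro C n ρ π hρ hπ k g p hp z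
  have h := isValue_value hρ hπ hp ((germFunctor k).map
    ((Ind.yonedaCompInclusion ≪≫ yonedaIso K).hom.app C) z)
  have h1 : ∀ g : (⟨k⟩ : AffineSpaces K) ⟶ ⟨1⟩, (affinoidUnderlyingIso K).hom.app C
      (((Ind.yoneda ⋙ indToEFC K).obj C).obj.map g z) = _ := fun g =>
    underlyingIso_hom_app_map (Ind.yonedaCompInclusion ≪≫ yonedaIso K)
      (fun C => C.property.isEvaluable) C g z
  rw [h1, funext fun i => h1 (AffineSpaces.coord k i)]
  exact h

theorem isInducedCalculus_qdaggerUnderlyingIso :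
    IsInducedCalculus (toInd K ⋙ indToEFC K) (qdaggerUnderlyingIso K) := by
  intro A P i k g p hp z b c hb hc
  have h1 : ∀ g : (⟨k⟩ : AffineSpaces K) ⟶ ⟨1⟩, (qdaggerUnderlyingIso K).hom.app A
      (((toInd K ⋙ indToEFC K).obj A).obj.map g z) = _ := fun g =>
    underlyingIso_hom_app_map (toIndCompInclusion K) (fun A => A.property.isEvaluable) A g z
  exact (h1 g).trans (P.value_germMap_eq i hp _ (fun j => (h1 _).symm.trans (hb j)) hc)

end Underlying

end QuasiDagger

theorem mainTheorem11 (K : Type u) [NontriviallyNormedField K] [IsUltrametricDist K]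
    [CompleteSpace K] [CharZero K] :
    ∃ (G : QuasiDagger.QDagger K ⥤ Ind (QuasiDagger.Affinoid K))
      (e : G ⋙ Ind.inclusion (QuasiDagger.Affinoid K) ≅ QuasiDagger.restrictedYoneda K),
      G.Full ∧ G.Faithful ∧
      (∀ A : QuasiDagger.QDagger K, Nonempty (QuasiDagger.FinPresentation A.obj)) ∧
      (∀ (A : QuasiDagger.QDagger K) (P : QuasiDagger.FinPresentation A.obj),
        ∃ ι : P.system ⋙ Ind.yoneda ⟶ (Functor.const P.Index).obj (G.obj A),
          Nonempty (IsColimit (Cocone.mk (G.obj A) ι)) ∧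
          ∀ i : P.Index,
            yonedaEquiv (Ind.yonedaCompInclusion.inv.app (P.system.obj i) ≫
              (Ind.inclusion (QuasiDagger.Affinoid K)).map (ι.app i) ≫ e.hom.app A) =
            CommAlgCat.ofHom (P.toAlg i)) ∧
      ∃ (E : QuasiDagger.Affinoid K ⥤ QuasiDagger.EFCAlg K)
        (u : E ⋙ QuasiDagger.EFCAlg.underlying K ≅
          (QuasiDagger.IsAffinoid K).ι ⋙ forget (CommAlgCat.{u} K))
        (L : Ind (QuasiDagger.Affinoid K) ⥤ QuasiDagger.EFCAlg K)
        (v : (G ⋙ L) ⋙ QuasiDagger.EFCAlg.underlying K ≅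
          (QuasiDagger.IsQuasiDagger K).ι ⋙ forget (CommAlgCat.{u} K)),
        QuasiDagger.IsFunctionalCalculus E u ∧
        Nonempty (Ind.yoneda ⋙ L ≅ E) ∧
        PreservesFilteredColimitsOfSize.{u, u} L ∧
        QuasiDagger.IsInducedCalculus (G ⋙ L) v ∧
        (G ⋙ L).Full ∧ (G ⋙ L).Faithful := by
  refine ⟨QuasiDagger.toInd K, QuasiDagger.toIndCompInclusion K, inferInstance, inferInstance,
    fun A => QuasiDagger.FinPresentation.nonempty_of_isQuasiDagger A.property,
    fun A P => ⟨P.indι, ⟨P.isColimitIndι⟩, P.yonedaEquiv_indι⟩,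
    Ind.yoneda ⋙ QuasiDagger.indToEFC K, QuasiDagger.affinoidUnderlyingIso K,
    QuasiDagger.indToEFC K, QuasiDagger.qdaggerUnderlyingIso K,
    QuasiDagger.isFunctionalCalculus_affinoidUnderlyingIso K, ⟨Iso.refl _⟩, inferInstance,
    QuasiDagger.isInducedCalculus_qdaggerUnderlyingIso K, inferInstance, inferInstance⟩
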